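/- For $N\ge 1$ let $\hat U(N)$ be the set of signatures of length $N$, i.e. of $N$-tuples of integers $\lambda=(\lambda_1\ge\dots\ge\lambda_N)$. For $\lambda\in\hat U(N)$ let $$\chi^\lambda(u_1,\dots,u_N)=\frac{\det\big(u_i^{\lambda_j+N-j}\big)_{1\le i,j\le N}}{\prod_{1\le i<j\le N}(u_i-u_j)},\qquad u\in(\mathbb C\setminus\{0\})^N,$$ be the rational Schur function (a Laurent polynomial, extended by continuity to points with coinciding coordinates). For a probability measure $\varrho$ on $\hat U(N)$, its Schur generating function is $$S_\varrho(u_1,\dots,u_N)=\sum_{\lambda\in\hat U(N)}\varrho(\lambda)\,\frac{\chi^\lambda(u_1,\dots,u_N)}{\chi^\lambda(1^N)},\qquad 1^N=(1,\dots,1).$$ **Theorem.** For every $N$ let $\varrho(N)$ be a probability measure on $\hat U(N)$, and let $\Psi,\Phi$ be complex functions that are analytic in a neighborhood of $1$. Suppose that for every finite $r$ $$\lim_{N\to\infty}N\Big(\frac1N\log S_{\varrho(N)}(u_1,\dots,u_r,1^{N-r})-\sum_{i=1}^r\Psi(u_i)\Big)=\sum_{i=1}^r\Phi(u_i)$$ uniformly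 in a complex neighborhood of $1^r$, which may depend on $r$ but not on $N$ and may be taken to be a polydisc centered at $1^r$. Here it is understood that, for all sufficiently large $N$, the series defining $S_{\varrho(N)}(u_1,\dots,u_r,1^{N-r})$ converges absolutely in this neighborhood and $\log S_{\varrho(N)}$ is a holomorphic branch of the logarithm there, with value $0$ at $1^r$. Then, for every $k\in\mathbb N$, the series $\sum_{\lambda}\varrho(N)[\lambda]\sum_{i=1}^N\big(\frac{\lambda_i+N-i}{N}\big)^k$ converges absolutely for all sufficiently large $N$, and $$\lim_{N\to\infty}N\Big(\frac1N\sum_{\lambda\in\hat U(N)}\varrho(N)[\lambda]\sum_{i=1}^N\Big(\frac{\lambda_i+N-i}{N}\Big)^k-\mathbf m_k\Big)=\sum_{\pi\in NC(k)}\ \sum_{V\in\pi}\kappa^{(1)}_{|V|}\prod_{W\in\pi,\,W\ne V}\kappa^{(0)}_{|W|},$$ where $NC(k)$ is the set of non-crossing partitions of $\{1,\dots,k\}$, $$\mathbf m_k=\sum_{m=0}^k\frac{k!}{m!\,(m+1)!\,(k-m)!}\,\frac{d^m}{dx^m}\Big(x^k(\Psi'(x))^{k-m}\Big)\Big|_{x=1},$$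 and for every $n\ge1$ $$\kappa^{(0)}_n=\frac1{(n-1)!}\frac{d^n}{du^n}\Big(\Psi(e^u)+\log\frac{e^u-1}{u}\Big)\Big|_{u=0},\qquad \kappa^{(1)}_n=\frac1{(n-1)!}\frac{d^n}{du^n}\Big(\Phi(e^u)-\frac u2\Big)\Big|_{u=0},$$ with $\frac{e^u-1}{u}$ equal to $1$ at $u=0$ and the principal branch of the logarithm near $1$. -/

import Mathlib

open Filter Topology

noncomputable section

/-- The signatures of length `N`: weakly decreasing `N`-tuples of integers. -/
abbrev Signature (N : ℕ) : Type := {l : Fin N → ℤ // Antitone l}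

/-- The shifted coordinate `λ_i + N - i` (with `i = 1, …, N`); the index of `Fin N` starts at `0`. -/
def Signature.shifted {N : ℕ} (l : Signature N) (i : Fin N) : ℤ :=
  l.1 i + (N : ℤ) - 1 - (i : ℤ)

/-- The quotient `det (u_i ^ (λ_j + N - j)) / ∏_{i < j} (u_i - u_j)`, meaningful at points with
pairwise distinct coordinates. -/
def schurRatio {N : ℕ} (l : Signature N) (u : Fin N → ℂ) : ℂ :=
  (Matrix.of fun i j : Fin N => u i ^ l.shifted j).det /
    ∏ i : Fin N, ∏ j ∈ Finset.Ioi i, (u i - u j)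

/-- The rational Schur function `χ^λ` on `(ℂ \ {0})^N`: the quotient above is a Laurent polynomial,
and its value at a point with coinciding coordinates (such as `1^N`) is the limit of the quotient
along points with pairwise distinct coordinates. -/
def schurFun {N : ℕ} (l : Signature N) : (Fin N → ℂ) → ℂ :=
  extendFrom {u : Fin N → ℂ | Function.Injective u} (schurRatio l)

/-- The summand `ϱ(λ) χ^λ(u) / χ^λ(1^N)` of the Schur generating function. -/
def schurGenTerm {N : ℕ} (ρ : PMF (Signature N)) (u : Fin N → ℂ) (l : Signature N) : ℂ :=
  ((ρ l).toReal : ℂ) * (schurFun l u / schurFun l 1)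

/-- The Schur generating function of a probability measure on signatures of length `N`. -/
def schurGen {N : ℕ} (ρ : PMF (Signature N)) (u : Fin N → ℂ) : ℂ :=
  ∑' l : Signature N, schurGenTerm ρ u l

/-- The point `(u_1, …, u_r, 1^{N-r})` (used for `r ≤ N`). -/
def padOnes {r : ℕ} (N : ℕ) (u : Fin r → ℂ) (i : Fin N) : ℂ :=
  if h : (i : ℕ) < r then u ⟨i, h⟩ else 1

/-- For every `r`, `N (N⁻¹ log S_{ϱ(N)}(u_1, …, u_r, 1^{N-r}) - ∑ Ψ(u_i)) → ∑ Φ(u_i)` uniformly on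
a complex polydisc around `1^r` (the ball of `Fin r → ℂ` is for the sup norm). For all large `N` the
series defining `S_{ϱ(N)}` converges absolutely on the polydisc, and `log S_{ϱ(N)}` is the
holomorphic branch `L N` of the logarithm there that vanishes at `1^r`. -/
def SchurGenAsymptotics (ρ : (N : ℕ) → PMF (Signature N)) (Ψ Φ : ℂ → ℂ) : Prop :=
  ∀ r : ℕ, ∃ ε : ℝ, 0 < ε ∧ ∃ L : ℕ → (Fin r → ℂ) → ℂ,
    (∀ᶠ N : ℕ in atTop,
      (∀ u ∈ Metric.ball (1 : Fin r → ℂ) ε, Summable (schurGenTerm (ρ N) (padOnes N u))) ∧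
      AnalyticOnNhd ℂ (L N) (Metric.ball 1 ε) ∧
      L N 1 = 0 ∧
      ∀ u ∈ Metric.ball (1 : Fin r → ℂ) ε,
        Complex.exp (L N u) = schurGen (ρ N) (padOnes N u)) ∧
    TendstoUniformlyOn
      (fun (N : ℕ) (u : Fin r → ℂ) => (N : ℂ) * (1 / (N : ℂ) * L N u - ∑ i : Fin r, Ψ (u i)))
      (fun u : Fin r → ℂ => ∑ i : Fin r, Φ (u i)) atTop (Metric.ball 1 ε)

/-- The summand `ϱ(λ) ∑_i ((λ_i + N - i) / N)^k` of the expected moment. -/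
def momentTerm {N : ℕ} (ρ : PMF (Signature N)) (k : ℕ) (l : Signature N) : ℝ :=
  (ρ l).toReal * ∑ i : Fin N, ((l.shifted i : ℝ) / (N : ℝ)) ^ k

/-- The expected `k`-th moment of the measure `N⁻¹ ∑_i δ((λ_i + N - i) / N)`. -/
def expectedMoment {N : ℕ} (ρ : PMF (Signature N)) (k : ℕ) : ℝ :=
  1 / (N : ℝ) * ∑' l : Signature N, momentTerm ρ k l

/-- The moments `m_k` of the limiting measure. -/
def limitMoment (Ψ : ℂ → ℂ) (k : ℕ) : ℂ :=
  ∑ m ∈ Finset.range (k + 1),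
    (k.factorial : ℂ) / ((m.factorial : ℂ) * ((m + 1).factorial : ℂ) * ((k - m).factorial : ℂ)) *
      iteratedDeriv m (fun x : ℂ => x ^ k * deriv Ψ x ^ (k - m)) 1

/-- `κ⁽⁰⁾_n` for `n ≥ 1`. Here `dslope Complex.exp 0 u` is `(e^u - 1) / u` with value `1` at
`u = 0`, and `Complex.log` is analytic near its values for small `u`. -/
def kappaZero (Ψ : ℂ → ℂ) (n : ℕ) : ℂ :=
  1 / ((n - 1).factorial : ℂ) *
    iteratedDeriv n
      (fun u : ℂ => Ψ (Complex.exp u) + Complex.log (dslope Complex.exp 0 u)) 0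

/-- `κ⁽¹⁾_n` for `n ≥ 1`. -/
def kappaOne (Φ : ℂ → ℂ) (n : ℕ) : ℂ :=
  1 / ((n - 1).factorial : ℂ) *
    iteratedDeriv n (fun u : ℂ => Φ (Complex.exp u) - 1 / 2 * u) 0

/-- A partition of `{1, …, k}` is non-crossing if there are no two different blocks `V`, `W` and
`a < b < c < d` with `a, c ∈ V` and `b, d ∈ W`. -/
def IsNonCrossing {k : ℕ} (π : Finpartition (Finset.univ : Finset (Fin k))) : Prop :=
  ∀ V ∈ π.parts, ∀ W ∈ π.parts, V ≠ W →
    ∀ a ∈ V, ∀ b ∈ W, ∀ c ∈ V, ∀ d ∈ W, ¬ (a < b ∧ b < c ∧ c < d)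

open Classical in
/-- The set `NC(k)` of non-crossing partitions of `{1, …, k}`. -/
def nonCrossing (k : ℕ) : Finset (Finpartition (Finset.univ : Finset (Fin k))) :=
  Finset.univ.filter IsNonCrossing

end

/-! Let C(u) = 1 + u d/du (Ψ(e^u) + log((e^u - 1)/u)) and D(u) = u d/du (Φ(e^u) - u/2); their
coefficients of positive degree are κ⁽⁰⁾_n and κ⁽¹⁾_n. Both constants of the theorem are
coefficients of powers of these series. The substitution x = e^u in a residue gives (k+1) m_k =
[u^k] C^(k+1) (`limitMoment_eq`). Counting non-crossing partitions by Łukasiewicz paths gives [u^k]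
C^(k+1) / (k+1) for the sum of the products of the κ⁽⁰⁾, and differentiating this in the direction
D, through dual numbers, turns the right-hand side of the theorem into [u^k] C^k D
(`sum_nonCrossing_derivative`). So the expected moment has to agree with [u^k] (C + D/N)^(k+1) /
(k+1) up to o(1/N).

The moment is read off from k variables only. Multiply row b of the matrix with entries l_j^(N-1-i)
by l_j^k: summed over b, the determinants give (∑ l_j^k) times the original one, and only the first
k rows contribute. These k determinants are Taylor coefficients at t = 0 of the confluent numerator
of χ(e^t, 1, ..., 1). Hence, if f is the form of degree k of the normalized Schur function times an
explicit product (`schurExp`), then ∑ l_j^k = ∑_b (N-b)(N-b+1)...(N-b+k-1) H_b, where H_b is the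
coefficient of f times the Vandermonde polynomial at the exponent δ + k e_b
(`exists_symmetric_form_schurExp`). These are signed hook coefficients, so (1-z) ∑ z^b H_b is the
value of f at a point with power sums 1 - z^m (`one_sub_mul_sum_coeff_staircase`).

All this is linear in the signature and can be averaged over ϱ; positivity of the coefficients of
Schur functions justifies the exchange of sums (`schurGen_taylor`). The averaged form is the degree
k part of the exponential of an explicit logarithm, whose degree m part at the special points is
(1-z) N w_m(z) with w_m = [u^m](Ψ(e^u) + log((e^u-1)/u)) (1 + z + ... + z^(m-1)) + O(1/N)
(`hasSum_power_sum`). Pairing polynomials in z with rising factorials turns a factor 1-z into a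
finite difference, which costs one power of N; in the limit polynomials are evaluated at z = 1.

At order 1/N the pair interactions carry (1-z)^2 and vanish, except for the term -u/2 in D. The
second-order terms of the rising factorials cancel against derivatives at z = 1, because 1 + ... +
z^(m-1) is palindromic (`hasJet_moment_functional`). Only D survives. -/

/-! ### Taylor coefficients as formal power series. -/

/-- The Taylor series at `0` of a function of one complex variable. -/
noncomputable def taylorSeries (f : ℂ → ℂ) : PowerSeries ℂ :=
  PowerSeries.mk fun n => iteratedDeriv n f 0 / (n.factorial : ℂ)

theorem coeff_taylorSeries (f : ℂ → ℂ) (n : ℕ) :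
    PowerSeries.coeff n (taylorSeries f) = iteratedDeriv n f 0 / (n.factorial : ℂ) :=
  PowerSeries.coeff_mk _ _

theorem taylorSeries_congr {f g : ℂ → ℂ} (h : f =ᶠ[𝓝 0] g) : taylorSeries f = taylorSeries g := by
  ext n
  rw [coeff_taylorSeries, coeff_taylorSeries, h.iteratedDeriv_eq n]

theorem constantCoeff_taylorSeries (f : ℂ → ℂ) :
    PowerSeries.constantCoeff (taylorSeries f) = f 0 := by
  rw [← PowerSeries.coeff_zero_eq_constantCoeff_apply, coeff_taylorSeries]
  simp

theorem taylorSeries_const (c : ℂ) : taylorSeries (fun _ => c) = PowerSeries.C c := by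
  ext n
  rw [coeff_taylorSeries, iteratedDeriv_const, PowerSeries.coeff_C]
  split_ifs with h <;> simp [h]

theorem taylorSeries_id : taylorSeries (fun x => x) = PowerSeries.X := by
  ext n
  rw [coeff_taylorSeries, iteratedDeriv_fun_id_zero, PowerSeries.coeff_X]
  split_ifs with h <;> simp [h]

theorem taylorSeries_add {f g : ℂ → ℂ} (hf : AnalyticAt ℂ f 0) (hg : AnalyticAt ℂ g 0) :
    taylorSeries (fun x => f x + g x) = taylorSeries f + taylorSeries g := by
  ext n
  rw [map_add, coeff_taylorSeries, coeff_taylorSeries, coeff_taylorSeries, ← add_div]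
  congr 1
  exact iteratedDeriv_add hf.contDiffAt hg.contDiffAt

theorem taylorSeries_sub {f g : ℂ → ℂ} (hf : AnalyticAt ℂ f 0) (hg : AnalyticAt ℂ g 0) :
    taylorSeries (fun x => f x - g x) = taylorSeries f - taylorSeries g := by
  ext n
  rw [map_sub, coeff_taylorSeries, coeff_taylorSeries, coeff_taylorSeries, ← sub_div]
  congr 1
  exact iteratedDeriv_sub hf.contDiffAt hg.contDiffAt

theorem taylorSeries_mul {f g : ℂ → ℂ} (hf : AnalyticAt ℂ f 0) (hg : AnalyticAt ℂ g 0) :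
    taylorSeries (fun x => f x * g x) = taylorSeries f * taylorSeries g := by
  ext n
  rw [PowerSeries.coeff_mul, coeff_taylorSeries,
    iteratedDeriv_fun_mul hf.contDiffAt hg.contDiffAt,
    Finset.Nat.sum_antidiagonal_eq_sum_range_succ_mk, Finset.sum_div]
  refine Finset.sum_congr rfl fun i hi => ?_
  rw [coeff_taylorSeries, coeff_taylorSeries, Nat.cast_choose _ (by grind)]
  field_simp [Nat.factorial_ne_zero]

theorem taylorSeries_const_mul (c : ℂ) (f : ℂ → ℂ) :
    taylorSeries (fun x => c * f x) = PowerSeries.C c * taylorSeries f := by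
  ext n
  rw [PowerSeries.coeff_C_mul, coeff_taylorSeries, coeff_taylorSeries,
    iteratedDeriv_const_mul_field, mul_div_assoc]

theorem taylorSeries_sum {ι : Type*} (s : Finset ι) {f : ι → ℂ → ℂ}
    (hf : ∀ i ∈ s, AnalyticAt ℂ (f i) 0) :
    taylorSeries (fun x => ∑ i ∈ s, f i x) = ∑ i ∈ s, taylorSeries (f i) := by
  ext n
  rw [map_sum, coeff_taylorSeries, iteratedDeriv_fun_sum fun i hi => (hf i hi).contDiffAt,
    Finset.sum_div]
  exact Finset.sum_congr rfl fun i _ => (coeff_taylorSeries _ _).symm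

theorem taylorSeries_pow {f : ℂ → ℂ} (hf : AnalyticAt ℂ f 0) (n : ℕ) :
    taylorSeries (fun x => f x ^ n) = taylorSeries f ^ n := by
  induction n with
  | zero => simpa using taylorSeries_const 1
  | succ n ih => simp only [pow_succ, taylorSeries_mul (hf.fun_pow n) hf, ih]

theorem taylorSeries_deriv (f : ℂ → ℂ) :
    taylorSeries (deriv f) = PowerSeries.derivative ℂ (taylorSeries f) := by
  ext n
  rw [PowerSeries.coeff_derivative, coeff_taylorSeries, coeff_taylorSeries, ← iteratedDeriv_succ',
    Nat.factorial_succ]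
  have : (n.factorial : ℂ) ≠ 0 := by exact_mod_cast Nat.factorial_ne_zero n
  have : (n : ℂ) + 1 ≠ 0 := by exact_mod_cast Nat.succ_ne_zero n
  push_cast
  field_simp

theorem taylorSeries_eq_of_hasSum {f : ℂ → ℂ} {a : ℕ → ℂ}
    (h : ∀ᶠ x in 𝓝 (0 : ℂ), HasSum (fun n => a n * x ^ n) (f x)) :
    AnalyticAt ℂ f 0 ∧ taylorSeries f = PowerSeries.mk a := by
  have h1 : HasFPowerSeriesAt f (FormalMultilinearSeries.ofScalars ℂ a) 0 := by
    rw [hasFPowerSeriesAt_iff]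
    filter_upwards [h] with x hx
    simpa [FormalMultilinearSeries.coeff_ofScalars, mul_comm] using hx
  refine ⟨h1.analyticAt, ?_⟩
  ext n
  have h2 := h1.eq_formalMultilinearSeries h1.analyticAt.hasFPowerSeriesAt
  have h3 := congrArg (fun p => FormalMultilinearSeries.coeff p n) h2
  simp only [FormalMultilinearSeries.coeff_ofScalars] at h3
  rw [coeff_taylorSeries, PowerSeries.coeff_mk, h3]

theorem hasSum_taylorSeries {f : ℂ → ℂ} (hf : AnalyticAt ℂ f 0) :
    ∀ᶠ x in 𝓝 (0 : ℂ), HasSum (fun n => PowerSeries.coeff n (taylorSeries f) * x ^ n) (f x) := by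
  have h := hasFPowerSeriesAt_iff.1 hf.hasFPowerSeriesAt
  filter_upwards [h] with x hx
  simpa [FormalMultilinearSeries.coeff_ofScalars, mul_comm, coeff_taylorSeries] using hx

theorem coeff_taylorSeries_comp_mul {f : ℂ → ℂ} (hf : AnalyticAt ℂ f 0) (c : ℂ) (n : ℕ) :
    PowerSeries.coeff n (taylorSeries fun x => f (x * c)) =
      PowerSeries.coeff n (taylorSeries f) * c ^ n := by
  have h := hasSum_taylorSeries hf
  have hc : Tendsto (fun x : ℂ => x * c) (𝓝 0) (𝓝 0) :=
    Continuous.tendsto' (by fun_prop) _ _ (by simp)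
  rw [(taylorSeries_eq_of_hasSum (a := fun n => PowerSeries.coeff n (taylorSeries f) * c ^ n) ?_).2,
    PowerSeries.coeff_mk]
  filter_upwards [hc.eventually h] with x hx
  convert hx using 2 with n
  ring

theorem coeff_taylorSeries_exp_mul (c : ℂ) (n : ℕ) :
    PowerSeries.coeff n (taylorSeries fun x => Complex.exp (x * c)) = c ^ n / n.factorial := by
  rw [coeff_taylorSeries_comp_mul (f := Complex.exp) (by fun_prop), coeff_taylorSeries]
  simp [iteratedDeriv_eq_iterate]
  ring

/-- As W vanishes at 0, its series is divisible by X, so W^(k+1) does not reach degree k and the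
exponential series may be truncated. -/
theorem coeff_taylorSeries_exp_comp {W : ℂ → ℂ} (hW : AnalyticAt ℂ W 0) (h0 : W 0 = 0) (k : ℕ) :
    PowerSeries.coeff k (taylorSeries fun x => Complex.exp (W x)) =
      ∑ j ∈ Finset.range (k + 1), PowerSeries.coeff k (taylorSeries W ^ j) / (j.factorial : ℂ) := by
  obtain ⟨F, hF, hFe⟩ : ∃ F : ℂ → ℂ, AnalyticAt ℂ F 0 ∧ ∀ z, Complex.exp z =
      (∑ i ∈ Finset.range (k + 1), z ^ i / (i.factorial : ℂ)) + z ^ (k + 1) * F z := by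
    obtain ⟨F, hF, h⟩ := (Differentiable.analyticAt Complex.differentiable_exp 0).exists_eq_sum_add_pow_mul (k + 1)
    refine ⟨F, hF, fun z => ?_⟩
    rw [h z]
    simp [iteratedDeriv_eq_iterate]
  have h1 : (fun x => Complex.exp (W x)) = fun x =>
      (∑ i ∈ Finset.range (k + 1), (1 / (i.factorial : ℂ)) * W x ^ i) + W x ^ (k + 1) * F (W x) := by
    funext x
    rw [hFe (W x)]
    congr 1
    exact Finset.sum_congr rfl fun i _ => by ring
  have hFW : AnalyticAt ℂ (fun x => F (W x)) 0 := AnalyticAt.fun_comp (by rwa [h0]) hW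
  rw [h1, taylorSeries_add (Finset.analyticAt_fun_sum _ fun i _ => by fun_prop)
    ((hW.fun_pow _).fun_mul hFW), taylorSeries_sum _ fun i _ => by fun_prop,
    taylorSeries_mul (by fun_prop) hFW,
    taylorSeries_pow hW]
  have h2 : PowerSeries.coeff k (taylorSeries W ^ (k + 1) * taylorSeries fun x => F (W x)) = 0 := by
    have hX : PowerSeries.X ^ (k + 1) ∣ taylorSeries W ^ (k + 1) * taylorSeries fun x => F (W x) := by
      apply Dvd.dvd.mul_right
      apply pow_dvd_pow_of_dvd
      rw [PowerSeries.X_dvd_iff, constantCoeff_taylorSeries, h0]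
    exact PowerSeries.X_pow_dvd_iff.1 hX k (Nat.lt_succ_self k)
  rw [map_add, h2, add_zero, map_sum]
  refine Finset.sum_congr rfl fun i _ => ?_
  rw [taylorSeries_const_mul, taylorSeries_pow hW, PowerSeries.coeff_C_mul]
  ring

/-- Cauchy's estimate on the circle of radius R/2, which lies inside the disc of uniform
convergence. -/
theorem tendsto_coeff_taylorSeries_zero {F : ℕ → ℂ → ℂ} {R : ℝ} (hR : 0 < R)
    (hF : ∀ᶠ N in atTop, DifferentiableOn ℂ (F N) (Metric.ball 0 R))
    (h : TendstoUniformlyOn F (fun _ => 0) atTop (Metric.ball 0 R)) (n : ℕ) :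
    Tendsto (fun N => PowerSeries.coeff n (taylorSeries (F N))) atTop (𝓝 0) := by
  rw [Metric.tendsto_atTop]
  intro ε hε
  have hR2 : 0 < R / 2 := by positivity
  have hd : 0 < ε / 2 * (R / 2) ^ n := by positivity
  rw [Metric.tendstoUniformlyOn_iff] at h
  obtain ⟨N0, hN0⟩ := eventually_atTop.1 ((h _ hd).and hF)
  refine ⟨N0, fun N hN => ?_⟩
  obtain ⟨h1, h2⟩ := hN0 N hN
  have hsub : Metric.closedBall (0 : ℂ) (R / 2) ⊆ Metric.ball 0 R :=
    Metric.closedBall_subset_ball (by linarith)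
  have h3 := Complex.norm_iteratedDeriv_le_of_forall_mem_sphere_norm_le (f := F N) n hR2
    (DifferentiableOn.diffContOnCl (by rw [closure_ball _ hR2.ne']; exact h2.mono hsub))
    (C := ε / 2 * (R / 2) ^ n) fun z hz => by
      have := h1 z (hsub (Metric.sphere_subset_closedBall hz))
      rw [dist_zero_left] at this
      exact this.le
  rw [dist_zero_right, coeff_taylorSeries, norm_div, Complex.norm_natCast]
  have hn : (0 : ℝ) < n.factorial := by exact_mod_cast Nat.factorial_pos n
  calc _ ≤ (n.factorial * (ε / 2 * (R / 2) ^ n) / (R / 2) ^ n) / n.factorial := by gcongr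
    _ = ε / 2 := by field_simp
    _ < ε := by linarith

/-- The homogeneous Taylor polynomials of an analytic function of several variables. -/
theorem exists_isHomogeneous_taylorSeries {k : ℕ} {f : (Fin k → ℂ) → ℂ} (hf : AnalyticAt ℂ f 0)
    (d : ℕ) : ∃ p : MvPolynomial (Fin k) ℂ, p.IsHomogeneous d ∧ ∀ c : Fin k → ℂ,
      PowerSeries.coeff d (taylorSeries fun x => f (x • c)) = MvPolynomial.eval c p := by
  obtain ⟨P, hP⟩ := hf
  refine ⟨∑ g : Fin d → Fin k, MvPolynomial.C (P d fun j => Pi.single (g j) 1) *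
    ∏ j, MvPolynomial.X (g j), ?_, fun c => ?_⟩
  · refine MvPolynomial.IsHomogeneous.sum _ _ _ fun g _ => ?_
    have h1 : (∏ j : Fin d, (MvPolynomial.X (g j) : MvPolynomial (Fin k) ℂ)).IsHomogeneous d := by
      simpa using MvPolynomial.IsHomogeneous.prod Finset.univ
        (fun j : Fin d => (MvPolynomial.X (g j) : MvPolynomial (Fin k) ℂ)) (fun _ => 1)
        fun j _ => MvPolynomial.isHomogeneous_X _ _
    simpa using (MvPolynomial.isHomogeneous_C (Fin k) (P d fun j => Pi.single (g j) 1)).mul h1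
  -- Along the line through c the coefficient of x^d is P_d(c, ..., c); expanding c in the standard
  -- basis by multilinearity makes this a form in the coordinates of c.
  · have h1 : ∀ᶠ x in 𝓝 (0 : ℂ), HasSum (fun n => (P n fun _ => c) * x ^ n) (f (x • c)) := by
      have hc : Tendsto (fun x : ℂ => x • c) (𝓝 0) (𝓝 0) :=
        Continuous.tendsto' (by fun_prop) _ _ (by simp)
      filter_upwards [hc.eventually hP.eventually_hasSum] with x hx
      rw [zero_add] at hx
      refine hx.congr_fun ?_
      intro n
      have := (P n).map_smul_univ (fun _ => x) (fun _ => c)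
      simp only [Finset.prod_const, Finset.card_univ, Fintype.card_fin, smul_eq_mul] at this
      rw [mul_comm, ← this]
    rw [(taylorSeries_eq_of_hasSum h1).2, PowerSeries.coeff_mk]
    have hc : (fun _ : Fin d => c) = fun _ => ∑ i, c i • (Pi.single i 1 : Fin k → ℂ) := by
      funext _
      exact pi_eq_sum_univ' c
    rw [hc, ContinuousMultilinearMap.map_sum]
    simp only [map_sum, map_mul, MvPolynomial.eval_C, map_prod, MvPolynomial.eval_X]
    refine Finset.sum_congr rfl fun g _ => ?_
    rw [(P d).map_smul_univ, smul_eq_mul, mul_comm]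

/-! ### Non-crossing partitions counted by Łukasiewicz paths. -/

section NonCrossingCount

variable {α : Type*} [LinearOrder α]

/-- The non-crossing partitions of a finite set `S` all of whose blocks meet `T`. -/
def ncParts (S T : Finset α) : Finset (Finset (Finset α)) :=
  {P ∈ S.powerset.powerset | ((∀ V ∈ P, V.Nonempty) ∧
    (∀ V ∈ P, ∀ W ∈ P, V ≠ W → Disjoint V W) ∧ P.biUnion id = S) ∧
    (∀ V ∈ P, ∀ W ∈ P, V ≠ W → ∀ a ∈ V, ∀ b ∈ W, ∀ c ∈ V, ∀ d ∈ W,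
      ¬ (a < b ∧ b < c ∧ c < d)) ∧ ∀ V ∈ P, ∃ x ∈ V, x ∈ T}

theorem mem_ncParts {S T : Finset α} {P : Finset (Finset α)} :
    P ∈ ncParts S T ↔ ((∀ V ∈ P, V.Nonempty) ∧
    (∀ V ∈ P, ∀ W ∈ P, V ≠ W → Disjoint V W) ∧ P.biUnion id = S) ∧
    (∀ V ∈ P, ∀ W ∈ P, V ≠ W → ∀ a ∈ V, ∀ b ∈ W, ∀ c ∈ V, ∀ d ∈ W,
      ¬ (a < b ∧ b < c ∧ c < d)) ∧ ∀ V ∈ P, ∃ x ∈ V, x ∈ T := by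
  rw [ncParts, Finset.mem_filter, and_iff_right_iff_imp]
  rintro ⟨⟨-, -, h⟩, -⟩
  rw [Finset.mem_powerset]
  intro V hV
  rw [Finset.mem_powerset, ← h]
  exact Finset.subset_biUnion_of_mem id hV

/-- The nonempty initial segments of a finite set. -/
def initialSegments (S : Finset α) : Finset (Finset α) :=
  {V ∈ S.powerset | V.Nonempty ∧ ∀ x ∈ V, ∀ y ∈ S, y < x → y ∈ V}

theorem mem_initialSegments {S V : Finset α} :
    V ∈ initialSegments S ↔ V ⊆ S ∧ V.Nonempty ∧ ∀ x ∈ V, ∀ y ∈ S, y < x → y ∈ V := by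
  rw [initialSegments, Finset.mem_filter, Finset.mem_powerset]

theorem exists_initialSegment_card (S : Finset α) (s : ℕ) (hs : s ≤ S.card) :
    ∃ V ⊆ S, V.card = s ∧ ∀ x ∈ V, ∀ y ∈ S, y < x → y ∈ V := by
  induction S using Finset.induction_on_max with
  | empty => exact ⟨∅, by simp, by rw [Finset.card_empty] at hs ⊢; omega, by simp⟩
  | insert a S ha ih =>
    have haS : a ∉ S := fun h => lt_irrefl _ (ha a h)
    rw [Finset.card_insert_of_notMem haS] at hs
    rcases Nat.lt_or_ge S.card s with h | h
    · refine ⟨insert a S, subset_rfl, ?_, fun x _ y hy _ => hy⟩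
      rw [Finset.card_insert_of_notMem haS]
      omega
    · obtain ⟨V, hV, hc, hl⟩ := ih h
      refine ⟨V, hV.trans (Finset.subset_insert _ _), hc, fun x hx y hy hyx => ?_⟩
      rcases Finset.mem_insert.1 hy with rfl | hy
      · exact absurd hyx (not_lt.2 (ha x (hV hx)).le)
      · exact hl x hx y hy hyx

/-- An initial segment of a finite linear order is determined by its cardinality, which can be any
number from 1 to |S|. -/
theorem sum_initialSegments {R : Type*} [AddCommMonoid R] (S : Finset α) (f : ℕ → R) :
    ∑ V ∈ initialSegments S, f V.card = ∑ s ∈ Finset.range S.card, f (s + 1) := by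
  refine Finset.sum_bij (fun V _ => V.card - 1) ?_ ?_ ?_ ?_
  · intro V hV
    obtain ⟨h1, h2, -⟩ := mem_initialSegments.1 hV
    have := Finset.card_le_card h1
    have := h2.card_pos
    rw [Finset.mem_range]
    omega
  · intro V hV W hW h
    obtain ⟨h1, h2, h3⟩ := mem_initialSegments.1 hV
    obtain ⟨k1, k2, k3⟩ := mem_initialSegments.1 hW
    have hc : V.card = W.card := by
      have := h2.card_pos
      have := k2.card_pos
      omega
    by_cases hVW : V ⊆ W
    · exact Finset.eq_of_subset_of_card_le hVW hc.ge
    · obtain ⟨x, hx, hxW⟩ := Finset.not_subset.1 hVW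
      refine (Finset.eq_of_subset_of_card_le (fun y hy => ?_) hc.le).symm
      rcases lt_trichotomy y x with hyx | hyx | hyx
      · exact h3 x hx y (k1 hy) hyx
      · exact hyx ▸ hx
      · exact absurd (k3 y hy x (h1 hx) hyx) hxW
  · intro s hs
    rw [Finset.mem_range] at hs
    obtain ⟨V, hV, hc, hl⟩ := exists_initialSegment_card S (s + 1) hs
    refine ⟨V, mem_initialSegments.2 ⟨hV, ?_, hl⟩, by simp [hc]⟩
    rw [← Finset.card_pos]
    omega
  · intro V hV
    obtain ⟨-, h2, -⟩ := mem_initialSegments.1 hV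
    have := h2.card_pos
    rw [Nat.sub_add_cancel this]

/-- Here T consists of the elements of S below m. Either every block meets T, or exactly one block V
avoids it; then m is the least element of V, and non-crossing forces V to be an initial segment of S
\ T. Conversely such a V can be added to any admissible partition of S \ V. -/
theorem sum_ncParts_insert {R : Type*} [CommSemiring R] (κ : ℕ → R) {S T : Finset α} {m : α}
    (hm : m ∈ S) (hTS : T ⊆ S) (hT : ∀ x ∈ S, x ∈ T ↔ x < m) :
    ∑ P ∈ ncParts S (insert m T), ∏ V ∈ P, κ V.card =
      ∑ P ∈ ncParts S T, ∏ V ∈ P, κ V.card +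
      ∑ V ∈ initialSegments (S \ T), κ V.card *
        ∑ P ∈ ncParts (S \ V) T, ∏ W ∈ P, κ W.card := by
  have hmT : m ∉ T := fun h => lt_irrefl _ ((hT m hm).1 h)
  rw [← Finset.sum_filter_add_sum_filter_not (ncParts S (insert m T))
    (fun P => ∀ V ∈ P, ∃ x ∈ V, x ∈ T)]
  congr 1
  · refine Finset.sum_congr ?_ fun _ _ => rfl
    ext P
    rw [Finset.mem_filter, mem_ncParts, mem_ncParts]
    constructor
    · rintro ⟨⟨h1, h2, -⟩, h3⟩
      exact ⟨h1, h2, h3⟩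
    · rintro ⟨h1, h2, h3⟩
      refine ⟨⟨h1, h2, fun V hV => ?_⟩, h3⟩
      obtain ⟨x, hx, hxT⟩ := h3 V hV
      exact ⟨x, hx, Finset.mem_insert_of_mem hxT⟩
  · simp_rw [Finset.mul_sum]
    rw [Finset.sum_sigma']
    symm
    have hVm : ∀ V ∈ initialSegments (S \ T), m ∈ V := by
      intro V hV
      obtain ⟨h1, ⟨x, hx⟩, h3⟩ := mem_initialSegments.1 hV
      have hxS := Finset.mem_sdiff.1 (h1 hx)
      rcases lt_trichotomy m x with h | h | h
      · exact h3 x hx m (Finset.mem_sdiff.2 ⟨hm, hmT⟩) h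
      · exact h ▸ hx
      · exact absurd ((hT x hxS.1).2 h) hxS.2
    have hnotin : ∀ V ∈ initialSegments (S \ T), ∀ P ∈ ncParts (S \ V) T, ∀ W ∈ P,
        W ⊆ S \ V := by
      intro V hV P hP W hW
      obtain ⟨⟨-, -, h⟩, -⟩ := mem_ncParts.1 hP
      rw [← h]
      exact Finset.subset_biUnion_of_mem id hW
    have hVP : ∀ V ∈ initialSegments (S \ T), ∀ P ∈ ncParts (S \ V) T, V ∉ P := by
      intro V hV P hP h
      have := hnotin V hV P hP V h (hVm V hV)
      simp [hVm V hV] at this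
    refine Finset.sum_bij (fun x _ => insert x.1 x.2) ?_ ?_ ?_ ?_
    · rintro ⟨V, P⟩ h
      obtain ⟨hV, hP⟩ := Finset.mem_sigma.1 h
      have hVP' := hVP V hV P hP
      have hsub := hnotin V hV P hP
      have hmV := hVm V hV
      obtain ⟨h1, h2, h3⟩ := mem_initialSegments.1 hV
      obtain ⟨⟨p1, p2, p3⟩, p4, p5⟩ := mem_ncParts.1 hP
      have hdis : ∀ W ∈ P, Disjoint V W := fun W hW =>
        Finset.disjoint_left.2 fun x hx hxW => (Finset.mem_sdiff.1 (hsub W hW hxW)).2 hx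
      rw [Finset.mem_filter, mem_ncParts]
      have hge : ∀ x ∈ V, m ≤ x := fun x hx => by
        have hxS := Finset.mem_sdiff.1 (h1 hx)
        by_contra hlt
        exact hxS.2 ((hT x hxS.1).2 (not_le.1 hlt))
      -- V is convex in S, so it crosses no block of P.
      have hcl : ∀ x ∈ V, ∀ y ∈ V, ∀ b ∈ S, x < b → b < y → b ∈ V := by
        intro x hx y hy b hb h1' h2'
        refine h3 y hy b (Finset.mem_sdiff.2 ⟨hb, fun hbT => ?_⟩) h2'
        have := (hT b hb).1 hbT
        exact absurd (h1'.trans this) (not_lt.2 (hge x hx))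
      refine ⟨⟨⟨?_, ?_, ?_⟩, ?_, ?_⟩, ?_⟩
      · intro W hW
        rcases Finset.mem_insert.1 hW with rfl | hW
        · exact h2
        · exact p1 W hW
      · intro W hW W' hW' hne
        rcases Finset.mem_insert.1 hW with rfl | hW <;>
          rcases Finset.mem_insert.1 hW' with rfl | hW'
        · exact absurd rfl hne
        · exact hdis _ hW'
        · exact (hdis _ hW).symm
        · exact p2 _ hW _ hW' hne
      · rw [Finset.biUnion_insert, p3, id]
        exact Finset.union_sdiff_of_subset (h1.trans Finset.sdiff_subset)
      · intro W hW W' hW' hne a ha b hb c hc d hd habcd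
        rcases Finset.mem_insert.1 hW with rfl | hW <;>
          rcases Finset.mem_insert.1 hW' with rfl | hW'
        · exact hne rfl
        · have := Finset.mem_sdiff.1 (hsub _ hW' hb)
          exact this.2 (hcl a ha c hc b this.1 habcd.1 habcd.2.1)
        · have := Finset.mem_sdiff.1 (hsub _ hW hc)
          exact this.2 (hcl b hb d hd c this.1 habcd.2.1 habcd.2.2)
        · exact p4 _ hW _ hW' hne a ha b hb c hc d hd habcd
      · intro W hW
        rcases Finset.mem_insert.1 hW with rfl | hW
        · exact ⟨m, hmV, Finset.mem_insert_self _ _⟩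
        · obtain ⟨x, hx, hxT⟩ := p5 W hW
          exact ⟨x, hx, Finset.mem_insert_of_mem hxT⟩
      · intro hcon
        obtain ⟨x, hx, hxT⟩ := hcon V (Finset.mem_insert_self _ _)
        exact (Finset.mem_sdiff.1 (h1 hx)).2 hxT
    · rintro ⟨V, P⟩ h ⟨V', P'⟩ h' heq
      obtain ⟨hV, hP⟩ := Finset.mem_sigma.1 h
      obtain ⟨hV', hP'⟩ := Finset.mem_sigma.1 h'
      simp only at hV hP hV' hP' heq
      have hVV : V = V' := by
        have h1 : V ∈ insert V' P' := heq ▸ Finset.mem_insert_self V P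
        rcases Finset.mem_insert.1 h1 with h1 | h1
        · exact h1
        · have := hnotin V' hV' P' hP' V h1 (hVm V hV)
          simp [hVm V' hV'] at this
      subst hVV
      have : P = P' := by
        rw [← Finset.erase_insert (hVP V hV P hP), heq, Finset.erase_insert (hVP V hV P' hP')]
      rw [this]
    · intro P hP
      obtain ⟨hP, hP2⟩ := Finset.mem_filter.1 hP
      obtain ⟨⟨p1, p2, p3⟩, p4, p5⟩ := mem_ncParts.1 hP
      push Not at hP2
      obtain ⟨V, hVP, hV⟩ := hP2
      have hmV : m ∈ V := by
        obtain ⟨x, hx, hxT⟩ := p5 V hVP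
        rcases Finset.mem_insert.1 hxT with rfl | hxT
        · exact hx
        · exact absurd hxT (hV x hx)
      have hsub : ∀ W ∈ P, W ⊆ S := fun W hW => by
        rw [← p3]; exact Finset.subset_biUnion_of_mem id hW
      have hW : ∀ W ∈ P, W ≠ V → ∃ x ∈ W, x ∈ T := by
        intro W hW hne
        obtain ⟨x, hx, hxT⟩ := p5 W hW
        rcases Finset.mem_insert.1 hxT with rfl | hxT
        · exact absurd hmV (Finset.disjoint_left.1 (p2 W hW V hVP hne) hx)
        · exact ⟨x, hx, hxT⟩
      refine ⟨⟨V, P.erase V⟩, Finset.mem_sigma.2 ⟨mem_initialSegments.2 ⟨?_, ⟨m, hmV⟩, ?_⟩,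
        mem_ncParts.2 ⟨⟨?_, ?_, ?_⟩, ?_, ?_⟩⟩, Finset.insert_erase hVP⟩
      · exact fun x hx => Finset.mem_sdiff.2 ⟨hsub V hVP hx, hV x hx⟩
      · intro x hx y hy hyx
        obtain ⟨hyS, hyT⟩ := Finset.mem_sdiff.1 hy
        by_contra hyV
        have hy' := hyS
        rw [← p3, Finset.mem_biUnion] at hy'
        obtain ⟨W, hWP, hyW⟩ := hy'
        have hne : W ≠ V := by rintro rfl; exact hyV hyW
        obtain ⟨a, ha, haT⟩ := hW W hWP hne
        have ham := (hT a (hTS haT)).1 haT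
        have hmy : m < y := by
          rcases lt_trichotomy m y with h | h | h
          · exact h
          · exact absurd (h ▸ hmV) hyV
          · exact absurd ((hT y hyS).2 h) hyT
        exact p4 W hWP V hVP hne a ha m hmV y hyW x hx ⟨ham, hmy, hyx⟩
      · exact fun W hW => p1 W (Finset.mem_of_mem_erase hW)
      · exact fun W hW W' hW' => p2 W (Finset.mem_of_mem_erase hW) W' (Finset.mem_of_mem_erase hW')
      · ext x
        simp only [Finset.mem_biUnion, Finset.mem_erase, id, Finset.mem_sdiff]
        constructor
        · rintro ⟨W, ⟨hne, hWP⟩, hx⟩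
          exact ⟨hsub W hWP hx, Finset.disjoint_left.1 (p2 W hWP V hVP hne) hx⟩
        · rintro ⟨hx, hxV⟩
          rw [← p3, Finset.mem_biUnion] at hx
          obtain ⟨W, hWP, hxW⟩ := hx
          exact ⟨W, ⟨by rintro rfl; exact hxV hxW, hWP⟩, hxW⟩
      · exact fun W hW W' hW' =>
          p4 W (Finset.mem_of_mem_erase hW) W' (Finset.mem_of_mem_erase hW')
      · exact fun W hW' => hW W (Finset.mem_of_mem_erase hW') (Finset.ne_of_mem_erase hW')
    · rintro ⟨V, P⟩ h
      obtain ⟨hV, hP⟩ := Finset.mem_sigma.1 h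
      rw [Finset.prod_insert (hVP V hV P hP)]

/-- Transfer weights of Łukasiewicz paths. -/
def transferWeight {R : Type*} [CommRing R] (κ : ℕ → R) (h h' : ℕ) : R :=
  if h ≤ h' + 1 then κ (h' + 1 - h) else 0

/-- Weighted number of Łukasiewicz paths from height `0` to height `p`. -/
def pathsTo {R : Type*} [CommRing R] (κ : ℕ → R) : ℕ → ℕ → R
  | 0, p => if p = 0 then 1 else 0
  | m + 1, p => ∑ q ∈ Finset.range (p + 2), transferWeight κ q p * pathsTo κ m q

/-- Weighted number of Łukasiewicz paths from height `h` to height `0`. -/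
def pathsFrom {R : Type*} [CommRing R] (κ : ℕ → R) : ℕ → ℕ → R
  | 0, h => if h = 0 then 1 else 0
  | n + 1, h => ∑ h' ∈ Finset.range (n + 1), transferWeight κ h h' * pathsFrom κ n h'

/-- The elements of T are read in increasing order and the height of the path is the number |S| -
|T| of elements outside T. Reading m either joins it to a block that meets the earlier elements
(weight κ 0 = 1) or removes a block of size s, with weight κ s, whose minimum is m. -/
theorem sum_ncParts_eq_pathsTo {R : Type*} [CommRing R] (κ : ℕ → R) (h0 : κ 0 = 1)
    (T : Finset α) : ∀ S : Finset α, T ⊆ S → (∀ x ∈ T, ∀ y ∈ S, y < x → y ∈ T) →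
    ∑ P ∈ ncParts S T, ∏ V ∈ P, κ V.card = pathsTo κ T.card (S.card - T.card) := by
  induction T using Finset.induction_on_max with
  | empty =>
    intro S _ _
    rw [Finset.card_empty, pathsTo]
    by_cases hS : S = ∅
    · subst hS
      have : ncParts (∅ : Finset α) ∅ = {∅} := by
        ext P
        rw [mem_ncParts, Finset.mem_singleton]
        constructor
        · rintro ⟨-, -, h⟩
          exact Finset.eq_empty_of_forall_notMem fun V hV => by simpa using h V hV
        · rintro rfl
          simp
      simp [this]
    · have : ncParts S ∅ = ∅ := by
        refine Finset.eq_empty_of_forall_notMem fun P hP => ?_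
        obtain ⟨⟨-, -, h1⟩, -, h⟩ := mem_ncParts.1 hP
        have : P = ∅ := Finset.eq_empty_of_forall_notMem fun V hV => by simpa using h V hV
        subst this
        exact hS (by simpa using h1.symm)
      simp [this, hS]
  | insert m T hm ih =>
    intro S hTS hl
    have hmT : m ∉ T := fun h => lt_irrefl _ (hm m h)
    have hmS : m ∈ S := hTS (Finset.mem_insert_self _ _)
    have hTS' : T ⊆ S := (Finset.subset_insert _ _).trans hTS
    have hT : ∀ x ∈ S, x ∈ T ↔ x < m := fun x hx => ⟨hm x, fun hxm => by
      rcases Finset.mem_insert.1 (hl m (Finset.mem_insert_self _ _) x hx hxm) with rfl | h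
      · exact absurd hxm (lt_irrefl _)
      · exact h⟩
    have hlow : ∀ x ∈ T, ∀ y ∈ S, y < x → y ∈ T := fun x hx y hy hyx =>
      (hT y hy).2 (hyx.trans (hm x hx))
    obtain ⟨p, hp⟩ : ∃ p, S.card = T.card + 1 + p := by
      have := Finset.card_le_card hTS
      rw [Finset.card_insert_of_notMem hmT] at this
      exact Nat.exists_eq_add_of_le this
    rw [sum_ncParts_insert κ hmS hTS' hT, ih S hTS' hlow]
    have h1 : ∀ V ∈ initialSegments (S \ T), κ V.card * ∑ P ∈ ncParts (S \ V) T,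
        ∏ W ∈ P, κ W.card = κ V.card * pathsTo κ T.card (p + 1 - V.card) := by
      intro V hV
      obtain ⟨hVs, -, -⟩ := mem_initialSegments.1 hV
      have hVS := hVs.trans Finset.sdiff_subset
      rw [ih (S \ V)]
      · rw [Finset.card_sdiff_of_subset hVS]
        congr 2
        omega
      · exact fun x hx => Finset.mem_sdiff.2 ⟨hTS' hx, fun hxV =>
          (Finset.mem_sdiff.1 (hVs hxV)).2 hx⟩
      · exact fun x hx y hy => hlow x hx y (Finset.mem_sdiff.1 hy).1
    have h2 : pathsTo κ (T.card + 1) p =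
        ∑ s ∈ Finset.range (p + 2), κ s * pathsTo κ T.card (p + 1 - s) := by
      rw [pathsTo, ← Finset.sum_range_reflect]
      refine Finset.sum_congr rfl fun s hs => ?_
      rw [Finset.mem_range] at hs
      rw [transferWeight, if_pos (by omega)]
      congr 2 <;> omega
    rw [Finset.sum_range_succ', h0, one_mul, Nat.sub_zero] at h2
    rw [Finset.sum_congr rfl h1,
      sum_initialSegments (S \ T) (fun s => κ s * pathsTo κ T.card (p + 1 - s)),
      Finset.card_sdiff_of_subset hTS', Finset.card_insert_of_notMem hmT, hp,
      show T.card + 1 + p - T.card = p + 1 by omega,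
      show T.card + 1 + p - (T.card + 1) = p by omega, h2, add_comm]

theorem pathsFrom_eq_zero {R : Type*} [CommRing R] (κ : ℕ → R) (n h : ℕ) (hn : n < h) :
    pathsFrom κ n h = 0 := by
  cases n with
  | zero => rw [pathsFrom, if_neg (by omega)]
  | succ n =>
    rw [pathsFrom]
    refine Finset.sum_eq_zero fun h' hh => ?_
    rw [Finset.mem_range] at hh
    rw [transferWeight, if_neg (by omega), zero_mul]

theorem pathsTo_eq_pathsFrom {R : Type*} [CommRing R] (κ : ℕ → R) (k : ℕ) :
    pathsTo κ k 0 = pathsFrom κ k 0 := by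
  -- A path of length k may be cut after any number m of steps; m = k gives `pathsTo` and m = 0
  -- gives `pathsFrom`. The range k + 1 suffices because more than n levels cannot be descended in n
  -- steps.
  have key : ∀ m n, m + n = k → ∑ p ∈ Finset.range (k + 1), pathsTo κ m p * pathsFrom κ n p =
      pathsFrom κ k 0 := by
    intro m
    induction m with
    | zero =>
      intro n hn
      obtain rfl : n = k := by omega
      rw [Finset.sum_eq_single 0]
      · simp [pathsTo]
      · intro p _ hp
        simp [pathsTo, hp]
      · simp
    | succ m ih =>
      intro n hn
      rw [← ih (n + 1) (by omega)]
      have h1 : ∀ p ∈ Finset.range (k + 1), pathsTo κ (m + 1) p * pathsFrom κ n p =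
          ∑ q ∈ Finset.range (k + 1), transferWeight κ q p * pathsTo κ m q * pathsFrom κ n p := by
        intro p hp
        rw [Finset.mem_range] at hp
        by_cases hpn : n < p
        · simp [pathsFrom_eq_zero κ n p hpn]
        · rw [pathsTo, Finset.sum_mul]
          refine Finset.sum_subset (fun q hq => ?_) fun q _ hq => ?_
          · rw [Finset.mem_range] at hq ⊢
            omega
          · rw [Finset.mem_range] at hq
            rw [transferWeight, if_neg (by omega), zero_mul, zero_mul]
      rw [Finset.sum_congr rfl h1, Finset.sum_comm]
      refine Finset.sum_congr rfl fun q _ => ?_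
      rw [pathsFrom, Finset.mul_sum]
      symm
      refine (Finset.sum_subset (fun p hp => ?_) fun p _ hp => ?_).trans
        (Finset.sum_congr rfl fun p _ => by ring)
      · rw [Finset.mem_range] at hp ⊢
        omega
      · rw [Finset.mem_range] at hp
        rw [pathsFrom_eq_zero κ n p (by omega), mul_zero, mul_zero]
  rw [← key k 0 (by omega), Finset.sum_eq_single 0]
  · simp [pathsFrom]
  · intro p _ hp
    simp [pathsFrom, hp]
  · simp

theorem coeff_X_mul_derivative {R : Type*} [CommRing R] (F : PowerSeries R) (n : ℕ) :
    PowerSeries.coeff n (PowerSeries.X * PowerSeries.derivative R F) =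
      (n : R) * PowerSeries.coeff n F := by
  cases n with
  | zero => simp
  | succ n =>
    rw [PowerSeries.coeff_succ_X_mul, PowerSeries.coeff_derivative]
    push_cast
    ring

/-- This is the cycle lemma, or Lagrange inversion, for paths starting at height h. The induction on
the number of steps uses only x (C^(n+2))' = (n+2) x C' C^(n+1). -/
theorem succ_mul_pathsFrom {R : Type*} [CommRing R] (hR : ∀ n : ℕ, IsUnit ((n : R) + 1))
    (κ : ℕ → R) (h0 : κ 0 = 1) (n : ℕ) : ∀ h ≤ n, ((n : R) + 1) * pathsFrom κ n h =
      ((h : R) + 1) * PowerSeries.coeff (n - h) (PowerSeries.mk κ ^ (n + 1)) := by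
  induction n with
  | zero =>
    intro h hh
    obtain rfl : h = 0 := by omega
    simp [pathsFrom, h0]
  | succ n ih =>
    intro h hh
    obtain ⟨K, hK⟩ : ∃ K, n + 1 = h + K := Nat.exists_eq_add_of_le hh
    set C := PowerSeries.mk κ with hC
    have hpow : ((n : R) + 2) * PowerSeries.coeff K
        (PowerSeries.X * PowerSeries.derivative R C * C ^ (n + 1)) =
        (K : R) * PowerSeries.coeff K (C ^ (n + 2)) := by
      rw [← coeff_X_mul_derivative, Derivation.leibniz_pow, ← map_natCast (algebraMap R R),
        ← PowerSeries.coeff_C_mul]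
      congr 1
      simp only [Nat.add_one_sub_one, smul_eq_mul, nsmul_eq_mul]
      push_cast
      simp
      rw [show PowerSeries.C (2 : R) = 2 from map_ofNat _ 2]
      ring
    have hsum : ((n : R) + 1) * pathsFrom κ (n + 1) h =
        (h : R) * PowerSeries.coeff K (C ^ (n + 2)) + PowerSeries.coeff K
        (PowerSeries.X * PowerSeries.derivative R C * C ^ (n + 1)) := by
      -- The summation index is the next height plus one; the added term i = 0 has weight zero.
      have h1 : ((n : R) + 1) * pathsFrom κ (n + 1) h = ∑ i ∈ Finset.range (n + 2),
          (if h ≤ i then κ (i - h) else 0) *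
            ((i : R) * PowerSeries.coeff (n + 1 - i) (C ^ (n + 1))) := by
        rw [Finset.sum_range_succ', pathsFrom, Finset.mul_sum]
        simp only [Nat.cast_zero, zero_mul, mul_zero, add_zero]
        refine Finset.sum_congr rfl fun i hi => ?_
        rw [Finset.mem_range] at hi
        have := ih i (by omega)
        rw [mul_left_comm, this, transferWeight]
        push_cast
        rfl
      rw [h1, show n + 2 = h + (K + 1) by omega, Finset.sum_range_add,
        Finset.sum_eq_zero fun i hi => by
          rw [Finset.mem_range] at hi
          rw [if_neg (by omega), zero_mul], zero_add,
        show h + (K + 1) = (n + 1) + 1 by omega, pow_succ' C (n + 1), PowerSeries.coeff_mul,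
        PowerSeries.coeff_mul, Finset.mul_sum, ← Finset.sum_add_distrib,
        Finset.Nat.sum_antidiagonal_eq_sum_range_succ_mk]
      refine Finset.sum_congr rfl fun s hs => ?_
      rw [Finset.mem_range] at hs
      rw [if_pos (by omega), coeff_X_mul_derivative, hC, PowerSeries.coeff_mk,
        show n + 1 - (h + s) = K - s by omega, show h + s - h = s by omega]
      push_cast
      ring
    refine (hR n).mul_left_cancel ?_
    rw [show n + 1 - h = K by omega]
    have hn : (n : R) + 1 = h + K := by exact_mod_cast congrArg (Nat.cast (R := R)) hK
    calc ((n : R) + 1) * ((((n + 1 : ℕ) : R) + 1) * pathsFrom κ (n + 1) h)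
        = ((n : R) + 2) * (((n : R) + 1) * pathsFrom κ (n + 1) h) := by push_cast; ring
      _ = ((n : R) + 2) * h * PowerSeries.coeff K (C ^ (n + 2)) +
          (K : R) * PowerSeries.coeff K (C ^ (n + 2)) := by rw [hsum, mul_add, hpow]; ring
      _ = _ := by
          rw [show (K : R) = n + 1 - h by rw [hn]; ring]
          ring

/-- Only invertibility of positive integers is needed, so the formula is available over the dual
numbers, where it can be differentiated. -/
theorem succ_mul_sum_ncParts {R : Type*} [CommRing R] (hR : ∀ n : ℕ, IsUnit ((n : R) + 1))
    (κ : ℕ → R) (h0 : κ 0 = 1) (S : Finset α) :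
    ((S.card : R) + 1) * ∑ P ∈ ncParts S S, ∏ V ∈ P, κ V.card =
      PowerSeries.coeff S.card (PowerSeries.mk κ ^ (S.card + 1)) := by
  rw [sum_ncParts_eq_pathsTo κ h0 S S subset_rfl fun _ _ y hy _ => hy, Nat.sub_self,
    pathsTo_eq_pathsFrom, succ_mul_pathsFrom hR κ h0 _ 0 (Nat.zero_le _)]
  simp

end NonCrossingCount

/-! ### First variation of the sum over non-crossing partitions. -/

theorem mem_nonCrossing {k : ℕ} {π : Finpartition (Finset.univ : Finset (Fin k))} :
    π ∈ nonCrossing k ↔ IsNonCrossing π := by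
  simp [nonCrossing]

theorem sum_nonCrossing {R : Type*} [AddCommMonoid R] (k : ℕ)
    (f : Finset (Finset (Fin k)) → R) :
    ∑ π ∈ nonCrossing k, f π.parts =
      ∑ P ∈ ncParts (Finset.univ : Finset (Fin k)) Finset.univ, f P := by
  refine Finset.sum_bij (fun π _ => π.parts) ?_ ?_ ?_ ?_
  · intro π hπ
    rw [mem_nonCrossing] at hπ
    refine mem_ncParts.2 ⟨⟨fun V hV => π.nonempty_of_mem_parts hV, fun V hV W hW hne =>
      π.disjoint hV hW hne, π.biUnion_parts⟩, hπ, fun V hV => ?_⟩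
    obtain ⟨x, hx⟩ := π.nonempty_of_mem_parts hV
    exact ⟨x, hx, Finset.mem_univ _⟩
  · intro π _ π' _ h
    exact Finpartition.ext h
  · intro P hP
    obtain ⟨⟨p1, p2, p3⟩, p4, -⟩ := mem_ncParts.1 hP
    refine ⟨⟨P, Finset.supIndep_iff_pairwiseDisjoint.2 fun V hV W hW hne => p2 V hV W hW hne,
      by rw [Finset.sup_eq_biUnion]; exact p3, fun h => by simpa using p1 ∅ h⟩, ?_, rfl⟩
    exact mem_nonCrossing.2 p4
  · exact fun _ _ => rfl

/-- Leibniz's product rule: the infinitesimal part is a derivation. The second conjunct is carried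
along to make the induction work. -/
theorem snd_prod_inl_add_inr {ι : Type*} [DecidableEq ι] (s : Finset ι) (a b : ι → ℂ) :
    TrivSqZeroExt.snd (∏ i ∈ s, (TrivSqZeroExt.inl (a i) + TrivSqZeroExt.inr (b i) : DualNumber ℂ)) =
      ∑ i ∈ s, b i * ∏ j ∈ s.erase i, a j ∧
    TrivSqZeroExt.fst (∏ i ∈ s, (TrivSqZeroExt.inl (a i) + TrivSqZeroExt.inr (b i) : DualNumber ℂ)) =
      ∏ i ∈ s, a i := by
  induction s using Finset.induction_on with
  | empty => simp
  | insert x s hx ih =>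
    refine ⟨?_, ?_⟩
    · rw [Finset.prod_insert hx, TrivSqZeroExt.snd_mul, ih.1, ih.2, Finset.sum_insert hx,
        Finset.erase_insert hx]
      simp only [TrivSqZeroExt.fst_add, TrivSqZeroExt.fst_inl, TrivSqZeroExt.fst_inr, add_zero,
        TrivSqZeroExt.snd_add, TrivSqZeroExt.snd_inl, TrivSqZeroExt.snd_inr, zero_add, smul_eq_mul,
        MulOpposite.smul_eq_mul_unop, MulOpposite.unop_op, Finset.mul_sum]
      rw [add_comm]
      congr 1
      refine Finset.sum_congr rfl fun i hi => ?_
      have hne : x ≠ i := by rintro rfl; exact hx hi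
      rw [Finset.erase_insert_of_ne hne, Finset.prod_insert
        (fun h => hx (Finset.mem_of_mem_erase h))]
      ring
    · rw [Finset.prod_insert hx, TrivSqZeroExt.fst_mul, ih.2, Finset.prod_insert hx]
      simp

/-- The counting formula is applied to the weights a + ε b with ε² = 0. The ε-part of (A + ε
B)^(k+1) is (k+1) A^k B, and the factor k+1 cancels. -/
theorem sum_nonCrossing_derivative (a b : ℕ → ℂ) (h0 : a 0 = 1) (hb : b 0 = 0) (k : ℕ) :
    ∑ π ∈ nonCrossing k, ∑ V ∈ π.parts, b V.card * ∏ W ∈ π.parts.erase V, a W.card =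
      PowerSeries.coeff k (PowerSeries.mk a ^ k * PowerSeries.mk b) := by
  let ι : ℂ →+* DualNumber ℂ := TrivSqZeroExt.inlHom ℂ ℂ
  let e : PowerSeries (DualNumber ℂ) := PowerSeries.C DualNumber.eps
  have hR : ∀ n : ℕ, IsUnit ((n : DualNumber ℂ) + 1) := fun n => by
    have := (Nat.cast_add_one_ne_zero (R := ℂ) n).isUnit.map ι
    simpa using this
  have h := succ_mul_sum_ncParts hR
    (fun n => (TrivSqZeroExt.inl (a n) + TrivSqZeroExt.inr (b n) : DualNumber ℂ))
    (by simp [h0, hb]) (Finset.univ : Finset (Fin k))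
  rw [← sum_nonCrossing k (fun P => ∏ V ∈ P,
    (TrivSqZeroExt.inl (a V.card) + TrivSqZeroExt.inr (b V.card) : DualNumber ℂ))] at h
  have hmk : (PowerSeries.mk fun n =>
      (TrivSqZeroExt.inl (a n) + TrivSqZeroExt.inr (b n) : DualNumber ℂ)) =
      PowerSeries.map ι (PowerSeries.mk a) + e * PowerSeries.map ι (PowerSeries.mk b) := by
    ext1 n
    rw [map_add, PowerSeries.coeff_C_mul, PowerSeries.coeff_map, PowerSeries.coeff_map,
      PowerSeries.coeff_mk, PowerSeries.coeff_mk, PowerSeries.coeff_mk]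
    ext <;> simp [ι]
  have he : e ^ 2 = 0 := by
    rw [pow_two, ← map_mul, DualNumber.eps_mul_eps, map_zero]
  have hp : (PowerSeries.map ι (PowerSeries.mk a) + e * PowerSeries.map ι (PowerSeries.mk b)) ^
      (k + 1) = PowerSeries.map ι (PowerSeries.mk a ^ (k + 1)) +
        e * PowerSeries.map ι (((k : ℂ) + 1) • (PowerSeries.mk a ^ k * PowerSeries.mk b)) := by
    obtain ⟨q, hq⟩ := Polynomial.powAddExpansion (PowerSeries.map ι (PowerSeries.mk a))
      (e * PowerSeries.map ι (PowerSeries.mk b)) (k + 1)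
    rw [hq, mul_pow, he, zero_mul, mul_zero, add_zero, map_pow, PowerSeries.smul_eq_C_mul,
      map_mul, map_mul, map_pow]
    simp
    ring
  rw [hmk, Finset.card_univ, Fintype.card_fin, hp] at h
  have h2 := congrArg TrivSqZeroExt.snd h
  rw [map_add, PowerSeries.coeff_C_mul, PowerSeries.coeff_map, PowerSeries.coeff_map] at h2
  have hk : (k : ℂ) + 1 ≠ 0 := Nat.cast_add_one_ne_zero k
  have h3 : TrivSqZeroExt.snd (∑ π ∈ nonCrossing k, ∏ V ∈ π.parts,
      (TrivSqZeroExt.inl (a V.card) + TrivSqZeroExt.inr (b V.card) : DualNumber ℂ)) =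
      ∑ π ∈ nonCrossing k, ∑ V ∈ π.parts, b V.card * ∏ W ∈ π.parts.erase V, a W.card := by
    rw [TrivSqZeroExt.snd_sum]
    exact Finset.sum_congr rfl fun π _ => (snd_prod_inl_add_inr π.parts _ _).1
  have h4 : ((k : DualNumber ℂ) + 1) = TrivSqZeroExt.inl ((k : ℂ) + 1) := by
    have : ((k : DualNumber ℂ) + 1) = ι ((k : ℂ) + 1) := by simp
    exact this
  rw [h4, TrivSqZeroExt.snd_mul, h3] at h2
  simp [ι] at h2
  rcases h2 with h2 | h2
  · exact h2
  · exact absurd h2 hk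

/-! ### The limiting moments as coefficients of a power series. -/

/-- The entire function `(e ^ u - 1) / u`. -/
noncomputable abbrev expQuot : ℂ → ℂ := dslope Complex.exp 0

theorem mul_expQuot (u : ℂ) : u * expQuot u = Complex.exp u - 1 := by
  have := sub_smul_dslope Complex.exp 0 u
  simpa using this

theorem expQuot_zero : expQuot 0 = 1 := by
  simp [expQuot, dslope_same]

theorem differentiable_expQuot : Differentiable ℂ expQuot := by
  rw [← differentiableOn_univ, expQuot, Complex.differentiableOn_dslope univ_mem]
  exact Complex.differentiable_exp.differentiableOn

theorem analyticAt_expQuot (u : ℂ) : AnalyticAt ℂ expQuot u :=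
  differentiable_expQuot.analyticAt u

/-- The branch of `log ((e ^ u - 1) / u)` near `0`. -/
noncomputable abbrev logExpQuot (u : ℂ) : ℂ := Complex.log (expQuot u)

theorem analyticAt_logExpQuot : AnalyticAt ℂ logExpQuot 0 :=
  (analyticAt_expQuot 0).clog (by rw [expQuot_zero]; exact Complex.one_mem_slitPlane)

theorem logExpQuot_zero : logExpQuot 0 = 0 := by
  rw [logExpQuot, expQuot_zero, Complex.log_one]

theorem eventually_expQuot_ne_zero : ∀ᶠ u in 𝓝 (0 : ℂ), expQuot u ≠ 0 :=
  (analyticAt_expQuot 0).continuousAt.eventually_ne (by rw [expQuot_zero]; exact one_ne_zero)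

theorem eventually_exp_logExpQuot :
    ∀ᶠ u in 𝓝 (0 : ℂ), Complex.exp (logExpQuot u) = expQuot u :=
  eventually_expQuot_ne_zero.mono fun _ hu => Complex.exp_log hu

theorem X_mul_taylorSeries_expQuot :
    PowerSeries.X * taylorSeries expQuot = taylorSeries Complex.exp - 1 := by
  rw [← taylorSeries_id, ← taylorSeries_mul (by fun_prop) (analyticAt_expQuot 0)]
  simp_rw [mul_expQuot]
  rw [taylorSeries_sub (by fun_prop) (by fun_prop), taylorSeries_const, map_one]

theorem derivative_taylorSeries_exp :
    PowerSeries.derivative ℂ (taylorSeries Complex.exp) = taylorSeries Complex.exp := by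
  rw [← taylorSeries_deriv, Complex.deriv_exp]

theorem taylorSeries_expQuot_add_X_mul_derivative :
    taylorSeries expQuot + PowerSeries.X * PowerSeries.derivative ℂ (taylorSeries expQuot) =
      taylorSeries Complex.exp := by
  have h := congrArg (PowerSeries.derivative ℂ) X_mul_taylorSeries_expQuot
  rw [Derivation.leibniz, map_sub, derivative_taylorSeries_exp] at h
  simp only [PowerSeries.derivative_X, smul_eq_mul, mul_one] at h
  rw [add_comm] at h
  simpa using h

theorem taylorSeries_expQuot_mul_inv : taylorSeries expQuot * (taylorSeries expQuot)⁻¹ = 1 :=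
  PowerSeries.mul_inv_cancel _ (by rw [constantCoeff_taylorSeries, expQuot_zero]; exact one_ne_zero)

theorem derivative_taylorSeries_comp_exp {g : ℂ → ℂ} (hg : AnalyticAt ℂ g 1) :
    PowerSeries.derivative ℂ (taylorSeries fun u => g (Complex.exp u)) =
      taylorSeries (fun u => deriv g (Complex.exp u)) * taylorSeries Complex.exp := by
  have h1 : Tendsto Complex.exp (𝓝 0) (𝓝 1) := by
    simpa using Complex.continuous_exp.tendsto 0
  have hg' : AnalyticAt ℂ (deriv g) (Complex.exp 0) := by rw [Complex.exp_zero]; exact hg.deriv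
  rw [← taylorSeries_deriv, ← taylorSeries_mul (hg'.fun_comp (by fun_prop)) (by fun_prop)]
  apply taylorSeries_congr
  filter_upwards [h1.eventually hg.eventually_analyticAt] with u hu
  exact (hu.differentiableAt.hasDerivAt.comp u (Complex.hasDerivAt_exp u)).deriv

/-- With x = e^u and E = (e^u - 1)/u this is the change of variables Res g(x) (x-1)^(-m-1) dx = Res
g(e^u) e^u (u E)^(-m-1) du. It is proved formally, by induction on m, through integration by parts.
-/
theorem coeff_residue_comp_exp (m : ℕ) : ∀ {g : ℂ → ℂ}, AnalyticAt ℂ g 1 →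
    PowerSeries.coeff m (taylorSeries (fun u => g (Complex.exp u)) * taylorSeries Complex.exp *
      (taylorSeries expQuot)⁻¹ ^ (m + 1)) = iteratedDeriv m g 1 / (m.factorial : ℂ) := by
  induction m with
  | zero =>
    intro g _
    rw [PowerSeries.coeff_zero_eq_constantCoeff_apply]
    simp [constantCoeff_taylorSeries, PowerSeries.constantCoeff_inv]
  | succ m ih =>
    intro g hg
    have h := ih hg.deriv
    rw [← iteratedDeriv_succ', ← derivative_taylorSeries_comp_exp hg] at h
    set Y := taylorSeries fun u => g (Complex.exp u)
    set E := taylorSeries expQuot with hE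
    set I := E⁻¹ with hI
    set e := taylorSeries Complex.exp
    have hEI : E * I = 1 := taylorSeries_expQuot_mul_inv
    have hXE : E + PowerSeries.X * PowerSeries.derivative ℂ E = e :=
      taylorSeries_expQuot_add_X_mul_derivative
    have hI' : PowerSeries.derivative ℂ I = -(PowerSeries.derivative ℂ E * I ^ 2) := by
      have h1 := congrArg (PowerSeries.derivative ℂ) hEI
      rw [Derivation.leibniz, Derivation.map_one_eq_zero, smul_eq_mul, smul_eq_mul] at h1
      linear_combination I * h1 - PowerSeries.derivative ℂ I * hEI
    -- This coefficient matches the last term of `h3`: an exact derivative has no residue. What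
    -- remains relates m + 1 for g to m for g'.
    have h2 := coeff_X_mul_derivative (Y * I ^ (m + 1)) (m + 1)
    have h3 : PowerSeries.X * PowerSeries.derivative ℂ (Y * I ^ (m + 1)) =
        PowerSeries.X * (PowerSeries.derivative ℂ Y * I ^ (m + 1)) -
        PowerSeries.C ((m : ℂ) + 1) * (Y * e * I ^ (m + 2)) +
        PowerSeries.C ((m : ℂ) + 1) * (Y * I ^ (m + 1)) := by
      rw [Derivation.leibniz, Derivation.leibniz_pow, hI', ← hXE]
      simp only [smul_eq_mul, nsmul_eq_mul, Nat.add_one_sub_one, map_add, map_natCast, map_one]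
      push_cast
      linear_combination (((m : PowerSeries ℂ) + 1) * Y * I ^ (m + 1)) * hEI
    rw [h3, map_add, map_sub, PowerSeries.coeff_succ_X_mul, h, PowerSeries.coeff_C_mul,
      PowerSeries.coeff_C_mul] at h2
    have hm : (m : ℂ) + 1 ≠ 0 := Nat.cast_add_one_ne_zero m
    have hf : (m.factorial : ℂ) ≠ 0 := by exact_mod_cast Nat.factorial_ne_zero m
    rw [Nat.factorial_succ]
    push_cast at h2 ⊢
    field_simp at h2 ⊢
    linear_combination -h2

theorem mk_kappaZero (Ψ : ℂ → ℂ) :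
    (PowerSeries.mk fun n => if n = 0 then 1 else kappaZero Ψ n) =
      1 + PowerSeries.X * PowerSeries.derivative ℂ
        (taylorSeries fun u => Ψ (Complex.exp u) + logExpQuot u) := by
  ext n
  rw [PowerSeries.coeff_mk, map_add, coeff_X_mul_derivative, coeff_taylorSeries,
    PowerSeries.coeff_one]
  split_ifs with h
  · simp [h]
  · obtain ⟨n, rfl⟩ := Nat.exists_eq_succ_of_ne_zero h
    rw [kappaZero, Nat.factorial_succ, Nat.succ_sub_one]
    have hm : (n : ℂ) + 1 ≠ 0 := Nat.cast_add_one_ne_zero n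
    have hf : (n.factorial : ℂ) ≠ 0 := by exact_mod_cast Nat.factorial_ne_zero n
    push_cast
    field_simp
    ring

/-- From E + u E' = e^u one gets 1 + u (log E)' = e^u / E; the chain rule for Ψ(e^u) gives the
remaining term. -/
theorem mk_kappaZero_mul {Ψ : ℂ → ℂ} (hΨ : AnalyticAt ℂ Ψ 1) :
    (PowerSeries.mk fun n => if n = 0 then 1 else kappaZero Ψ n) = taylorSeries Complex.exp *
      (taylorSeries expQuot)⁻¹ * (1 + PowerSeries.X * taylorSeries expQuot *
        taylorSeries fun u => deriv Ψ (Complex.exp u)) := by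
  have hΨ' : AnalyticAt ℂ Ψ (Complex.exp 0) := by rwa [Complex.exp_zero]
  have hlog : PowerSeries.derivative ℂ (taylorSeries logExpQuot) * taylorSeries expQuot =
      PowerSeries.derivative ℂ (taylorSeries expQuot) := by
    rw [← taylorSeries_deriv, ← taylorSeries_deriv,
      ← taylorSeries_mul analyticAt_logExpQuot.deriv (analyticAt_expQuot 0)]
    apply taylorSeries_congr
    have hs : ∀ᶠ u in 𝓝 (0 : ℂ), expQuot u ∈ Complex.slitPlane :=
      (analyticAt_expQuot 0).continuousAt.eventually_mem
        (Complex.isOpen_slitPlane.mem_nhds (by rw [expQuot_zero]; exact Complex.one_mem_slitPlane))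
    filter_upwards [hs] with u hu
    have := ((differentiable_expQuot u).hasDerivAt.clog hu).deriv
    rw [show deriv logExpQuot u = _ from this, div_mul_cancel₀ _ (Complex.slitPlane_ne_zero hu)]
  have hEI := taylorSeries_expQuot_mul_inv
  have hXE := taylorSeries_expQuot_add_X_mul_derivative
  rw [mk_kappaZero, taylorSeries_add (hΨ'.fun_comp (by fun_prop)) analyticAt_logExpQuot, map_add,
    derivative_taylorSeries_comp_exp hΨ]
  set E := taylorSeries expQuot
  set e := taylorSeries Complex.exp
  linear_combination (-(1 + PowerSeries.X * PowerSeries.derivative ℂ (taylorSeries logExpQuot)) -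
    e * PowerSeries.X * taylorSeries fun u => deriv Ψ (Complex.exp u)) * hEI +
    E⁻¹ * hXE + E⁻¹ * PowerSeries.X * hlog

/-- The factor (1 + u E Ψ'(e^u))^(k+1) is expanded by the binomial theorem. The term with exponent
k-m leaves u^(k-m) times the residue integrand of x^k Ψ'(x)^(k-m), and the term with exponent k+1 is
divisible by u^(k+1). -/
theorem limitMoment_eq {Ψ : ℂ → ℂ} (hΨ : AnalyticAt ℂ Ψ 1) (k : ℕ) :
    ((k : ℂ) + 1) * limitMoment Ψ k = PowerSeries.coeff k
      ((PowerSeries.mk fun n => if n = 0 then 1 else kappaZero Ψ n) ^ (k + 1)) := by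
  have hEI := taylorSeries_expQuot_mul_inv
  rw [mk_kappaZero_mul hΨ, mul_pow, add_pow, Finset.mul_sum, map_sum, Finset.sum_range_succ',
    limitMoment, Finset.mul_sum]
  have hw : AnalyticAt ℂ (fun u => deriv Ψ (Complex.exp u)) 0 := by
    have hg' : AnalyticAt ℂ (deriv Ψ) (Complex.exp 0) := by
      rw [Complex.exp_zero]; exact hΨ.deriv
    exact hg'.fun_comp (by fun_prop)
  set w := taylorSeries fun u => deriv Ψ (Complex.exp u) with hwdef
  set E := taylorSeries expQuot
  set e := taylorSeries Complex.exp with he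
  have h0 : PowerSeries.coeff k ((e * E⁻¹) ^ (k + 1) * (1 ^ 0 *
      (PowerSeries.X * E * w) ^ (k + 1 - 0) * ((k + 1).choose 0 : PowerSeries ℂ))) = 0 := by
    refine PowerSeries.X_pow_dvd_iff.1 (?_ : PowerSeries.X ^ (k + 1) ∣ _) k (Nat.lt_succ_self k)
    refine Dvd.dvd.mul_left (Dvd.dvd.mul_right (Dvd.dvd.mul_left ?_ _) _) _
    exact pow_dvd_pow_of_dvd (by rw [mul_assoc]; exact dvd_mul_right _ _) _
  rw [h0, add_zero]
  refine Finset.sum_congr rfl fun m hm => ?_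
  have hmk : m ≤ k := by rw [Finset.mem_range] at hm; omega
  have hg : AnalyticAt ℂ (fun x : ℂ => x ^ k * deriv Ψ x ^ (k - m)) 1 :=
    AnalyticAt.fun_mul (by fun_prop) (hΨ.deriv.fun_pow _)
  have hres := coeff_residue_comp_exp m hg
  rw [taylorSeries_mul (by fun_prop) (hw.fun_pow _), taylorSeries_pow hw,
    taylorSeries_pow (by fun_prop)] at hres
  have h1 : (e * E⁻¹) ^ (k + 1) * (1 ^ (m + 1) * (PowerSeries.X * E * w) ^ (k + 1 - (m + 1)) *
      ((k + 1).choose (m + 1) : PowerSeries ℂ)) = PowerSeries.C ((k + 1).choose (m + 1) : ℂ) *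
      (PowerSeries.X ^ (k - m) * (e ^ k * w ^ (k - m) * e * E⁻¹ ^ (m + 1))) := by
    rw [Nat.add_sub_add_right, map_natCast, mul_pow, mul_pow, mul_pow,
      show E⁻¹ ^ (k + 1) = E⁻¹ ^ (m + 1) * E⁻¹ ^ (k - m) by rw [← pow_add]; congr 1; omega]
    have h2 : E⁻¹ ^ (k - m) * E ^ (k - m) = 1 := by rw [← mul_pow, mul_comm, hEI, one_pow]
    linear_combination (e ^ (k + 1) * E⁻¹ ^ (m + 1) * PowerSeries.X ^ (k - m) * w ^ (k - m) *
      ((k + 1).choose (m + 1) : PowerSeries ℂ)) * h2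
  rw [h1, PowerSeries.coeff_C_mul]
  have h3 := PowerSeries.coeff_X_pow_mul (e ^ k * w ^ (k - m) * e * E⁻¹ ^ (m + 1)) (k - m) m
  rw [show m + (k - m) = k by omega] at h3
  rw [h3, hres, Nat.cast_choose ℂ (by omega : m + 1 ≤ k + 1), Nat.add_sub_add_right,
    Nat.factorial_succ k]
  have hf : ∀ n : ℕ, (n.factorial : ℂ) ≠ 0 := fun n => by exact_mod_cast Nat.factorial_ne_zero n
  have := hf m
  have := hf (m + 1)
  have := hf (k - m)
  push_cast
  field_simp

/-! ### Schur functions as sums of Laurent monomials. -/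

theorem zpow_sub_zpow_mul {u v : ℂ} (hu : u ≠ 0) (hv : v ≠ 0) {p q : ℤ} (hpq : p ≤ q) :
    u ^ p - v ^ (p - q) * u ^ q =
      -(u - v) * ∑ m ∈ Finset.Ico p q, u ^ m * v ^ (p - 1 - m) := by
  induction q, hpq using Int.leInduction with
  | base => simp
  | succ q hq ih =>
    rw [← Finset.insert_Ico_right_eq_Ico_add_one hq, Finset.sum_insert (by simp), mul_add, ← ih,
      show p - (q + 1) = p - 1 - q by ring, show p - q = p - 1 - q + 1 by ring, zpow_add_one₀ hu,
      zpow_add_one₀ hv]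
    ring

theorem prod_Ioi_castSucc {M : Type*} [CommMonoid M] {N : ℕ} (i : Fin N) (f : Fin (N + 1) → M) :
    ∏ j ∈ Finset.Ioi i.castSucc, f j = (∏ j ∈ Finset.Ioi i, f j.castSucc) * f (Fin.last N) := by
  rw [← Finset.filter_lt_eq_Ioi, ← Finset.filter_lt_eq_Ioi, Finset.prod_filter, Finset.prod_filter,
    Fin.prod_univ_castSucc]
  simp [Fin.castSucc_lt_last]

theorem prod_prod_Ioi_succ {M : Type*} [CommMonoid M] {N : ℕ}
    (f : Fin (N + 1) → Fin (N + 1) → M) :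
    ∏ i, ∏ j ∈ Finset.Ioi i, f i j = (∏ i : Fin N, ∏ j ∈ Finset.Ioi i, f i.castSucc j.castSucc) *
      ∏ i : Fin N, f i.castSucc (Fin.last N) := by
  rw [Fin.prod_univ_castSucc]
  simp_rw [prod_Ioi_castSucc]
  rw [Finset.prod_mul_distrib, ← Fin.top_eq_last, Finset.Ioi_top, Finset.prod_empty, mul_one]

/-- This is the Gelfand–Tsetlin branching rule. Column operations clear the row of the last variable
v except for its first entry; each remaining row has a factor u_i - v, and multilinearity of the
cofactor produces the interlacing exponents. All monomials occur with coefficient +1, a positivity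
used for the convergence estimates. -/
theorem exists_schur_weights (N : ℕ) : ∀ l : Fin N → ℤ, StrictAnti l →
    ∃ (ι : Type) (_ : Fintype ι) (_ : Nonempty ι) (a : ι → Fin N → ℤ),
      ∀ u : Fin N → ℂ, (∀ i, u i ≠ 0) → (Matrix.of fun i j : Fin N => u i ^ l j).det =
        (∏ i : Fin N, ∏ j ∈ Finset.Ioi i, (u i - u j)) * ∑ x, ∏ i, u i ^ a x i := by
  induction N with
  | zero =>
    intro l _
    exact ⟨Unit, inferInstance, inferInstance, fun _ => Fin.elim0, fun u _ => by simp⟩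
  | succ N ih =>
    intro l hl
    have hlt : ∀ j : Fin N, l j.succ < l j.castSucc := fun j => hl Fin.castSucc_lt_succ
    -- The strictly decreasing sequences that interlace with l: l_(j+1) ≤ m_j < l_j.
    let I : Finset (Fin N → ℤ) := Fintype.piFinset fun j : Fin N => Finset.Ico (l j.succ) (l j.castSucc)
    have hI : ∀ m : I, StrictAnti m.1 := by
      rintro ⟨m, hm⟩
      rw [Fintype.mem_piFinset] at hm
      intro i j hij
      have hi := Finset.mem_Ico.1 (hm i)
      have hj := Finset.mem_Ico.1 (hm j)
      have : l j.castSucc ≤ l i.succ := hl.antitone (Fin.succ_le_castSucc_iff.2 hij)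
      exact lt_of_lt_of_le hj.2 (this.trans hi.1)
    choose ι hfin hne a ha using fun m : I => ih m.1 (hI m)
    have hIne : Nonempty I := ⟨⟨fun j => l j.succ, Fintype.mem_piFinset.2 fun j =>
      Finset.left_mem_Ico.2 (hlt j)⟩⟩
    refine ⟨Σ m : I, ι m, inferInstance, ⟨⟨hIne.some, (hne _).some⟩⟩, fun x => Fin.snoc (a x.1 x.2)
      (l 0 + ∑ j : Fin N, (l j.succ - 1 - x.1.1 j)), fun u hu => ?_⟩
    set v := u (Fin.last N) with hv
    have hv0 : v ≠ 0 := hu _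
    let w : Fin N → ℂ := fun i => u i.castSucc
    -- From each column a multiple of the preceding original column is subtracted, chosen to make
    -- the entry at u_i = v vanish.
    let B : Matrix (Fin (N + 1)) (Fin (N + 1)) ℂ := Matrix.of fun i => Fin.cons (u i ^ l 0)
      fun j : Fin N => u i ^ l j.succ - v ^ (l j.succ - l j.castSucc) * u i ^ l j.castSucc
    have h1 : (Matrix.of fun i j : Fin (N + 1) => u i ^ l j).det = B.det := by
      refine Matrix.det_eq_of_forall_col_eq_smul_add_pred
        (fun j : Fin N => v ^ (l j.succ - l j.castSucc)) (fun i => ?_) fun i j => ?_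
      · simp [B]
      · simp [B]
    have hBlast : ∀ j : Fin N, B (Fin.last N) j.succ = 0 := fun j => by
      simp only [B, Matrix.of_apply, Fin.cons_succ]
      rw [← hv, ← zpow_add₀ hv0]
      simp
    have h2 : B.det = (-1) ^ N * v ^ l 0 *
        (Matrix.of fun i j : Fin N => -(w i - v) *
          ∑ m ∈ Finset.Ico (l j.succ) (l j.castSucc), v ^ (l j.succ - 1 - m) * w i ^ m).det := by
      rw [Matrix.det_succ_row B (Fin.last N), Fin.sum_univ_succ, Finset.sum_eq_zero fun j _ => by
        rw [hBlast, mul_zero, zero_mul], add_zero]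
      have h0 : B (Fin.last N) 0 = v ^ l 0 := by simp [B, hv]
      rw [h0, Fin.val_last, Fin.val_zero, add_zero]
      congr 2
      ext i j
      simp only [Matrix.submatrix_apply, Fin.succAbove_last, Fin.succAbove_zero, B,
        Matrix.of_apply, Fin.cons_succ, w]
      rw [zpow_sub_zpow_mul (hu _) hv0 (hlt j).le]
      congr 1
      exact Finset.sum_congr rfl fun m _ => mul_comm _ _
    have h3 : (Matrix.of fun i j : Fin N => -(w i - v) *
          ∑ m ∈ Finset.Ico (l j.succ) (l j.castSucc), v ^ (l j.succ - 1 - m) * w i ^ m).det =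
        (∏ i, -(w i - v)) * ∑ m ∈ I, (∏ j, v ^ (l j.succ - 1 - m j)) *
          (Matrix.of fun i j : Fin N => w i ^ m j).det := by
      refine (Matrix.det_mul_column (fun i => -(w i - v)) (Matrix.of fun i j : Fin N =>
        ∑ m ∈ Finset.Ico (l j.succ) (l j.castSucc), v ^ (l j.succ - 1 - m) * w i ^ m)).trans ?_
      congr 1
      rw [← Matrix.det_transpose]
      have := (Matrix.detRowAlternating (n := Fin N) (R := ℂ)).toMultilinearMap.map_sum_finset
        (fun (j : Fin N) (m : ℤ) (i : Fin N) => v ^ (l j.succ - 1 - m) * w i ^ m)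
        (fun j => Finset.Ico (l j.succ) (l j.castSucc))
      refine (Eq.trans ?_ this).trans ?_
      · change Matrix.det _ = Matrix.det _
        congr 1
        ext j i
        simp
      · refine Finset.sum_congr rfl fun m _ => ?_
        rw [← Matrix.det_transpose (Matrix.of fun i j : Fin N => w i ^ m j)]
        exact Matrix.det_mul_column (fun j : Fin N => v ^ (l j.succ - 1 - m j))
          (fun j i : Fin N => w i ^ m j)
    rw [h1, h2, h3, prod_prod_Ioi_succ, Fintype.sum_sigma]
    have h4 : ∑ m ∈ I, (∏ j, v ^ (l j.succ - 1 - m j)) *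
          (Matrix.of fun i j : Fin N => w i ^ m j).det =
        (∏ i : Fin N, ∏ j ∈ Finset.Ioi i, (w i - w j)) * ∑ m : I, (∏ j, v ^ (l j.succ - 1 - m.1 j)) *
          ∑ x, ∏ i, w i ^ a m x i := by
      rw [← Finset.sum_coe_sort, Finset.mul_sum]
      refine Finset.sum_congr rfl fun m _ => ?_
      rw [ha m w fun i => hu _]
      ring
    have h5 : (∏ i, -(w i - v)) = (-1) ^ N * ∏ i, (w i - v) := by
      rw [Finset.prod_neg, Finset.card_univ, Fintype.card_fin]
    -- The sign of the cofactor cancels the sign from the N factors -(w_i - v).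
    have h6 : ((-1 : ℂ)) ^ N * (-1) ^ N = 1 := by rw [← mul_pow]; simp
    have h7 : ∑ m : I, ∑ x : ι m, ∏ i, u i ^ (Fin.snoc (α := fun _ => ℤ) (a m x)
        (l 0 + ∑ j : Fin N, (l j.succ - 1 - m.1 j)) : Fin (N + 1) → ℤ) i =
        v ^ l 0 * ∑ m : I, (∏ j, v ^ (l j.succ - 1 - m.1 j)) * ∑ x, ∏ i, w i ^ a m x i := by
      rw [Finset.mul_sum]
      refine Finset.sum_congr rfl fun m _ => ?_
      rw [Finset.mul_sum, Finset.mul_sum]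
      refine Finset.sum_congr rfl fun x _ => ?_
      rw [Fin.prod_univ_castSucc]
      simp only [Fin.snoc_castSucc, Fin.snoc_last]
      rw [zpow_add₀ hv0]
      have : v ^ (∑ j : Fin N, (l j.succ - 1 - m.1 j)) = ∏ j, v ^ (l j.succ - 1 - m.1 j) := by
        induction (Finset.univ : Finset (Fin N)) using Finset.induction_on with
        | empty => simp
        | insert b s hb ih => rw [Finset.sum_insert hb, Finset.prod_insert hb, zpow_add₀ hv0, ih]
      rw [this]
      ring
    rw [h4, h5, h7]
    linear_combination (v ^ l 0 * (∏ i, (w i - v)) * ((∏ i : Fin N, ∏ j ∈ Finset.Ioi i, (w i - w j)) *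
      ∑ m : I, (∏ j, v ^ (l j.succ - 1 - m.1 j)) * ∑ x, ∏ i, w i ^ a m x i)) * h6

/-- On the line u + s (0, 1, 2, ...) two coordinates coincide for at most one value of s. -/
theorem dense_injective (N : ℕ) : Dense {u : Fin N → ℂ | Function.Injective u} := by
  intro u
  have h1 : Tendsto (fun s : ℂ => u + s • fun i : Fin N => (i : ℂ)) (𝓝[≠] 0) (𝓝 u) := by
    refine Tendsto.mono_left ?_ nhdsWithin_le_nhds
    exact Continuous.tendsto' (by fun_prop) _ _ (by simp)
  refine mem_closure_of_tendsto h1 ?_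
  have h2 : ∀ i j : Fin N, ∀ᶠ s in 𝓝[≠] (0 : ℂ), u i + s * (i : ℂ) = u j + s * (j : ℂ) → i = j := by
    intro i j
    by_cases hij : i = j
    · exact Eventually.of_forall fun _ _ => hij
    · have hd : (i : ℂ) - (j : ℂ) ≠ 0 := by
        rw [sub_ne_zero]
        exact_mod_cast fun h => hij (Fin.ext h)
      have h3 : ∀ᶠ s in 𝓝[≠] (0 : ℂ), s ≠ (u j - u i) / ((i : ℂ) - (j : ℂ)) := by
        by_cases h0 : (u j - u i) / ((i : ℂ) - (j : ℂ)) = 0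
        · rw [h0]
          exact self_mem_nhdsWithin
        · exact (eventually_ne_nhds (Ne.symm h0)).filter_mono nhdsWithin_le_nhds
      filter_upwards [h3] with s hs h
      refine absurd ?_ hs
      rw [eq_div_iff hd]
      linear_combination h
  filter_upwards [eventually_all.2 fun i => eventually_all.2 (h2 i)] with s hs
  intro i j h
  exact hs i j (by simpa using h)

theorem Signature.strictAnti_shifted {N : ℕ} (l : Signature N) : StrictAnti l.shifted := by
  intro i j hij
  have h1 := l.2 hij.le
  have h2 : (i : ℤ) < (j : ℤ) := by exact_mod_cast hij
  rw [Signature.shifted, Signature.shifted]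
  linarith

theorem prod_sub_ne_zero {N : ℕ} {u : Fin N → ℂ} (hu : Function.Injective u) :
    ∏ i : Fin N, ∏ j ∈ Finset.Ioi i, (u i - u j) ≠ 0 := by
  refine Finset.prod_ne_zero_iff.2 fun i _ => Finset.prod_ne_zero_iff.2 fun j hj => ?_
  rw [sub_ne_zero]
  exact fun h => (Finset.mem_Ioi.1 hj).ne (hu h)

theorem exists_schurFun_eq_sum {N : ℕ} (l : Signature N) :
    ∃ (ι : Type) (_ : Fintype ι) (_ : Nonempty ι) (a : ι → Fin N → ℤ),
      ∀ u : Fin N → ℂ, (∀ i, u i ≠ 0) → schurFun l u = ∑ x, ∏ i, u i ^ a x i ∧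
        (Matrix.of fun i j : Fin N => u i ^ l.shifted j).det =
          (∏ i : Fin N, ∏ j ∈ Finset.Ioi i, (u i - u j)) * schurFun l u := by
  obtain ⟨ι, hf, hn, a, ha⟩ := exists_schur_weights N l.shifted l.strictAnti_shifted
  refine ⟨ι, hf, hn, a, fun u hu => ?_⟩
  have h : schurFun l u = ∑ x, ∏ i, u i ^ a x i := by
    refine extendFrom_eq (dense_injective N u) ?_
    have hc : ContinuousAt (fun u : Fin N → ℂ => ∑ x, ∏ i, u i ^ a x i) u := by
      refine tendsto_finsetSum _ fun x _ => tendsto_finsetProd _ fun i _ => ?_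
      exact (continuous_apply i).continuousAt.zpow₀ _ (Or.inl (hu i))
    refine (hc.tendsto.mono_left nhdsWithin_le_nhds).congr' ?_
    have h0 : ∀ᶠ w in 𝓝 u, ∀ i, w i ≠ 0 := eventually_all.2 fun i =>
      (continuous_apply i).continuousAt.eventually_ne (hu i)
    filter_upwards [self_mem_nhdsWithin, h0.filter_mono nhdsWithin_le_nhds] with w hw hw0
    rw [schurRatio, ha w hw0, mul_div_cancel_left₀ _ (prod_sub_ne_zero hw)]
  exact ⟨h, by rw [h]; exact ha u hu⟩

theorem continuousAt_schurFun {N : ℕ} (l : Signature N) {u : Fin N → ℂ} (hu : ∀ i, u i ≠ 0) :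
    ContinuousAt (schurFun l) u := by
  obtain ⟨ι, hf, hn, a, ha⟩ := exists_schurFun_eq_sum l
  have hc : ContinuousAt (fun u : Fin N → ℂ => ∑ x, ∏ i, u i ^ a x i) u := by
    refine tendsto_finsetSum _ fun x _ => tendsto_finsetProd _ fun i _ => ?_
    exact (continuous_apply i).continuousAt.zpow₀ _ (Or.inl (hu i))
  refine hc.congr ?_
  filter_upwards [eventually_all.2 fun i =>
    (continuous_apply i).continuousAt.eventually_ne (hu i)] with v hv
  exact (ha v hv).1.symm

/-- Numerator and denominator both acquire the sign of the permutation at points with distinct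
coordinates; density and continuity give the rest. -/
theorem schurFun_comp_perm {N : ℕ} (l : Signature N) (σ : Equiv.Perm (Fin N)) {u : Fin N → ℂ}
    (hu : ∀ i, u i ≠ 0) : schurFun l (u ∘ σ) = schurFun l u := by
  obtain ⟨ι, hf, hn, a, ha⟩ := exists_schurFun_eq_sum l
  have hinj : ∀ w : Fin N → ℂ, Function.Injective w → (∀ i, w i ≠ 0) →
      schurFun l (w ∘ σ) = schurFun l w := by
    intro w hw hw0
    have h1 := (ha w hw0).2
    have h2 := (ha (w ∘ σ) fun i => hw0 _).2
    have h3 : ∀ w : Fin N → ℂ, ∏ i : Fin N, ∏ j ∈ Finset.Ioi i, (w i - w j) =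
        (Matrix.vandermonde fun i => -w i).det := fun w => by
      rw [Matrix.det_vandermonde]
      exact Finset.prod_congr rfl fun i _ => Finset.prod_congr rfl fun j _ => by ring
    have h4 : (Matrix.vandermonde fun i => -(w ∘ σ) i).det =
        Equiv.Perm.sign σ * (Matrix.vandermonde fun i => -w i).det :=
      Matrix.det_permute σ (Matrix.vandermonde fun i => -w i)
    have h5 : (Matrix.of fun i j : Fin N => (w ∘ σ) i ^ l.shifted j).det =
        Equiv.Perm.sign σ * (Matrix.of fun i j : Fin N => w i ^ l.shifted j).det :=
      Matrix.det_permute σ (Matrix.of fun i j : Fin N => w i ^ l.shifted j)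
    rw [h5, h1, h3, h3, h4, mul_assoc] at h2
    have hs : ((Equiv.Perm.sign σ : ℤ) : ℂ) ≠ 0 := by
      exact_mod_cast (Equiv.Perm.sign σ).ne_zero
    have hv := prod_sub_ne_zero hw
    rw [h3] at hv
    exact (mul_left_cancel₀ hv (mul_left_cancel₀ hs h2)).symm
  have hne : (𝓝[{u : Fin N → ℂ | Function.Injective u}] u).NeBot :=
    mem_closure_iff_nhdsWithin_neBot.1 (dense_injective N u)
  have hcσ : Continuous fun w : Fin N → ℂ => w ∘ σ := by fun_prop
  have t1 : Tendsto (fun w => schurFun l (w ∘ σ)) (𝓝[{u : Fin N → ℂ | Function.Injective u}] u)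
      (𝓝 (schurFun l (u ∘ σ))) :=
    ((ContinuousAt.comp (f := fun w : Fin N → ℂ => w ∘ σ) (x := u) (continuousAt_schurFun l fun i => hu _)
      hcσ.continuousAt).tendsto).mono_left nhdsWithin_le_nhds
  have t2 := (continuousAt_schurFun l hu).tendsto.mono_left
    (nhdsWithin_le_nhds (s := {u : Fin N → ℂ | Function.Injective u}))
  refine tendsto_nhds_unique (t1.congr' ?_) t2
  have h0 : ∀ᶠ w in 𝓝 u, ∀ i, w i ≠ 0 := eventually_all.2 fun i =>
    (continuous_apply i).continuousAt.eventually_ne (hu i)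
  filter_upwards [self_mem_nhdsWithin, h0.filter_mono nhdsWithin_le_nhds] with w hw hw0
  exact hinj w hw hw0

/-! ### Confluent determinants: letting variables tend to 1. -/

section Confluent

variable {N : ℕ}

/-- The matrix with rows `exp (t_i l_j)` for `i < r` and confluent rows `l_j ^ (N - 1 - i)` for
`i ≥ r`. -/
noncomputable def confluentMatrix (l : Fin N → ℤ) (r : ℕ) (t : Fin N → ℂ) :
    Matrix (Fin N) (Fin N) ℂ :=
  Matrix.of fun i j =>
    if (i : ℕ) < r then Complex.exp (t i * (l j : ℂ)) else (l j : ℂ) ^ (N - 1 - (i : ℕ))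

/-- The point `(e ^ t_0, …, e ^ t_{r-1}, 1, …, 1)`. -/
noncomputable def expPad (r : ℕ) (t : Fin N → ℂ) (i : Fin N) : ℂ :=
  if (i : ℕ) < r then Complex.exp (t i) else 1

/-- The factor of index `i` in the confluent Vandermonde determinant. -/
noncomputable def confluentFactor (r : ℕ) (t : Fin N → ℂ) (i : Fin N) : ℂ :=
  if (i : ℕ) < r then
    ∏ j ∈ Finset.Ioi i, (Complex.exp (t i) - if (j : ℕ) < r then Complex.exp (t j) else 1)
  else ((N - 1 - (i : ℕ)).factorial : ℂ)

theorem exists_exp_eq_sum_add (n : ℕ) : ∃ F : ℂ → ℂ, ContinuousAt F 0 ∧ F 0 = 1 / n.factorial ∧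
    ∀ z, Complex.exp z = (∑ a ∈ Finset.range n, (1 / (a.factorial : ℂ)) * z ^ a) + z ^ n * F z := by
  obtain ⟨F, hF, h⟩ :=
    (Differentiable.analyticAt Complex.differentiable_exp 0).exists_eq_sum_add_pow_mul (n + 1)
  have hF' := hF.continuousAt
  refine ⟨fun z => 1 / n.factorial + z * F z, by fun_prop, by simp, fun z => ?_⟩
  rw [h z, Finset.sum_range_succ]
  simp only [smul_eq_mul, iteratedDeriv_eq_iterate, Complex.iter_deriv_exp, Complex.exp_zero,
    mul_one]
  have : ∀ a : ℕ, z ^ a / (a.factorial : ℂ) = 1 / (a.factorial : ℂ) * z ^ a := fun a => by ring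
  simp_rw [this]
  ring

theorem confluentMatrix_succ (l : Fin N → ℤ) (p : Fin N) (t : Fin N → ℂ) (s : ℂ) :
    confluentMatrix l (p + 1) (Function.update t p s) =
      (confluentMatrix l p t).updateRow p fun j => Complex.exp (s * (l j : ℂ)) := by
  ext i j
  rw [Matrix.updateRow_apply]
  split_ifs with h
  · subst h
    simp [confluentMatrix]
  · have : ((i : ℕ) < p + 1) ↔ (i : ℕ) < p := by
      have : (i : ℕ) ≠ p := fun h' => h (Fin.ext h')
      omega
    simp only [confluentMatrix, Matrix.of_apply, this, Function.update_of_ne h]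

/-- The Taylor terms of degree below N-1-p are multiples of the confluent rows below row p, so they
do not change the determinant, and s^(N-1-p) factors out of the remainder. -/
theorem det_updateRow_exp (l : Fin N → ℤ) (p : Fin N) (t : Fin N → ℂ) (s : ℂ) {F : ℂ → ℂ}
    (hF : ∀ z, Complex.exp z = (∑ a ∈ Finset.range (N - 1 - p), (1 / (a.factorial : ℂ)) * z ^ a) +
      z ^ (N - 1 - (p : ℕ)) * F z) :
    ((confluentMatrix l p t).updateRow p fun j => Complex.exp (s * (l j : ℂ))).det =
      s ^ (N - 1 - (p : ℕ)) * ((confluentMatrix l p t).updateRow p fun j =>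
        (l j : ℂ) ^ (N - 1 - (p : ℕ)) * F (s * (l j : ℂ))).det := by
  have h1 : (fun j => Complex.exp (s * (l j : ℂ))) =
      (∑ a ∈ Finset.range (N - 1 - p), (s ^ a / (a.factorial : ℂ)) • fun j => (l j : ℂ) ^ a) +
      s ^ (N - 1 - (p : ℕ)) • fun j => (l j : ℂ) ^ (N - 1 - (p : ℕ)) * F (s * (l j : ℂ)) := by
    funext j
    rw [hF]
    simp only [Pi.add_apply, Finset.sum_apply, Pi.smul_apply, smul_eq_mul, mul_pow]
    congr 1
    · exact Finset.sum_congr rfl fun a _ => by ring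
    · ring
  have h2 : ∀ S ⊆ Finset.range (N - 1 - (p : ℕ)), ((confluentMatrix l p t).updateRow p
      (∑ a ∈ S, (s ^ a / (a.factorial : ℂ)) • fun j => (l j : ℂ) ^ a)).det = 0 := by
    intro S
    induction S using Finset.induction_on with
    | empty =>
      intro _
      exact Matrix.det_eq_zero_of_row_eq_zero p fun j => by simp
    | insert a S ha ih =>
      intro hS
      have haN := Finset.mem_range.1 (hS (Finset.mem_insert_self a S))
      have hrow : (fun j => (l j : ℂ) ^ a) = (confluentMatrix l p t) ⟨N - 1 - a, by omega⟩ := by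
        funext j
        simp only [confluentMatrix, Matrix.of_apply]
        rw [if_neg (by omega)]
        congr 1
        omega
      rw [Finset.sum_insert ha, Matrix.det_updateRow_add, ih ((Finset.subset_insert a S).trans hS),
        add_zero, Matrix.det_updateRow_smul, hrow, Matrix.det_updateRow_eq_zero, mul_zero]
      exact fun h => by have := congrArg Fin.val h; simp only at this; omega
  rw [h1, Matrix.det_updateRow_add, Matrix.det_updateRow_smul, h2 _ subset_rfl, zero_add]

/-- Downward induction on the number of free variables: the variable with index p tends to 0 after
the common factor s^(N-1-p) has been cancelled. At r = N this is the quotient of alternants in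
exponential coordinates. -/
theorem confluent_det {f : (Fin N → ℂ) → ℂ} (l : Fin N → ℤ)
    (hf : ∀ u : Fin N → ℂ, (∀ i, u i ≠ 0) → ContinuousAt f u ∧
      (Matrix.of fun i j : Fin N => u i ^ l j).det =
        (∏ i : Fin N, ∏ j ∈ Finset.Ioi i, (u i - u j)) * f u) {r : ℕ} (hr : r ≤ N) :
    ∀ t : Fin N → ℂ, f (expPad r t) * ∏ i, confluentFactor r t i =
      (confluentMatrix l r t).det := by
  induction hr using Nat.decreasingInduction with
  | self =>
    intro t
    have h1 : expPad N t = fun i => Complex.exp (t i) := by funext i; simp [expPad]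
    have h2 : confluentMatrix l N t = Matrix.of fun i j : Fin N => Complex.exp (t i) ^ l j := by
      ext i j
      simp [confluentMatrix, ← Complex.exp_int_mul, mul_comm]
    rw [h1, h2, (hf _ fun i => Complex.exp_ne_zero _).2, mul_comm]
    simp [confluentFactor]
  | of_succ r hr ih =>
    intro t
    obtain ⟨p, rfl⟩ : ∃ p : Fin N, (p : ℕ) = r := ⟨⟨r, hr⟩, rfl⟩
    set n := N - 1 - (p : ℕ) with hn
    obtain ⟨F, hFc, hF0, hF⟩ := exists_exp_eq_sum_add n
    have hcard : (Finset.Ioi p).card = n := by rw [Fin.card_Ioi]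
    let A : ℂ → Fin N → ℂ := fun s i => confluentFactor (p + 1) (Function.update t p s) i
    have hA : ∀ i, i ≠ p → Continuous fun s => A s i := by
      intro i hi
      simp only [A, confluentFactor, Function.update_of_ne hi]
      split_ifs with h
      · refine continuous_finsetProd _ fun j _ => ?_
        split_ifs
        · refine continuous_const.sub (Complex.continuous_exp.comp ?_)
          by_cases hj : j = p
          · subst hj; simpa using continuous_id'
          · simpa [Function.update_of_ne hj] using continuous_const
        · exact continuous_const
      · exact continuous_const
    have hA0 : ∀ i, i ≠ p → A 0 i = confluentFactor p t i := by
      intro i hi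
      have hi' : (i : ℕ) ≠ p := fun h' => hi (Fin.ext h')
      simp only [A, confluentFactor, Function.update_of_ne hi]
      have : ((i : ℕ) < p + 1) ↔ (i : ℕ) < p := by omega
      simp only [this]
      split_ifs with h
      · refine Finset.prod_congr rfl fun j _ => ?_
        congr 1
        by_cases hj : j = p
        · subst hj; simp
        · have hj' : (j : ℕ) ≠ p := fun h' => hj (Fin.ext h')
          have : ((j : ℕ) < p + 1) ↔ (j : ℕ) < p := by omega
          simp [this, Function.update_of_ne hj]
      · rfl
    have hAp : ∀ s, A s p = s ^ n * expQuot s ^ n := by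
      intro s
      simp only [A, confluentFactor, Function.update_self]
      rw [if_pos (Nat.lt_succ_self _), ← mul_pow, mul_expQuot, ← hcard, ← Finset.prod_const]
      refine Finset.prod_congr rfl fun j hj => ?_
      have : (p : ℕ) < j := Fin.lt_def.1 (Finset.mem_Ioi.1 hj)
      rw [if_neg (by omega)]
    -- The formula for p + 1 variables divided by s^n; both sides now have limits as s → 0. On the
    -- right, F(0) = 1/n! supplies the factorial in `confluentFactor`.
    have key : ∀ s, s ≠ 0 → f (expPad (p + 1) (Function.update t p s)) * (expQuot s ^ n *
        ∏ i ∈ Finset.univ.erase p, A s i) = ((confluentMatrix l p t).updateRow p fun j =>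
        (l j : ℂ) ^ n * F (s * (l j : ℂ))).det := by
      intro s hs
      have h1 := ih (Function.update t p s)
      rw [confluentMatrix_succ, det_updateRow_exp l p t s hF,
        ← Finset.mul_prod_erase _ _ (Finset.mem_univ p)] at h1
      have h2 := hAp s
      simp only [A] at h2
      rw [h2] at h1
      refine mul_left_cancel₀ (pow_ne_zero n hs) ?_
      rw [← h1]
      ring
    have hpad : Tendsto (fun s => expPad (p + 1) (Function.update t p s)) (𝓝 0)
        (𝓝 (expPad p t)) := by
      rw [tendsto_pi_nhds]
      intro i
      by_cases hi : i = p
      · subst hi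
        simp only [expPad, Function.update_self, Nat.lt_succ_self, if_true, lt_irrefl, if_false]
        exact Complex.continuous_exp.tendsto' _ _ Complex.exp_zero
      · have hi' : (i : ℕ) ≠ p := fun h' => hi (Fin.ext h')
        have : ((i : ℕ) < p + 1) ↔ (i : ℕ) < p := by omega
        simp only [expPad, this, Function.update_of_ne hi]
        exact tendsto_const_nhds
    have hfc := (hf (expPad p t) fun i => by
      unfold expPad; split_ifs; exacts [Complex.exp_ne_zero _, one_ne_zero]).1
    have t1 : Tendsto (fun s => f (expPad (p + 1) (Function.update t p s)) * (expQuot s ^ n *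
        ∏ i ∈ Finset.univ.erase p, A s i)) (𝓝[≠] 0)
        (𝓝 (f (expPad p t) * (1 ^ n * ∏ i ∈ Finset.univ.erase p, confluentFactor p t i))) := by
      refine Tendsto.mono_left ?_ nhdsWithin_le_nhds
      refine (hfc.tendsto.comp hpad).mul (Tendsto.mul (Tendsto.pow ?_ n) ?_)
      · rw [← expQuot_zero]
        exact differentiable_expQuot.continuous.tendsto 0
      · refine tendsto_finsetProd _ fun i hi => ?_
        have hi := Finset.ne_of_mem_erase hi
        rw [← hA0 i hi]
        exact (hA i hi).tendsto 0
    have t2 : Tendsto (fun s => ((confluentMatrix l p t).updateRow p fun j =>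
        (l j : ℂ) ^ n * F (s * (l j : ℂ))).det) (𝓝[≠] 0)
        (𝓝 ((confluentMatrix l p t).updateRow p fun j => (l j : ℂ) ^ n * F 0).det) := by
      refine Tendsto.mono_left ?_ nhdsWithin_le_nhds
      have hcd : Continuous fun M : Matrix (Fin N) (Fin N) ℂ => M.det :=
        continuous_id.matrix_det
      refine (hcd.tendsto _).comp ?_
      refine tendsto_pi_nhds.2 fun i => tendsto_pi_nhds.2 fun j => ?_
      simp only [Matrix.updateRow_apply]
      split_ifs
      · refine Tendsto.const_mul _ (hFc.tendsto.comp ?_)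
        exact Continuous.tendsto' (by fun_prop) _ _ (by simp)
      · exact tendsto_const_nhds
    have h3 := tendsto_nhds_unique t1 (t2.congr' (by
      filter_upwards [self_mem_nhdsWithin] with s hs
      exact (key s hs).symm))
    have h4 : (fun j => (l j : ℂ) ^ n * F 0) = (1 / (n.factorial : ℂ)) •
        (confluentMatrix l p t) p := by
      funext j
      simp [confluentMatrix, hF0, hn, mul_comm]
    rw [h4, Matrix.det_updateRow_smul, Matrix.updateRow_eq_self, one_pow, one_mul] at h3
    rw [← Finset.mul_prod_erase _ _ (Finset.mem_univ p)]
    have h5 : confluentFactor p t p = n.factorial := by simp [confluentFactor, hn]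
    have hfn : (n.factorial : ℂ) ≠ 0 := by exact_mod_cast Nat.factorial_ne_zero n
    rw [h5, mul_left_comm, h3]
    field_simp

end Confluent

/-! ### Symmetric polynomials and their hook coefficients. -/

section SymmetricPolynomials

variable {k : ℕ}

/-- Newton's identities, with division by n. -/
theorem esymm_mem_adjoin_psum (n : ℕ) (hn : n ≤ k) :
    MvPolynomial.esymm (Fin k) ℂ n ∈ Algebra.adjoin ℂ
      ((MvPolynomial.psum (Fin k) ℂ) '' (Finset.Icc 1 k : Finset ℕ)) := by
  induction n using Nat.strong_induction_on with
  | _ n ih =>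
    rcases Nat.eq_zero_or_pos n with rfl | hpos
    · rw [MvPolynomial.esymm_zero]
      exact one_mem _
    · have h := MvPolynomial.mul_esymm_eq_sum (Fin k) ℂ n
      have hn0 : (n : ℂ) ≠ 0 := by exact_mod_cast hpos.ne'
      have h2 : MvPolynomial.esymm (Fin k) ℂ n = ((n : ℂ)⁻¹) • ((n : MvPolynomial (Fin k) ℂ) *
          MvPolynomial.esymm (Fin k) ℂ n) := by
        rw [← map_natCast (MvPolynomial.C (R := ℂ) (σ := Fin k)), ← MvPolynomial.smul_eq_C_mul,
          smul_smul, inv_mul_cancel₀ hn0, one_smul]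
      rw [h2, h]
      refine Subalgebra.smul_mem _ (mul_mem (pow_mem (neg_mem (one_mem _)) _)
        (sum_mem fun a ha => ?_)) _
      rw [Finset.mem_filter, Finset.HasAntidiagonal.mem_antidiagonal] at ha
      refine mul_mem (mul_mem (pow_mem (neg_mem (one_mem _)) _) (ih _ ha.2 (by omega))) ?_
      exact Algebra.subset_adjoin ⟨a.2, by simp; omega, rfl⟩

theorem mem_adjoin_psum {f : MvPolynomial (Fin k) ℂ} (hf : f.IsSymmetric) :
    f ∈ Algebra.adjoin ℂ ((MvPolynomial.psum (Fin k) ℂ) '' (Finset.Icc 1 k : Finset ℕ)) := by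
  obtain ⟨p, hp⟩ := MvPolynomial.esymmAlgHom_fin_surjective ℂ (le_refl k) ⟨f, hf⟩
  have h1 : f = MvPolynomial.aeval (fun i : Fin k => MvPolynomial.esymm (Fin k) ℂ (i + 1)) p := by
    have h2 := congrArg Subtype.val hp
    rw [MvPolynomial.esymmAlgHom_apply] at h2
    exact h2.symm
  rw [h1]
  have h3 := (MvPolynomial.aeval (R := ℂ)
    (fun i : Fin k => (⟨MvPolynomial.esymm (Fin k) ℂ (i + 1), esymm_mem_adjoin_psum _ i.2⟩ :
    Algebra.adjoin ℂ ((MvPolynomial.psum (Fin k) ℂ) '' (Finset.Icc 1 k : Finset ℕ)))) p).2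
  convert h3
  rw [← Subalgebra.coe_val, ← AlgHom.comp_apply, MvPolynomial.comp_aeval]
  rfl

/-- The products of power sums of total degree `d`. -/
def psumProducts (k d : ℕ) : Set (MvPolynomial (Fin k) ℂ) :=
  {f | ∃ s : Multiset ℕ, (∀ m ∈ s, 1 ≤ m ∧ m ≤ k) ∧ s.sum = d ∧
    (s.map (MvPolynomial.psum (Fin k) ℂ)).prod = f}

theorem isHomogeneous_psum (m : ℕ) : (MvPolynomial.psum (Fin k) ℂ m).IsHomogeneous m :=
  MvPolynomial.IsHomogeneous.sum _ _ _ fun i _ => by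
    simpa using (MvPolynomial.isHomogeneous_X ℂ i).pow m

theorem isHomogeneous_prod_psum (s : Multiset ℕ) :
    (s.map (MvPolynomial.psum (Fin k) ℂ)).prod.IsHomogeneous s.sum := by
  induction s using Multiset.induction_on with
  | empty => simpa using MvPolynomial.isHomogeneous_one (Fin k) ℂ
  | cons m s ih =>
    rw [Multiset.map_cons, Multiset.prod_cons, Multiset.sum_cons]
    exact (isHomogeneous_psum m).mul ih

/-- A symmetric polynomial is a polynomial in the power sums; taking the component of degree d keeps
exactly the products of that degree. -/
theorem mem_span_psumProducts {f : MvPolynomial (Fin k) ℂ} {d : ℕ} (hf : f.IsSymmetric)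
    (hd : f.IsHomogeneous d) : f ∈ Submodule.span ℂ (psumProducts k d) := by
  have h := mem_adjoin_psum hf
  rw [← Subalgebra.mem_toSubmodule, Algebra.adjoin_eq_span] at h
  have h2 := Submodule.mem_map_of_mem (f := MvPolynomial.homogeneousComponent d) h
  rw [MvPolynomial.homogeneousComponent_eq_self
    ((MvPolynomial.mem_homogeneousSubmodule d f).2 hd), Submodule.map_span] at h2
  refine Submodule.span_le.2 ?_ h2
  rintro _ ⟨g, hg, rfl⟩
  obtain ⟨s, hs, rfl⟩ := Submonoid.exists_multiset_of_mem_closure hg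
  have : ∃ r : Multiset ℕ, (∀ m ∈ r, 1 ≤ m ∧ m ≤ k) ∧ r.map (MvPolynomial.psum (Fin k) ℂ) = s := by
    clear hg
    induction s using Multiset.induction_on with
    | empty => exact ⟨0, by simp, by simp⟩
    | cons a s ih =>
      obtain ⟨r, hr, rfl⟩ := ih fun y hy => hs y (Multiset.mem_cons_of_mem hy)
      obtain ⟨m, hm, rfl⟩ := hs a (Multiset.mem_cons_self _ _)
      refine ⟨m ::ₘ r, fun x hx => ?_, by simp⟩
      rcases Multiset.mem_cons.1 hx with rfl | hx
      · simpa using hm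
      · exact hr x hx
  obtain ⟨r, hr, rfl⟩ := this
  rw [SetLike.mem_coe, MvPolynomial.homogeneousComponent_of_mem
    ((MvPolynomial.mem_homogeneousSubmodule _ _).2 (isHomogeneous_prod_psum r))]
  split_ifs with h3
  · exact Submodule.subset_span ⟨r, hr, h3.symm, rfl⟩
  · exact zero_mem _

/-- Antisymmetry under transpositions of the variables. -/
def IsAlternatingPoly (Y : MvPolynomial (Fin k) ℂ) : Prop :=
  ∀ i j : Fin k, i ≠ j → MvPolynomial.rename (Equiv.swap i j) Y = -Y

theorem IsAlternatingPoly.symm_mul {f Y : MvPolynomial (Fin k) ℂ} (hY : IsAlternatingPoly Y)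
    (hf : f.IsSymmetric) : IsAlternatingPoly (f * Y) := fun i j hij => by
  rw [map_mul, hf, hY i j hij, mul_neg]

theorem IsAlternatingPoly.coeff_eq_neg {Y : MvPolynomial (Fin k) ℂ} (hY : IsAlternatingPoly Y)
    {i j : Fin k} (hij : i ≠ j) {d e : Fin k →₀ ℕ} (h : ∀ x, e x = d (Equiv.swap i j x)) :
    Y.coeff e = -Y.coeff d := by
  have h1 : e = Finsupp.mapDomain (Equiv.swap i j) d := by
    ext x
    rw [h, Finsupp.mapDomain_equiv_apply, Equiv.symm_swap]
  have h2 := MvPolynomial.coeff_rename_mapDomain (Equiv.swap i j) (Equiv.injective _) Y d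
  rw [hY i j hij, ← h1, MvPolynomial.coeff_neg] at h2
  rw [← h2, neg_neg]

theorem IsAlternatingPoly.coeff_eq_zero {Y : MvPolynomial (Fin k) ℂ} (hY : IsAlternatingPoly Y)
    {i j : Fin k} (hij : i ≠ j) {d : Fin k →₀ ℕ} (h : d i = d j) : Y.coeff d = 0 := by
  have h1 : Y.coeff d = -Y.coeff d := hY.coeff_eq_neg hij fun x => by
    rcases eq_or_ne x i with rfl | hi
    · rw [Equiv.swap_apply_left, h]
    rcases eq_or_ne x j with rfl | hj
    · rw [Equiv.swap_apply_right, h]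
    rw [Equiv.swap_apply_of_ne_of_ne hi hj]
  linear_combination h1 / 2

/-- The exponent `δ + d e_i`, where `δ = (k - 1, k - 2, …, 0)`. -/
noncomputable def staircaseAdd (k d : ℕ) (i : Fin k) : Fin k →₀ ℕ :=
  Finsupp.equivFunOnFinite.symm fun x => k - 1 - x + if x = i then d else 0

theorem staircaseAdd_apply (d : ℕ) (i x : Fin k) :
    staircaseAdd k d i x = k - 1 - x + if x = i then d else 0 := rfl

/-- The combination of the coefficients of `Y` at the exponents `δ + d e_i` with weights the
coefficients of `H`. -/
noncomputable def staircaseSum (d : ℕ) (H : Polynomial ℂ) (Y : MvPolynomial (Fin k) ℂ) : ℂ :=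
  ∑ i : Fin k, H.coeff (k - 1 - i) * Y.coeff (staircaseAdd k d i)

/-- A Murnaghan–Nakayama rule for hooks. Removing m from the exponent of X_i shortens the arm.
Removing it from another X_j gives an exponent already present at j + m, hence zero, unless j + m =
i; then exchanging i and j gives δ + (d-m) e_j with a minus sign. -/
theorem IsAlternatingPoly.coeff_psum_mul {Y : MvPolynomial (Fin k) ℂ} (hY : IsAlternatingPoly Y)
    {d m : ℕ} (hm : 1 ≤ m) (hmd : m ≤ d) (i : Fin k) :
    (MvPolynomial.psum (Fin k) ℂ m * Y).coeff (staircaseAdd k d i) =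
      Y.coeff (staircaseAdd k (d - m) i) -
        ∑ j : Fin k, if (i : ℕ) = j + m then Y.coeff (staircaseAdd k (d - m) j) else 0 := by
  have h1 : ∀ j : Fin k, (MvPolynomial.X j ^ m * Y).coeff (staircaseAdd k d i) =
      (if j = i then Y.coeff (staircaseAdd k (d - m) i) else 0) -
        if (i : ℕ) = j + m then Y.coeff (staircaseAdd k (d - m) j) else 0 := by
    intro j
    rw [MvPolynomial.X_pow_eq_monomial, MvPolynomial.coeff_monomial_mul', one_mul]
    have hle : Finsupp.single j m ≤ staircaseAdd k d i ↔ m ≤ staircaseAdd k d i j :=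
      Finsupp.single_le_iff
    have hsub : ∀ x, (staircaseAdd k d i - Finsupp.single j m) x =
        staircaseAdd k d i x - if x = j then m else 0 := fun x => by
      rw [Finsupp.tsub_apply, Finsupp.single_apply]
      simp only [eq_comm]
    rcases eq_or_ne j i with rfl | hji
    · rw [if_pos rfl, if_neg (by omega : ¬ (j : ℕ) = j + m), sub_zero, if_pos]
      · congr 1
        ext x
        rw [hsub, staircaseAdd_apply, staircaseAdd_apply]
        split_ifs <;> omega
      · rw [hle, staircaseAdd_apply, if_pos rfl]
        omega
    · rw [if_neg hji, zero_sub]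
      have hj : staircaseAdd k d i j = k - 1 - j := by
        rw [staircaseAdd_apply, if_neg hji, add_zero]
      split_ifs with ha hb hb
      · refine hY.coeff_eq_neg hji fun x => ?_
        rw [hsub, staircaseAdd_apply, staircaseAdd_apply]
        rcases eq_or_ne x j with rfl | hxj
        · rw [Equiv.swap_apply_left, if_neg hji, if_pos rfl, if_neg hji.symm]
          omega
        rcases eq_or_ne x i with rfl | hxi
        · rw [Equiv.swap_apply_right, if_neg hxj, if_pos rfl, if_pos rfl]
          rw [hle, hj] at ha
          omega
        · rw [Equiv.swap_apply_of_ne_of_ne hxj hxi, if_neg hxi, if_neg hxj, if_neg hxj]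
          omega
      · rw [hle, hj] at ha
        rw [neg_zero]
        have hjk := j.2
        have hne : j ≠ ⟨j + m, by omega⟩ := fun h => by
          have := congrArg Fin.val h
          simp only at this
          omega
        refine hY.coeff_eq_zero hne ?_
        rw [hsub, hsub, hj, if_pos rfl, if_neg hne.symm, staircaseAdd_apply, if_neg]
        · simp only
          omega
        · intro h
          exact hb (by rw [← h])
      · exfalso
        apply ha
        rw [hle, hj]
        have := i.2
        omega
      · rw [neg_zero]
  rw [MvPolynomial.psum, Finset.sum_mul, MvPolynomial.coeff_sum, Finset.sum_congr rfl fun j _ => h1 j,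
    Finset.sum_sub_distrib, Finset.sum_ite_eq' Finset.univ i, if_pos (Finset.mem_univ _)]

/-- The previous rule transposed: with the weight of index i stored at X^(k-1-i), the shift by m is
multiplication of H by X^m. Iterated, it removes all power sums and leaves the Vandermonde
polynomial. -/
theorem IsAlternatingPoly.staircaseSum_psum_mul {Y : MvPolynomial (Fin k) ℂ}
    (hY : IsAlternatingPoly Y) {d m : ℕ} (hm : 1 ≤ m) (hmd : m ≤ d) (H : Polynomial ℂ) :
    staircaseSum d H (MvPolynomial.psum (Fin k) ℂ m * Y) =
      staircaseSum (d - m) ((1 - Polynomial.X ^ m) * H) Y := by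
  simp only [staircaseSum, hY.coeff_psum_mul hm hmd, sub_mul, one_mul, Polynomial.coeff_sub,
    mul_sub, Finset.sum_sub_distrib]
  congr 1
  simp_rw [Finset.mul_sum]
  rw [Finset.sum_comm]
  refine Finset.sum_congr rfl fun j _ => ?_
  rw [Polynomial.coeff_X_pow_mul']
  split_ifs with h
  · have hj := j.2
    rw [Finset.sum_eq_single ⟨j + m, by omega⟩]
    · simp only [if_true]
      congr 2
      omega
    · intro i _ hi
      rw [if_neg (fun h => hi (Fin.ext h)), mul_zero]
    · simp
  · rw [zero_mul]
    refine Finset.sum_eq_zero fun i _ => ?_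
    have := i.2
    rw [if_neg (by omega), mul_zero]

theorem isSymmetric_prod_psum (s : Multiset ℕ) :
    (s.map (MvPolynomial.psum (Fin k) ℂ)).prod.IsSymmetric := by
  induction s using Multiset.induction_on with
  | empty => simp [MvPolynomial.IsSymmetric.one]
  | cons m s ih =>
    rw [Multiset.map_cons, Multiset.prod_cons]
    exact (MvPolynomial.psum_isSymmetric _ _ m).mul ih

theorem IsAlternatingPoly.staircaseSum_prod_psum_mul {Y : MvPolynomial (Fin k) ℂ}
    (hY : IsAlternatingPoly Y) (s : Multiset ℕ) (hs : ∀ m ∈ s, 1 ≤ m) : ∀ H : Polynomial ℂ,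
    staircaseSum s.sum H ((s.map (MvPolynomial.psum (Fin k) ℂ)).prod * Y) =
      staircaseSum 0 ((s.map fun m => 1 - Polynomial.X ^ m).prod * H) Y := by
  induction s using Multiset.induction_on with
  | empty => intro H; simp
  | cons m s ih =>
    intro H
    rw [Multiset.map_cons, Multiset.prod_cons, Multiset.sum_cons, mul_assoc,
      (hY.symm_mul (isSymmetric_prod_psum s)).staircaseSum_psum_mul (hs m (Multiset.mem_cons_self _ _))
        (Nat.le_add_right _ _), Nat.add_sub_cancel_left,
      ih (fun x hx => hs x (Multiset.mem_cons_of_mem hx)), Multiset.map_cons, Multiset.prod_cons]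
    congr 1
    ring

/-- The Vandermonde polynomial `∏_{i < j} (X_i - X_j)`. -/
noncomputable def vandermondePoly (k : ℕ) : MvPolynomial (Fin k) ℂ :=
  ∏ i : Fin k, ∏ j ∈ Finset.Ioi i, (MvPolynomial.X i - MvPolynomial.X j)

theorem vandermondePoly_eq_det (k : ℕ) : vandermondePoly k =
    (Matrix.of fun i j : Fin k => (MvPolynomial.X i : MvPolynomial (Fin k) ℂ) ^ (k - 1 - j)).det := by
  have h := Matrix.det_projVandermonde (fun _ => 1)
    (fun i : Fin k => (MvPolynomial.X i : MvPolynomial (Fin k) ℂ))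
  simp only [one_mul] at h
  rw [vandermondePoly, ← h]
  congr 1
  ext i j : 2
  simp only [Matrix.projVandermonde, Matrix.rectVandermonde, Matrix.of_apply, one_pow, one_mul,
    Fin.val_rev, show k - 1 - (j : ℕ) = k - (j + 1) by omega]

theorem isAlternatingPoly_vandermondePoly (k : ℕ) : IsAlternatingPoly (vandermondePoly k) := by
  intro i j hij
  rw [vandermondePoly_eq_det, AlgHom.map_det]
  have h : (MvPolynomial.rename (R := ℂ) (Equiv.swap i j)).mapMatrix
      (Matrix.of fun i j : Fin k => (MvPolynomial.X i : MvPolynomial (Fin k) ℂ) ^ (k - 1 - j)) =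
      (Matrix.of fun i j : Fin k => (MvPolynomial.X i : MvPolynomial (Fin k) ℂ) ^ (k - 1 - j)).submatrix
        (Equiv.swap i j) id := by
    ext a b : 2
    simp
  rw [h, Matrix.det_permute, Equiv.Perm.sign_swap hij]
  simp

theorem prod_X_pow_eq_monomial' {σ : Type*} [Fintype σ] (f : σ → ℕ) :
    ∏ i, (MvPolynomial.X i : MvPolynomial σ ℂ) ^ f i =
      MvPolynomial.monomial (Finsupp.equivFunOnFinite.symm f) 1 := by
  rw [MvPolynomial.monomial_eq, Finsupp.prod_fintype _ _ (by simp)]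
  simp

/-- For d = 0 the exponent is the staircase δ whatever i is, and only the identity permutation
produces it. -/
theorem coeff_staircase_vandermondePoly (i : Fin k) :
    (vandermondePoly k).coeff (staircaseAdd k 0 i) = 1 := by
  rw [vandermondePoly_eq_det, Matrix.det_apply', MvPolynomial.coeff_sum]
  have h : ∀ σ : Equiv.Perm (Fin k), MvPolynomial.coeff (staircaseAdd k 0 i)
      (((Equiv.Perm.sign σ : ℤ) : MvPolynomial (Fin k) ℂ) * ∏ j, (Matrix.of fun i j : Fin k =>
        (MvPolynomial.X i : MvPolynomial (Fin k) ℂ) ^ (k - 1 - j)) (σ j) j) =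
      if σ = 1 then 1 else 0 := by
    intro σ
    have h1 : ∏ j, (Matrix.of fun i j : Fin k =>
        (MvPolynomial.X i : MvPolynomial (Fin k) ℂ) ^ (k - 1 - (j : ℕ))) (σ j) j =
        ∏ j, (MvPolynomial.X j : MvPolynomial (Fin k) ℂ) ^ (k - 1 - (σ.symm j : ℕ)) := by
      rw [← Equiv.prod_comp σ fun j => (MvPolynomial.X j : MvPolynomial (Fin k) ℂ) ^
        (k - 1 - (σ.symm j : ℕ))]
      simp
    rw [h1, prod_X_pow_eq_monomial', ← map_intCast (MvPolynomial.C (R := ℂ) (σ := Fin k)),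
      MvPolynomial.coeff_C_mul, MvPolynomial.coeff_monomial]
    split_ifs with h2 h3 h3
    · simp [h3]
    · exfalso
      apply h3
      ext j
      have h4 := DFunLike.congr_fun h2 (σ j)
      rw [staircaseAdd_apply, Finsupp.equivFunOnFinite_symm_apply_apply, Equiv.symm_apply_apply,
        ite_self, add_zero] at h4
      have := (σ j).2
      have := j.2
      simp only [Equiv.Perm.coe_one, id]
      omega
    · exfalso
      apply h2
      subst h3
      ext x
      rw [staircaseAdd_apply, Finsupp.equivFunOnFinite_symm_apply_apply, ite_self, add_zero]
      rfl
    · simp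
  rw [Finset.sum_congr rfl fun σ _ => h σ]
  simp

theorem staircaseSum_zero_vandermondePoly (H : Polynomial ℂ) :
    staircaseSum 0 H (vandermondePoly k) = ∑ n ∈ Finset.range k, H.coeff n := by
  simp only [staircaseSum, coeff_staircase_vandermondePoly, mul_one]
  rw [Fin.sum_univ_eq_sum_range (fun i => H.coeff (k - 1 - i)), Finset.sum_range_reflect]

theorem coeff_staircaseAdd_eq_staircaseSum (d : ℕ) (b : Fin k) (Y : MvPolynomial (Fin k) ℂ) :
    Y.coeff (staircaseAdd k d b) = staircaseSum d (Polynomial.X ^ (k - 1 - (b : ℕ))) Y := by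
  rw [staircaseSum, Finset.sum_eq_single b]
  · simp
  · intro i _ hi
    rw [Polynomial.coeff_X_pow, if_neg, zero_mul]
    intro h
    have := i.2
    have := b.2
    exact hi (Fin.ext (by omega))
  · simp

/-- The weight X^(k-1-b) singles out the index b; truncation at degree k after the shift by k-1-b
leaves the partial sum up to b. -/
theorem coeff_prod_psum_mul_vandermondePoly (s : Multiset ℕ) (hs : ∀ m ∈ s, 1 ≤ m) (b : Fin k) :
    ((s.map (MvPolynomial.psum (Fin k) ℂ)).prod * vandermondePoly k).coeff
      (staircaseAdd k s.sum b) =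
    ∑ n ∈ Finset.range (b + 1), (s.map fun m => (1 - Polynomial.X ^ m : Polynomial ℂ)).prod.coeff n := by
  rw [coeff_staircaseAdd_eq_staircaseSum,
    (isAlternatingPoly_vandermondePoly k).staircaseSum_prod_psum_mul s hs,
    staircaseSum_zero_vandermondePoly]
  have hb := b.2
  rw [show Finset.range k = Finset.range ((k - 1 - b) + (b + 1)) by congr 1; omega,
    Finset.sum_range_add, Finset.sum_eq_zero, zero_add]
  · refine Finset.sum_congr rfl fun n _ => ?_
    rw [Polynomial.coeff_mul_X_pow', if_pos (by omega)]
    congr 1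
    omega
  · intro n hn
    rw [Finset.mem_range] at hn
    rw [Polynomial.coeff_mul_X_pow', if_neg (by omega)]

theorem natDegree_prod_one_sub_X_pow_le (s : Multiset ℕ) :
    (s.map fun m => (1 - Polynomial.X ^ m : Polynomial ℂ)).prod.natDegree ≤ s.sum := by
  induction s using Multiset.induction_on with
  | empty => simp
  | cons m s ih =>
    rw [Multiset.map_cons, Multiset.prod_cons, Multiset.sum_cons]
    refine Polynomial.natDegree_mul_le.trans (add_le_add ?_ ih)
    exact (Polynomial.natDegree_sub_le _ _).trans (by simp)

theorem eval_prod_psum (s : Multiset ℕ) (hs : ∀ m ∈ s, 1 ≤ m ∧ m ≤ k) {c : Fin k → ℂ} {z : ℂ}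
    (hc : ∀ m, 1 ≤ m → m ≤ k → ∑ i, c i ^ m = 1 - z ^ m) :
    MvPolynomial.eval c (s.map (MvPolynomial.psum (Fin k) ℂ)).prod =
      (s.map fun m => (1 - Polynomial.X ^ m : Polynomial ℂ)).prod.eval z := by
  induction s using Multiset.induction_on with
  | empty => simp
  | cons m s ih =>
    rw [Multiset.map_cons, Multiset.prod_cons, map_mul, Multiset.map_cons, Multiset.prod_cons,
      Polynomial.eval_mul, ih fun x hx => hs x (Multiset.mem_cons_of_mem hx)]
    have := hs m (Multiset.mem_cons_self _ _)
    simp [MvPolynomial.psum, hc m this.1 this.2]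

/-- Abel summation; the boundary term is z^k R(1) because the degree is at most k, and it vanishes.
-/
theorem one_sub_mul_sum_pow_mul_partial_sum (R : Polynomial ℂ) (hR : R.natDegree ≤ k)
    (h1 : R.eval 1 = 0) (z : ℂ) :
    (1 - z) * ∑ b ∈ Finset.range k, z ^ b * ∑ n ∈ Finset.range (b + 1), R.coeff n = R.eval z := by
  have h : ∀ K, (1 - z) * ∑ b ∈ Finset.range K, z ^ b * ∑ n ∈ Finset.range (b + 1), R.coeff n =
      (∑ n ∈ Finset.range (K + 1), R.coeff n * z ^ n) -
        z ^ K * ∑ n ∈ Finset.range (K + 1), R.coeff n := by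
    intro K
    induction K with
    | zero => simp
    | succ K ih =>
      rw [Finset.sum_range_succ, mul_add, ih, Finset.sum_range_succ _ (K + 1),
        Finset.sum_range_succ (fun n => R.coeff n) (K + 1)]
      ring
  rw [h, Polynomial.eval_eq_sum_range' (Nat.lt_succ_of_le hR)]
  rw [Polynomial.eval_eq_sum_range' (Nat.lt_succ_of_le hR)] at h1
  simp only [one_pow, mul_one] at h1
  rw [h1, mul_zero, sub_zero]

/-- Generating polynomial of hook coefficients: evaluation of a symmetric polynomial of degree `k`
at a point with power sums `1 - z ^ m`. -/
theorem one_sub_mul_sum_coeff_staircase (hk : 1 ≤ k) {f : MvPolynomial (Fin k) ℂ}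
    (hf : f.IsSymmetric) (hd : f.IsHomogeneous k) {c : Fin k → ℂ} {z : ℂ}
    (hc : ∀ m, 1 ≤ m → m ≤ k → ∑ i, c i ^ m = 1 - z ^ m) :
    (1 - z) * ∑ b : Fin k, z ^ (b : ℕ) * (f * vandermondePoly k).coeff (staircaseAdd k k b) =
      MvPolynomial.eval c f := by
  -- Both sides are linear in f, so products of power sums suffice; these take the value ∏ (1 - z^m)
  -- at c.
  have h := mem_span_psumProducts hf hd
  clear hf hd
  induction h using Submodule.span_induction with
  | mem f hf =>
    obtain ⟨s, hs, hsum, rfl⟩ := hf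
    have h1 : ∀ b : Fin k, ((s.map (MvPolynomial.psum (Fin k) ℂ)).prod * vandermondePoly k).coeff
        (staircaseAdd k k b) = ∑ n ∈ Finset.range (b + 1),
          (s.map fun m => (1 - Polynomial.X ^ m : Polynomial ℂ)).prod.coeff n := fun b => by
      have := coeff_prod_psum_mul_vandermondePoly s (fun m hm => (hs m hm).1) b
      rwa [hsum] at this
    simp_rw [h1]
    rw [Fin.sum_univ_eq_sum_range (fun b => z ^ b * ∑ n ∈ Finset.range (b + 1),
      (s.map fun m => (1 - Polynomial.X ^ m : Polynomial ℂ)).prod.coeff n),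
      one_sub_mul_sum_pow_mul_partial_sum _ (hsum ▸ natDegree_prod_one_sub_X_pow_le s),
      eval_prod_psum s hs hc]
    -- As k ≥ 1 there is at least one factor 1 - X^m, hence a zero at 1.
    obtain ⟨m, hm⟩ := Multiset.exists_mem_of_ne_zero (s := s) (by rintro rfl; simp at hsum; omega)
    obtain ⟨t, rfl⟩ := Multiset.exists_cons_of_mem hm
    simp
  | zero => simp
  | add f g _ _ hf hg =>
    rw [map_add, ← hf, ← hg, ← mul_add, ← Finset.sum_add_distrib]
    simp only [add_mul, MvPolynomial.coeff_add, mul_add]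
  | smul a f _ hf =>
    rw [MvPolynomial.smul_eval, ← hf, mul_left_comm, Finset.mul_sum]
    simp only [smul_mul_assoc, MvPolynomial.coeff_smul, smul_eq_mul, mul_left_comm _ a, ← Finset.mul_sum]

/-- A symmetric form of degree `d ≥ 1` evaluates, at the points with power sums `1 - z ^ m`, to
`1 - z` times a polynomial in `z` of degree less than `d`. -/
theorem exists_polynomial_eval_symmetric {d : ℕ} (hd : 1 ≤ d)
    {f : MvPolynomial (Fin k) ℂ} (hf : f.IsSymmetric) (hfd : f.IsHomogeneous d) :
    ∃ P : Polynomial ℂ, P.degree < d ∧ ∀ (c : Fin k → ℂ) (z : ℂ),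
      (∀ m, 1 ≤ m → m ≤ k → ∑ i, c i ^ m = 1 - z ^ m) →
        MvPolynomial.eval c f = (1 - z) * P.eval z := by
  have h := mem_span_psumProducts hf hfd
  clear hf hfd
  induction h using Submodule.span_induction with
  | mem f hf =>
    obtain ⟨s, hs, hsum, rfl⟩ := hf
    obtain ⟨m, hm⟩ := Multiset.exists_mem_of_ne_zero (s := s) (by rintro rfl; simp at hsum; omega)
    obtain ⟨t, rfl⟩ := Multiset.exists_cons_of_mem hm
    -- One factor 1 - z^m is divided by 1 - z, which lowers the degree by one.
    refine ⟨(∑ i ∈ Finset.range m, Polynomial.X ^ i) *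
      (t.map fun m => (1 - Polynomial.X ^ m : Polynomial ℂ)).prod, ?_, fun c z hc => ?_⟩
    · refine (Polynomial.degree_mul_le _ _).trans_lt ?_
      have h1 : (∑ i ∈ Finset.range m, (Polynomial.X : Polynomial ℂ) ^ i).degree ≤ (m - 1 : ℕ) := by
        refine (Polynomial.degree_sum_le _ _).trans (Finset.sup_le fun i hi => ?_)
        rw [Polynomial.degree_X_pow]
        rw [Finset.mem_range] at hi
        exact_mod_cast (by omega : i ≤ m - 1)
      have h2 := Polynomial.natDegree_le_iff_degree_le.1 (natDegree_prod_one_sub_X_pow_le t)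
      refine (add_le_add h1 h2).trans_lt ?_
      rw [Multiset.sum_cons] at hsum
      have := hs m hm
      exact_mod_cast (by omega : m - 1 + t.sum < d)
    · rw [eval_prod_psum _ hs hc, Multiset.map_cons, Multiset.prod_cons, Polynomial.eval_mul,
        Polynomial.eval_mul, ← mul_assoc]
      congr 1
      have := mul_neg_geom_sum z m
      simp [Polynomial.eval_finsetSum, this]
  | zero => exact ⟨0, by simp, by simp⟩
  | add f g _ _ hf hg =>
    obtain ⟨P, hP, hP'⟩ := hf
    obtain ⟨Q, hQ, hQ'⟩ := hg
    refine ⟨P + Q, (Polynomial.degree_add_le _ _).trans_lt (max_lt hP hQ), fun c z hc => ?_⟩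
    rw [map_add, hP' c z hc, hQ' c z hc, Polynomial.eval_add, mul_add]
  | smul a f _ hf =>
    obtain ⟨P, hP, hP'⟩ := hf
    refine ⟨a • P, (Polynomial.degree_smul_le _ _).trans_lt hP, fun c z hc => ?_⟩
    rw [MvPolynomial.smul_eval, hP' c z hc, Polynomial.eval_smul, smul_eq_mul]
    ring

end SymmetricPolynomials

/-! ### Points with prescribed power sums. -/

section PowerSums

/-- The elementary symmetric functions determined by the power sums `p` through Newton's
identities. -/
noncomputable def newtonEsymm (p : ℕ → ℂ) (m : ℕ) : ℂ :=
  if m = 0 then 1 else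
    (-1) ^ (m + 1) / m * (p m + ∑ a : {a // a ∈ (Finset.HasAntidiagonal.antidiagonal m).filter
      fun a => a.1 ∈ Set.Ioo 0 m}, (-1) ^ a.1.1 * newtonEsymm p a.1.1 * p a.1.2)
termination_by m
decreasing_by exact (Finset.mem_filter.1 a.2).2.2

/-- The coordinates are the roots of the monic polynomial whose coefficients are, up to sign, the
elementary symmetric values dictated by Newton's identities; the field is algebraically closed. -/
theorem exists_sum_pow_eq (k : ℕ) (p : ℕ → ℂ) :
    ∃ c : Fin k → ℂ, ∀ m, 1 ≤ m → m ≤ k → ∑ i, c i ^ m = p m := by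
  let q : Polynomial ℂ := ∑ i ∈ Finset.range (k + 1),
    Polynomial.C ((-1) ^ (k - i) * newtonEsymm p (k - i)) * Polynomial.X ^ i
  have he0 : newtonEsymm p 0 = 1 := by rw [newtonEsymm, if_pos rfl]
  have hcoeff : ∀ i, i ≤ k → q.coeff i = (-1) ^ (k - i) * newtonEsymm p (k - i) := by
    intro i hi
    simp only [q, Polynomial.finsetSum_coeff, Polynomial.coeff_C_mul_X_pow]
    rw [Finset.sum_ite_eq, if_pos (Finset.mem_range.2 (by omega))]
  have hk : q.coeff k = 1 := by rw [hcoeff k le_rfl, Nat.sub_self, he0]; simp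
  have hdeg : q.natDegree = k := by
    refine Polynomial.natDegree_eq_of_le_of_coeff_ne_zero ?_ (by rw [hk]; exact one_ne_zero)
    refine Polynomial.natDegree_sum_le_of_forall_le _ _ fun i hi => ?_
    exact (Polynomial.natDegree_C_mul_X_pow_le _ _).trans (by simpa [Nat.lt_succ_iff] using hi)
  have hlead : q.leadingCoeff = 1 := by rw [Polynomial.leadingCoeff, hdeg, hk]
  have hcard : q.roots.card = q.natDegree := (IsAlgClosed.splits q).natDegree_eq_card_roots.symm
  have hlen : q.roots.toList.length = k := by rw [Multiset.length_toList, hcard, hdeg]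
  let c : Fin k → ℂ := fun i => q.roots.toList.get (Fin.cast hlen.symm i)
  have hc : Multiset.map c Finset.univ.val = q.roots := by
    have h1 : (List.ofFn c : Multiset ℂ) = q.roots := by
      have : List.ofFn c = q.roots.toList := by
        rw [← List.ofFn_get q.roots.toList]
        refine List.ext_get (by simp [hlen]) fun n h1 h2 => ?_
        simp [c]
      rw [this, Multiset.coe_toList]
    rw [← h1]
    exact Fin.univ_val_map c
  have hesymm : ∀ m, m ≤ k → MvPolynomial.eval c (MvPolynomial.esymm (Fin k) ℂ m) =
      newtonEsymm p m := by
    intro m hm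
    have h1 := Polynomial.coeff_eq_esymm_roots_of_card hcard (k := k - m) (by omega)
    rw [hcoeff _ (by omega), hlead, hdeg, one_mul, Nat.sub_sub_self hm, ← hc] at h1
    have h2 := MvPolynomial.aeval_esymm_eq_multiset_esymm (Fin k) ℂ m c
    rw [← h2] at h1
    have h3 : ((-1 : ℂ)) ^ m ≠ 0 := pow_ne_zero _ (by norm_num)
    rw [mul_left_cancel₀ h3 h1]
    rfl
  refine ⟨c, fun m => ?_⟩
  induction m using Nat.strong_induction_on with
  | _ m ih =>
    intro h1 hm
    have h2 := congrArg (MvPolynomial.eval c) (MvPolynomial.psum_eq_mul_esymm_sub_sum (Fin k) ℂ m h1)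
    have h3 : ∀ m, MvPolynomial.eval c (MvPolynomial.psum (Fin k) ℂ m) = ∑ i, c i ^ m := fun m => by
      simp [MvPolynomial.psum]
    rw [h3] at h2
    rw [h2]
    simp only [map_sub, map_mul, map_pow, map_neg, map_one, map_natCast, map_sum, h3, hesymm m hm]
    have hm0 : (m : ℂ) ≠ 0 := by exact_mod_cast (by omega : m ≠ 0)
    rw [newtonEsymm, if_neg (by omega)]
    have h4 : ∑ a ∈ (Finset.HasAntidiagonal.antidiagonal m).filter fun a => a.1 ∈ Set.Ioo 0 m,
        (-1) ^ a.1 * MvPolynomial.eval c (MvPolynomial.esymm (Fin k) ℂ a.1) * ∑ i, c i ^ a.2 =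
        ∑ a : {a // a ∈ (Finset.HasAntidiagonal.antidiagonal m).filter
      fun a => a.1 ∈ Set.Ioo 0 m}, (-1) ^ a.1.1 * newtonEsymm p a.1.1 * p a.1.2 := by
      rw [← Finset.sum_coe_sort]
      refine Finset.sum_congr rfl fun a _ => ?_
      have ha := Finset.mem_filter.1 a.2
      have ha1 := Finset.HasAntidiagonal.mem_antidiagonal.1 ha.1
      have ha2 := ha.2.1
      have ha3 := ha.2.2
      rw [hesymm _ (by omega), ih _ (by omega) (by omega) (by omega)]
    rw [h4]
    have h5 : ((-1 : ℂ)) ^ (m + 1) * (-1) ^ (m + 1) = 1 := by rw [← mul_pow]; simp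
    field_simp
    linear_combination (p m + ∑ a : {a // a ∈ (Finset.HasAntidiagonal.antidiagonal m).filter
      fun a => a.1 ∈ Set.Ioo 0 m}, (-1) ^ a.1.1 * newtonEsymm p a.1.1 * p a.1.2) * h5

end PowerSums

/-! ### Power sums as sums of determinants. -/

section MomentIdentity

/-- In the Leibniz expansion the term of σ is multiplied by ∑_b v(σ b), which does not depend on σ.
-/
theorem sum_det_mul_row {N : ℕ} (M : Matrix (Fin N) (Fin N) ℂ) (v : Fin N → ℂ) :
    ∑ b, (M.updateRow b fun j => M b j * v j).det = (∑ j, v j) * M.det := by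
  have h : ∀ b, (M.updateRow b fun j => M b j * v j).det =
      ∑ σ : Equiv.Perm (Fin N), (Equiv.Perm.sign σ : ℂ) * (∏ i, M i (σ i)) * v (σ b) := by
    intro b
    rw [← Matrix.det_transpose, Matrix.det_apply']
    refine Finset.sum_congr rfl fun σ _ => ?_
    rw [mul_assoc, ← Finset.mul_prod_erase _ _ (Finset.mem_univ b),
      ← Finset.mul_prod_erase _ (fun i => M i (σ i)) (Finset.mem_univ b)]
    rw [Finset.prod_congr rfl fun i hi => by
      rw [Matrix.transpose_apply, Matrix.updateRow_ne (Finset.ne_of_mem_erase hi)]]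
    rw [Matrix.transpose_apply, Matrix.updateRow_self]
    ring
  simp_rw [h]
  rw [Finset.sum_comm, ← Matrix.det_transpose M, Matrix.det_apply', Finset.mul_sum]
  refine Finset.sum_congr rfl fun σ _ => ?_
  rw [← Finset.mul_sum, Equiv.sum_comp σ v]
  simp only [Matrix.transpose_apply]
  ring

theorem coeff_sum_C_mul_X_pow {k : ℕ} (a : Fin k → ℂ) (α : Fin k → ℕ) {K : ℕ} (hα : ∑ i, α i = K) :
    MvPolynomial.coeff (Finsupp.equivFunOnFinite.symm α)
      ((∑ i, MvPolynomial.C (a i) * MvPolynomial.X i) ^ K) =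
      K.factorial * ∏ i, a i ^ α i / (α i).factorial := by
  rw [Finset.sum_pow_eq_sum_piAntidiag, MvPolynomial.coeff_sum]
  have h : ∀ β : Fin k → ℕ, MvPolynomial.coeff (Finsupp.equivFunOnFinite.symm α)
      ((Nat.multinomial Finset.univ β : MvPolynomial (Fin k) ℂ) *
        ∏ i, (MvPolynomial.C (a i) * MvPolynomial.X i) ^ β i) =
      if β = α then Nat.multinomial Finset.univ α * ∏ i, a i ^ α i else 0 := by
    intro β
    simp_rw [mul_pow]
    rw [Finset.prod_mul_distrib, prod_X_pow_eq_monomial', ← map_natCast (MvPolynomial.C (σ := Fin k)),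
      MvPolynomial.coeff_C_mul]
    simp_rw [← map_pow]
    rw [← map_prod, MvPolynomial.coeff_C_mul, MvPolynomial.coeff_monomial]
    by_cases hβ : β = α
    · subst hβ
      simp
    · rw [if_neg hβ, if_neg, mul_zero, mul_zero]
      exact fun h => hβ (Finsupp.equivFunOnFinite.symm.injective h)
  rw [Finset.sum_congr rfl fun β _ => h β, Finset.sum_ite_eq', if_pos (by
    rw [Finset.mem_piAntidiag]
    exact ⟨hα, fun i _ => Finset.mem_univ i⟩)]
  have h2 := Nat.multinomial_spec Finset.univ α
  rw [hα] at h2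
  rw [← h2, Finset.prod_div_distrib]
  have h3 : (∏ i, ((α i).factorial : ℂ)) ≠ 0 :=
    Finset.prod_ne_zero_iff.2 fun i _ => by exact_mod_cast Nat.factorial_ne_zero _
  push_cast
  field_simp

variable {k n : ℕ}

theorem prod_Ioi_castAdd {M : Type*} [CommMonoid M] (i : Fin k) (f : Fin (k + n) → M) :
    ∏ j ∈ Finset.Ioi (Fin.castAdd n i), f j =
      (∏ j ∈ Finset.Ioi i, f (Fin.castAdd n j)) * ∏ j : Fin n, f (Fin.natAdd k j) := by
  rw [← Finset.filter_lt_eq_Ioi, ← Finset.filter_lt_eq_Ioi, Finset.prod_filter, Finset.prod_filter,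
    Fin.prod_univ_add]
  congr 1
  refine Finset.prod_congr rfl fun j _ => ?_
  rw [if_pos]
  rw [Fin.lt_def, Fin.val_castAdd, Fin.val_natAdd]
  omega

/-- The quotient of `∏_{i < j} (e ^ t_i - e ^ t_j) ∏_i (e ^ t_i - 1) ^ n` by
`∏_{i < j} (t_i - t_j) ∏_i t_i ^ n`. -/
noncomputable def expQuotProd (k n : ℕ) (t : Fin k → ℂ) : ℂ :=
  (∏ i, ∏ j ∈ Finset.Ioi i, (Complex.exp (t j) * expQuot (t i - t j))) * ∏ i, expQuot (t i) ^ n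

/-- The matrix of powers `l_j ^ (N - 1 - i)`. -/
noncomputable def powMatrix {N : ℕ} (l : Fin N → ℤ) : Matrix (Fin N) (Fin N) ℂ :=
  Matrix.of fun i j => (l j : ℂ) ^ (N - 1 - (i : ℕ))

theorem det_powMatrix_ne_zero {N : ℕ} {l : Fin N → ℤ} (hl : Function.Injective l) :
    (powMatrix l).det ≠ 0 := by
  have h : powMatrix l = ((Matrix.vandermonde fun j => (l j : ℂ)).submatrix id Fin.revPerm).transpose := by
    ext i j
    simp only [powMatrix, Matrix.of_apply, Matrix.transpose_apply, Matrix.submatrix_apply, id,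
      Matrix.vandermonde_apply, Fin.revPerm_apply, Fin.val_rev]
    congr 1
    omega
  rw [h, Matrix.det_transpose, Matrix.det_permute']
  refine mul_ne_zero (by exact_mod_cast (Equiv.Perm.sign _).ne_zero)
    (Matrix.det_vandermonde_ne_zero_iff.2 fun i j hij => hl ?_)
  exact_mod_cast hij

theorem schurFun_confluent {N : ℕ} (l : Signature N) {r : ℕ} (hr : r ≤ N) (t : Fin N → ℂ) :
    schurFun l (expPad r t) * ∏ i, confluentFactor r t i =
      (confluentMatrix l.shifted r t).det := by
  obtain ⟨ι, hf, hn, a, ha⟩ := exists_schurFun_eq_sum l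
  exact confluent_det l.shifted (fun u hu => ⟨continuousAt_schurFun l hu, (ha u hu).2⟩) hr t

/-- The case of no free variable, that is, Weyl's dimension formula in determinant form. -/
theorem schurFun_one_mul {N : ℕ} (l : Signature N) :
    schurFun l 1 * ∏ i : Fin N, ((N - 1 - (i : ℕ)).factorial : ℂ) = (powMatrix l.shifted).det := by
  have h := schurFun_confluent l (Nat.zero_le N) 0
  have h1 : expPad 0 (0 : Fin N → ℂ) = 1 := by funext i; simp [expPad]
  rw [h1] at h
  simpa [confluentFactor, confluentMatrix, powMatrix] using h

theorem schurFun_one_ne_zero {N : ℕ} (l : Signature N) : schurFun l 1 ≠ 0 := fun h => by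
  have := schurFun_one_mul l
  rw [h, zero_mul] at this
  exact det_powMatrix_ne_zero l.strictAnti_shifted.injective this.symm

/-- The normalized Schur function in exponential coordinates, times `expQuotProd`. -/
noncomputable def schurExp (l : Signature (k + n)) (t : Fin k → ℂ) : ℂ :=
  schurFun l (padOnes (k + n) fun i => Complex.exp (t i)) / schurFun l 1 * expQuotProd k n t

/-- The factor `expQuotProd` turns the products of e^(t_i) - e^(t_j) and e^(t_i) - 1 into products
of t_i - t_j and t_i, so the denominator becomes a form in t; dividing by the value at 1 brings in
the factorials of the first k rows. -/
theorem schurExp_mul (l : Signature (k + n)) (t : Fin k → ℂ) :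
    schurExp l t * ((∏ i, ∏ j ∈ Finset.Ioi i, (t i - t j)) * ∏ i, t i ^ n) *
      (powMatrix l.shifted).det = (∏ i : Fin k, ((k + n - 1 - (i : ℕ)).factorial : ℂ)) *
      (confluentMatrix l.shifted k (Fin.append t 0)).det := by
  have h := schurFun_confluent l (Nat.le_add_right k n) (Fin.append t 0)
  have hpad : expPad k (Fin.append t (0 : Fin n → ℂ)) =
      padOnes (k + n) fun i => Complex.exp (t i) := by
    funext i
    refine Fin.addCases (fun i => ?_) (fun i => ?_) i
    · simp [expPad, padOnes]
    · simp [expPad, padOnes]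
  have hfac : ∏ i, confluentFactor k (Fin.append t (0 : Fin n → ℂ)) i =
      expQuotProd k n t * ((∏ i, ∏ j ∈ Finset.Ioi i, (t i - t j)) * ∏ i, t i ^ n) *
        ∏ i : Fin n, ((k + n - 1 - (k + (i : ℕ))).factorial : ℂ) := by
    rw [Fin.prod_univ_add]
    congr 1
    · have h1 : ∀ i : Fin k, confluentFactor k (Fin.append t (0 : Fin n → ℂ)) (Fin.castAdd n i) =
          (∏ j ∈ Finset.Ioi i, (Complex.exp (t j) * expQuot (t i - t j))) * expQuot (t i) ^ n *
          ((∏ j ∈ Finset.Ioi i, (t i - t j)) * t i ^ n) := by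
        intro i
        have h2 : ∀ j, Complex.exp (t i) - Complex.exp (t j) =
            Complex.exp (t j) * expQuot (t i - t j) * (t i - t j) := fun j => by
          rw [mul_assoc, mul_comm (expQuot _), mul_expQuot, Complex.exp_sub]
          field_simp [Complex.exp_ne_zero]
        have h3 : Complex.exp (t i) - 1 = expQuot (t i) * t i := by rw [mul_comm, mul_expQuot]
        rw [confluentFactor, if_pos (by simp), prod_Ioi_castAdd]
        simp only [Fin.append_left, Fin.val_castAdd, Fin.is_lt, if_true, Fin.val_natAdd,
          add_lt_iff_neg_left, not_lt_zero, if_false, Finset.prod_const, Finset.card_univ,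
          Fintype.card_fin, h2, h3, Finset.prod_mul_distrib, mul_pow]
        ring
      rw [Finset.prod_congr rfl fun i _ => h1 i, expQuotProd]
      simp only [Finset.prod_mul_distrib]
    · refine Finset.prod_congr rfl fun i _ => ?_
      simp [confluentFactor]
  rw [hpad, hfac] at h
  have h1 := schurFun_one_mul l
  rw [Fin.prod_univ_add] at h1
  simp only [Fin.val_castAdd, Fin.val_natAdd] at h1
  rw [← h1, ← h, schurExp]
  field_simp [schurFun_one_ne_zero l]

end MomentIdentity

/-! ### The power sum of a signature through hook coefficients. -/

section HookIdentity

variable {k n : ℕ}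

theorem rename_vandermondePoly (σ : Equiv.Perm (Fin k)) :
    MvPolynomial.rename σ (vandermondePoly k) =
      MvPolynomial.C (Equiv.Perm.sign σ : ℂ) * vandermondePoly k := by
  rw [vandermondePoly_eq_det, AlgHom.map_det]
  have h : (MvPolynomial.rename (R := ℂ) σ).mapMatrix
      (Matrix.of fun i j : Fin k => (MvPolynomial.X i : MvPolynomial (Fin k) ℂ) ^ (k - 1 - j)) =
      (Matrix.of fun i j : Fin k =>
        (MvPolynomial.X i : MvPolynomial (Fin k) ℂ) ^ (k - 1 - j)).submatrix σ id := by
    ext a b : 2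
    simp
  rw [h, Matrix.det_permute]
  simp

theorem vandermondePoly_ne_zero (k : ℕ) : vandermondePoly k ≠ 0 := by
  refine Finset.prod_ne_zero_iff.2 fun i _ => Finset.prod_ne_zero_iff.2 fun j hj => ?_
  rw [sub_ne_zero]
  exact fun h => (Finset.mem_Ioi.1 hj).ne (MvPolynomial.X_injective h)

theorem eval_vandermondePoly (c : Fin k → ℂ) : MvPolynomial.eval c (vandermondePoly k) =
    ∏ i, ∏ j ∈ Finset.Ioi i, (c i - c j) := by
  simp [vandermondePoly]

theorem analyticAt_apply (i : Fin k) (t : Fin k → ℂ) : AnalyticAt ℂ (fun t : Fin k → ℂ => t i) t :=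
  (ContinuousLinearMap.proj (R := ℂ) (φ := fun _ : Fin k => ℂ) i).analyticAt t

theorem analyticAt_expQuotProd (t : Fin k → ℂ) : AnalyticAt ℂ (expQuotProd k n) t := by
  unfold expQuotProd
  refine AnalyticAt.mul ?_ ?_
  · refine Finset.analyticAt_fun_prod _ fun i _ => Finset.analyticAt_fun_prod _ fun j _ => ?_
    exact (analyticAt_apply j t).cexp.mul ((analyticAt_expQuot _).comp
      ((analyticAt_apply i t).sub (analyticAt_apply j t)))
  · refine Finset.analyticAt_fun_prod _ fun i _ => ?_
    exact ((analyticAt_expQuot _).comp (analyticAt_apply i t)).pow n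

theorem padOnes_exp_ne_zero (N : ℕ) (t : Fin k → ℂ) (i : Fin N) :
    padOnes N (fun i => Complex.exp (t i)) i ≠ 0 := by
  unfold padOnes
  split_ifs
  exacts [Complex.exp_ne_zero _, one_ne_zero]

theorem analyticAt_schurExp (l : Signature (k + n)) (t : Fin k → ℂ) :
    AnalyticAt ℂ (schurExp l) t := by
  obtain ⟨ι, hf, hn, a, ha⟩ := exists_schurFun_eq_sum l
  refine AnalyticAt.mul ?_ (analyticAt_expQuotProd t)
  simp_rw [div_eq_mul_inv]
  refine AnalyticAt.mul ?_ analyticAt_const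
  have h : (fun t : Fin k → ℂ => schurFun l (padOnes (k + n) fun i => Complex.exp (t i))) =
      fun t => ∑ x, ∏ i, padOnes (k + n) (fun i => Complex.exp (t i)) i ^ a x i := by
    funext t
    exact (ha _ fun i => padOnes_exp_ne_zero _ t i).1
  rw [h]
  refine Finset.analyticAt_fun_sum _ fun x _ => Finset.analyticAt_fun_prod _ fun i _ => ?_
  refine AnalyticAt.fun_zpow ?_ (padOnes_exp_ne_zero _ t i)
  unfold padOnes
  split_ifs
  · exact (analyticAt_apply _ t).cexp
  · exact analyticAt_const

theorem analyticAt_comp_smul {f : (Fin k → ℂ) → ℂ} (hf : AnalyticAt ℂ f 0) (c : Fin k → ℂ) :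
    AnalyticAt ℂ (fun x : ℂ => f (x • c)) 0 := by
  refine AnalyticAt.comp (g := f) (f := fun x : ℂ => x • c) (by simpa using hf) ?_
  exact ((ContinuousLinearMap.id ℂ ℂ).smulRight c).analyticAt 0

theorem det_confluentMatrix_append_perm (l : Fin (k + n) → ℤ) (t : Fin k → ℂ)
    (σ : Equiv.Perm (Fin k)) : (confluentMatrix l k (Fin.append (t ∘ σ) 0)).det =
      (Equiv.Perm.sign σ : ℂ) * (confluentMatrix l k (Fin.append t 0)).det := by
  have h : confluentMatrix l k (Fin.append (t ∘ σ) 0) = (confluentMatrix l k (Fin.append t 0)).submatrix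
      (finSumFinEquiv.permCongr (Equiv.Perm.sumCongr σ 1)) id := by
    ext i j
    refine Fin.addCases (fun i => ?_) (fun i => ?_) i
    · simp [confluentMatrix, Equiv.permCongr_apply]
    · simp [confluentMatrix, Equiv.permCongr_apply]
  rw [h, Matrix.det_permute, Equiv.Perm.sign_permCongr, Equiv.Perm.sign_sumCongr]
  simp

theorem det_eq_sum_append {M : Matrix (Fin (k + n)) (Fin (k + n)) ℂ} : M.det =
    ∑ σ : Equiv.Perm (Fin (k + n)), (Equiv.Perm.sign σ : ℂ) *
      (∏ i : Fin n, M (Fin.natAdd k i) (σ (Fin.natAdd k i))) *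
      ∏ i : Fin k, M (Fin.castAdd n i) (σ (Fin.castAdd n i)) := by
  rw [← Matrix.det_transpose, Matrix.det_apply']
  refine Finset.sum_congr rfl fun σ _ => ?_
  rw [Fin.prod_univ_add]
  simp only [Matrix.transpose_apply]
  ring

theorem det_confluentMatrix_append (l : Fin (k + n) → ℤ) (t : Fin k → ℂ) :
    (confluentMatrix l k (Fin.append t 0)).det =
    ∑ σ : Equiv.Perm (Fin (k + n)), (Equiv.Perm.sign σ : ℂ) *
      (∏ i : Fin n, powMatrix l (Fin.natAdd k i) (σ (Fin.natAdd k i))) *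
      Complex.exp (∑ i : Fin k, t i * (l (σ (Fin.castAdd n i)) : ℂ)) := by
  rw [det_eq_sum_append]
  refine Finset.sum_congr rfl fun σ _ => ?_
  rw [Complex.exp_sum]
  simp [confluentMatrix, powMatrix]

/-- The form of degree `K` in the expansion of the confluent determinant. -/
noncomputable def confluentForm (l : Fin (k + n) → ℤ) (K : ℕ) : MvPolynomial (Fin k) ℂ :=
  ∑ σ : Equiv.Perm (Fin (k + n)), MvPolynomial.C ((Equiv.Perm.sign σ : ℂ) *
      (∏ i : Fin n, powMatrix l (Fin.natAdd k i) (σ (Fin.natAdd k i))) / K.factorial) *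
    (∑ i, MvPolynomial.C (l (σ (Fin.castAdd n i)) : ℂ) * MvPolynomial.X i) ^ K

theorem coeff_taylorSeries_det_confluentMatrix (l : Fin (k + n) → ℤ) (K : ℕ) (c : Fin k → ℂ) :
    PowerSeries.coeff K (taylorSeries fun x =>
      (confluentMatrix l k (Fin.append (x • c) 0)).det) =
      MvPolynomial.eval c (confluentForm l K) := by
  have h : (fun x : ℂ => (confluentMatrix l k (Fin.append (x • c) 0)).det) = fun x =>
    ∑ σ : Equiv.Perm (Fin (k + n)), (Equiv.Perm.sign σ : ℂ) *
      (∏ i : Fin n, powMatrix l (Fin.natAdd k i) (σ (Fin.natAdd k i))) *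
      Complex.exp (x * ∑ i : Fin k, c i * (l (σ (Fin.castAdd n i)) : ℂ)) := by
    funext x
    rw [det_confluentMatrix_append]
    simp only [Pi.smul_apply, smul_eq_mul, mul_assoc, Finset.mul_sum]
  rw [h, taylorSeries_sum _ fun σ _ => by fun_prop, map_sum, confluentForm, map_sum]
  refine Finset.sum_congr rfl fun σ _ => ?_
  rw [taylorSeries_const_mul, PowerSeries.coeff_C_mul, coeff_taylorSeries_exp_mul]
  simp only [map_mul, map_pow, map_sum, MvPolynomial.eval_C, MvPolynomial.eval_X]
  simp_rw [mul_comm (c _)]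
  ring

theorem rename_confluentForm (l : Fin (k + n) → ℤ) (K : ℕ) (σ : Equiv.Perm (Fin k)) :
    MvPolynomial.rename σ (confluentForm l K) =
      MvPolynomial.C (Equiv.Perm.sign σ : ℂ) * confluentForm l K := by
  refine MvPolynomial.funext fun c => ?_
  rw [MvPolynomial.eval_rename, map_mul, MvPolynomial.eval_C,
    ← coeff_taylorSeries_det_confluentMatrix, ← coeff_taylorSeries_det_confluentMatrix,
    ← PowerSeries.coeff_C_mul, ← taylorSeries_const_mul]
  congr 2
  funext x
  exact det_confluentMatrix_append_perm l (x • c) σ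

/-- The exponential contributes ∏ l_σ(i)^α_i / α_i!, and at this exponent the sum over σ is the
determinant whose row b carries an extra l^k. The rising factorial is the quotient (N-1-b+k)! /
(N-1-b)! with N = k + n. -/
theorem coeff_confluentForm (l : Fin (k + n) → ℤ) {K : ℕ} (b : Fin k)
    (hK : ∑ i : Fin k, (k + n - 1 - (i : ℕ) + if i = b then k else 0) = K) :
    MvPolynomial.coeff (Finsupp.equivFunOnFinite.symm fun i : Fin k =>
      k + n - 1 - (i : ℕ) + if i = b then k else 0) (confluentForm l K) *
      (∏ i : Fin k, ((k + n - 1 - (i : ℕ)).factorial : ℂ)) * ((k + n - b).ascFactorial k : ℂ) =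
    ((powMatrix l).updateRow (Fin.castAdd n b)
      fun j => powMatrix l (Fin.castAdd n b) j * (l j : ℂ) ^ k).det := by
  have hfac : ∏ i : Fin k, ((k + n - 1 - (i : ℕ) + if i = b then k else 0).factorial : ℂ) =
      (∏ i : Fin k, ((k + n - 1 - (i : ℕ)).factorial : ℂ)) * ((k + n - b).ascFactorial k : ℂ) := by
    rw [← Finset.mul_prod_erase _ _ (Finset.mem_univ b), ← Finset.mul_prod_erase _
      (fun i : Fin k => ((k + n - 1 - (i : ℕ)).factorial : ℂ)) (Finset.mem_univ b), if_pos rfl,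
      ← Nat.factorial_mul_ascFactorial, show k + n - 1 - (b : ℕ) + 1 = k + n - b by have := b.2; omega,
      Finset.prod_congr rfl fun i hi => by rw [if_neg (Finset.ne_of_mem_erase hi), add_zero]]
    push_cast
    ring
  have hne : ∏ i : Fin k, ((k + n - 1 - (i : ℕ) + if i = b then k else 0).factorial : ℂ) ≠ 0 :=
    Finset.prod_ne_zero_iff.2 fun i _ => by exact_mod_cast Nat.factorial_ne_zero _
  have hK0 : (K.factorial : ℂ) ≠ 0 := by exact_mod_cast Nat.factorial_ne_zero _
  rw [mul_assoc, ← hfac, confluentForm, MvPolynomial.coeff_sum, det_eq_sum_append, Finset.sum_mul]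
  refine Finset.sum_congr rfl fun σ _ => ?_
  rw [MvPolynomial.coeff_C_mul, coeff_sum_C_mul_X_pow _ _ hK, Finset.prod_div_distrib]
  have h1 : ∏ i : Fin n, (powMatrix l).updateRow (Fin.castAdd n b)
      (fun j => powMatrix l (Fin.castAdd n b) j * (l j : ℂ) ^ k) (Fin.natAdd k i)
        (σ (Fin.natAdd k i)) = ∏ i : Fin n, powMatrix l (Fin.natAdd k i) (σ (Fin.natAdd k i)) := by
    refine Finset.prod_congr rfl fun i _ => ?_
    rw [Matrix.updateRow_ne]
    intro h
    have := congrArg Fin.val h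
    rw [Fin.val_natAdd, Fin.val_castAdd] at this
    omega
  have h2 : ∏ i : Fin k, (powMatrix l).updateRow (Fin.castAdd n b)
      (fun j => powMatrix l (Fin.castAdd n b) j * (l j : ℂ) ^ k) (Fin.castAdd n i)
        (σ (Fin.castAdd n i)) =
      ∏ i : Fin k, (l (σ (Fin.castAdd n i)) : ℂ) ^ (k + n - 1 - (i : ℕ) + if i = b then k else 0) := by
    refine Finset.prod_congr rfl fun i _ => ?_
    by_cases hi : i = b
    · subst hi
      rw [Matrix.updateRow_self, if_pos rfl, pow_add]
      simp [powMatrix]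
    · rw [Matrix.updateRow_ne, if_neg hi, add_zero]
      · simp [powMatrix]
      · intro h
        exact hi (Fin.castAdd_injective k n h)
  rw [h1, h2]
  field_simp

/-- Raising the exponent of row k + b by k reproduces row b, so two rows coincide. -/
theorem det_updateRow_pow_natAdd (hk : 1 ≤ k) (l : Fin (k + n) → ℤ) (b : Fin n) :
    ((powMatrix l).updateRow (Fin.natAdd k b)
      fun j => powMatrix l (Fin.natAdd k b) j * (l j : ℂ) ^ k).det = 0 := by
  have hb := b.2
  have h : (fun j => powMatrix l (Fin.natAdd k b) j * (l j : ℂ) ^ k) =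
      powMatrix l ⟨b, by omega⟩ := by
    funext j
    simp only [powMatrix, Matrix.of_apply, Fin.val_natAdd]
    rw [← pow_add]
    congr 1
    omega
  rw [h]
  refine Matrix.det_updateRow_eq_zero fun h => ?_
  have := congrArg Fin.val h
  simp only [Fin.val_natAdd] at this
  omega

/-- The power sum of the shifted coordinates in terms of the form of degree `k` of `schurExp`. -/
theorem exists_symmetric_form_schurExp (hk : 1 ≤ k) (l : Signature (k + n)) :
    ∃ f : MvPolynomial (Fin k) ℂ, f.IsSymmetric ∧ f.IsHomogeneous k ∧
      (∀ c : Fin k → ℂ, PowerSeries.coeff k (taylorSeries fun x => schurExp l (x • c)) =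
        MvPolynomial.eval c f) ∧
      ∑ j, (l.shifted j : ℂ) ^ k = ∑ b : Fin k,
        ((k + n - b).ascFactorial k : ℂ) * (f * vandermondePoly k).coeff (staircaseAdd k k b) := by
  obtain ⟨f, hfh, hf⟩ := exists_isHomogeneous_taylorSeries (analyticAt_schurExp l 0) k
  set D := (powMatrix l.shifted).det with hD
  have hD0 : D ≠ 0 := det_powMatrix_ne_zero l.strictAnti_shifted.injective
  set F := ∏ i : Fin k, ((k + n - 1 - (i : ℕ)).factorial : ℂ) with hF
  set m := ∑ i : Fin k, (k + n - 1 - (i : ℕ)) with hm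
  -- Comparison of the forms of degree k + m in `schurExp_mul`, where m is the degree of the
  -- Vandermonde product times ∏ t_i^n.
  have key : f * (vandermondePoly k * MvPolynomial.monomial
      (Finsupp.equivFunOnFinite.symm fun _ : Fin k => n) 1) * MvPolynomial.C D =
      MvPolynomial.C F * confluentForm l.shifted (k + m) := by
    refine MvPolynomial.funext fun c => ?_
    simp only [map_mul, MvPolynomial.eval_C, ← prod_X_pow_eq_monomial', eval_vandermondePoly,
      map_prod, map_pow, MvPolynomial.eval_X, ← hf c, ← coeff_taylorSeries_det_confluentMatrix]
    set V := (∏ i, ∏ j ∈ Finset.Ioi i, (c i - c j)) * ∏ i, c i ^ n with hV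
    have h1 : (fun x : ℂ => F * (confluentMatrix l.shifted k (Fin.append (x • c) 0)).det) =
        fun x => (V * D) * (x ^ m * schurExp l (x • c)) := by
      funext x
      rw [← schurExp_mul]
      have h2 : (∏ i, ∏ j ∈ Finset.Ioi i, ((x • c) i - (x • c) j)) * ∏ i, (x • c) i ^ n =
          x ^ m * V := by
        simp only [Pi.smul_apply, smul_eq_mul, ← mul_sub, Finset.prod_mul_distrib, mul_pow,
          Finset.prod_const, hV, hm, ← Finset.prod_pow_eq_pow_sum]
        have h3 : ∀ i : Fin k, x ^ (k + n - 1 - (i : ℕ)) = x ^ (Finset.Ioi i).card * x ^ n := by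
          intro i
          rw [Fin.card_Ioi, ← pow_add]
          congr 1
          have := i.2
          omega
        rw [Finset.prod_congr rfl fun i _ => h3 i, Finset.prod_mul_distrib]
        simp only [Finset.prod_const]
        ring
      rw [h2, ← hD]
      ring
    rw [← PowerSeries.coeff_C_mul, ← taylorSeries_const_mul, h1, taylorSeries_const_mul,
      taylorSeries_mul (by fun_prop) (analyticAt_comp_smul (analyticAt_schurExp l 0) c),
      taylorSeries_pow (by fun_prop), taylorSeries_id, PowerSeries.coeff_C_mul,
      PowerSeries.coeff_X_pow_mul]
    ring
  have hmono : ∀ σ : Equiv.Perm (Fin k), MvPolynomial.rename σ (MvPolynomial.monomial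
      (Finsupp.equivFunOnFinite.symm fun _ : Fin k => n) (1 : ℂ)) = MvPolynomial.monomial
      (Finsupp.equivFunOnFinite.symm fun _ : Fin k => n) (1 : ℂ) := fun σ => by
    rw [← prod_X_pow_eq_monomial', map_prod]
    simp only [map_pow, MvPolynomial.rename_X]
    exact Equiv.prod_comp σ fun i => (MvPolynomial.X i : MvPolynomial (Fin k) ℂ) ^ n
  -- By `key`, f is up to a constant a quotient of two alternating forms.
  have hsymm : f.IsSymmetric := by
    intro σ
    have h1 := congrArg (MvPolynomial.rename (R := ℂ) σ) key
    rw [map_mul, map_mul, map_mul, map_mul, rename_vandermondePoly, hmono, rename_confluentForm,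
      MvPolynomial.rename_C, MvPolynomial.rename_C] at h1
    have h2 : MvPolynomial.C ((Equiv.Perm.sign σ : ℤ) : ℂ) * (vandermondePoly k *
        MvPolynomial.monomial (Finsupp.equivFunOnFinite.symm fun _ : Fin k => n) 1) *
        MvPolynomial.C D ≠ 0 := by
      refine mul_ne_zero (mul_ne_zero ?_ (mul_ne_zero (vandermondePoly_ne_zero k) ?_)) ?_
      · rw [Ne, MvPolynomial.C_eq_zero]
        exact_mod_cast (Equiv.Perm.sign σ).ne_zero
      · rw [Ne, MvPolynomial.monomial_eq_zero]
        exact one_ne_zero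
      · rwa [Ne, MvPolynomial.C_eq_zero]
    refine mul_right_cancel₀ h2 ?_
    linear_combination h1 - MvPolynomial.C ((Equiv.Perm.sign σ : ℤ) : ℂ) * key
  refine ⟨f, hsymm, hfh, hf, ?_⟩
  have hcoeff : ∀ b : Fin k, ((k + n - b).ascFactorial k : ℂ) *
      (f * vandermondePoly k).coeff (staircaseAdd k k b) * D =
      ((powMatrix l.shifted).updateRow (Fin.castAdd n b)
      fun j => powMatrix l.shifted (Fin.castAdd n b) j * (l.shifted j : ℂ) ^ k).det := by
    intro b
    have hK : ∑ i : Fin k, (k + n - 1 - (i : ℕ) + if i = b then k else 0) = k + m := by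
      rw [Finset.sum_add_distrib, Finset.sum_ite_eq', if_pos (Finset.mem_univ b), add_comm]
    have h1 := congrArg (MvPolynomial.coeff (Finsupp.equivFunOnFinite.symm fun i : Fin k =>
      k + n - 1 - (i : ℕ) + if i = b then k else 0)) key
    have hα : (Finsupp.equivFunOnFinite.symm fun i : Fin k =>
      k + n - 1 - (i : ℕ) + if i = b then k else 0) = staircaseAdd k k b +
        Finsupp.equivFunOnFinite.symm fun _ : Fin k => n := by
      ext i
      rw [Finsupp.add_apply, staircaseAdd_apply]
      simp only [Finsupp.equivFunOnFinite_symm_apply_apply]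
      have := i.2
      omega
    rw [MvPolynomial.coeff_C_mul, mul_comm _ (MvPolynomial.C D), MvPolynomial.coeff_C_mul,
      ← mul_assoc, hα, MvPolynomial.coeff_mul_monomial, mul_one, ← hα] at h1
    rw [← coeff_confluentForm l.shifted b hK, ← hF]
    linear_combination ((k + n - b).ascFactorial k : ℂ) * h1
  -- Sum over all rows b; those beyond the first k give zero.
  refine mul_right_cancel₀ hD0 ?_
  rw [hD, ← sum_det_mul_row, ← hD, Finset.sum_mul, Finset.sum_congr rfl fun b _ => hcoeff b,
    Fin.sum_univ_add,
    Finset.sum_eq_zero fun b _ => det_updateRow_pow_natAdd hk l.shifted b, add_zero]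

end HookIdentity

/-! ### Averaging over the random signature. -/

section Expectation

variable {k n : ℕ}

/-- The normalized Schur function in exponential coordinates. -/
noncomputable def schurNorm (l : Signature (k + n)) (t : Fin k → ℂ) : ℂ :=
  schurFun l (padOnes (k + n) fun i => Complex.exp (t i)) / schurFun l 1

/-- The value at 1 is the number of monomials, so the normalized function is an average of
exponentials with integer frequencies. -/
theorem exists_schurNorm_eq_sum (l : Signature (k + n)) :
    ∃ (ι : Type) (_ : Fintype ι) (_ : Nonempty ι) (α : ι → Fin k → ℤ), ∀ t : Fin k → ℂ,
      schurNorm l t = (Fintype.card ι : ℂ)⁻¹ * ∑ x, Complex.exp (∑ i, (α x i : ℂ) * t i) := by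
  obtain ⟨ι, hf, hn, a, ha⟩ := exists_schurFun_eq_sum l
  refine ⟨ι, hf, hn, fun x i => a x (Fin.castAdd n i), fun t => ?_⟩
  have h1 : schurFun l 1 = Fintype.card ι := by
    rw [(ha 1 fun i => one_ne_zero).1]
    simp
  rw [schurNorm, h1, (ha _ fun i => padOnes_exp_ne_zero _ t i).1, div_eq_inv_mul]
  congr 1
  refine Finset.sum_congr rfl fun x _ => ?_
  rw [Fin.prod_univ_add, Complex.exp_sum]
  simp [padOnes, Complex.exp_int_mul]

/-- The sign vector adapted to a occurs among the positive summands. -/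
theorem exp_sum_abs_le (a : Fin k → ℤ) (η : Fin k → ℝ) :
    Real.exp (∑ i, |(a i : ℝ)| * η i) ≤
      ∑ s : Fin k → Bool, Real.exp (∑ i, (a i : ℝ) * ((if s i then 1 else -1) * η i)) := by
  have h : ∑ i, |(a i : ℝ)| * η i =
      ∑ i, (a i : ℝ) * ((if (decide (0 ≤ a i)) then 1 else -1) * η i) := by
    refine Finset.sum_congr rfl fun i _ => ?_
    by_cases h0 : 0 ≤ a i
    · have : (0 : ℝ) ≤ a i := by exact_mod_cast h0
      simp [h0, abs_of_nonneg this]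
    · have : (a i : ℝ) ≤ 0 := by exact_mod_cast (not_le.1 h0).le
      simp [h0, abs_of_nonpos this]
  rw [h]
  exact Finset.single_le_sum
    (f := fun s : Fin k → Bool => Real.exp (∑ i, (a i : ℝ) * ((if s i then 1 else -1) * η i)))
    (fun s _ => (Real.exp_pos _).le) (Finset.mem_univ fun i => decide (0 ≤ a i))

/-- Absolute values inside the average of exponentials bound all Taylor coefficients at once, and
the resulting majorant is controlled by values of the same function at the real points (± r‖c_i‖),
where every term is positive. -/
theorem schurNorm_coeff_bound (l : Signature (k + n)) (c : Fin k → ℂ) :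
    (∀ x : ℂ, HasSum (fun d => PowerSeries.coeff d (taylorSeries fun x => schurNorm l (x • c)) * x ^ d)
      (schurNorm l (x • c))) ∧ ∀ r : ℝ, 0 ≤ r → ∃ (M : ℕ → ℝ) (B : ℝ), HasSum M B ∧
      (∀ d, ‖PowerSeries.coeff d (taylorSeries fun x => schurNorm l (x • c))‖ * r ^ d ≤ M d) ∧
      B ≤ ∑ s : Fin k → Bool,
        ‖schurNorm l fun i => (((if s i then 1 else -1) * (r * ‖c i‖) : ℝ) : ℂ)‖ := by
  obtain ⟨ι, hf, hn, α, hα⟩ := exists_schurNorm_eq_sum l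
  have hcard : (0 : ℝ) < Fintype.card ι := by exact_mod_cast Fintype.card_pos
  have h1 : (fun x : ℂ => schurNorm l (x • c)) = fun x => (Fintype.card ι : ℂ)⁻¹ *
      ∑ y, Complex.exp (x * ∑ i, (α y i : ℂ) * c i) := by
    funext x
    rw [hα]
    simp only [Pi.smul_apply, smul_eq_mul, Finset.mul_sum, mul_left_comm x]
  have h2 : ∀ d, PowerSeries.coeff d (taylorSeries fun x => schurNorm l (x • c)) =
      (Fintype.card ι : ℂ)⁻¹ * ∑ y, (∑ i, (α y i : ℂ) * c i) ^ d / d.factorial := by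
    intro d
    rw [h1, taylorSeries_const_mul, PowerSeries.coeff_C_mul, taylorSeries_sum _ fun y _ => by fun_prop,
      map_sum]
    simp only [coeff_taylorSeries_exp_mul]
  constructor
  · intro x
    rw [congrFun h1 x]
    simp_rw [h2, mul_assoc, Finset.sum_mul]
    refine HasSum.mul_left _ (hasSum_sum fun y _ => ?_)
    have := NormedSpace.expSeries_div_hasSum_exp (x * ∑ i, (α y i : ℂ) * c i)
    rw [← Complex.exp_eq_exp_ℂ] at this
    refine this.congr_fun fun d => ?_
    rw [mul_pow]
    ring
  · intro r hr
    refine ⟨fun d => (Fintype.card ι : ℝ)⁻¹ * ∑ y, (r * ∑ i, |(α y i : ℝ)| * ‖c i‖) ^ d / d.factorial,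
      (Fintype.card ι : ℝ)⁻¹ * ∑ y, Real.exp (r * ∑ i, |(α y i : ℝ)| * ‖c i‖), ?_, fun d => ?_, ?_⟩
    · refine HasSum.mul_left _ (hasSum_sum fun y _ => ?_)
      have := NormedSpace.expSeries_div_hasSum_exp (r * ∑ i, |(α y i : ℝ)| * ‖c i‖)
      rwa [← Real.exp_eq_exp_ℝ] at this
    · rw [h2, norm_mul, norm_inv, Complex.norm_natCast, mul_assoc]
      refine mul_le_mul_of_nonneg_left ?_ (by positivity)
      refine (mul_le_mul_of_nonneg_right (norm_sum_le _ _) (by positivity)).trans ?_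
      rw [Finset.sum_mul]
      refine Finset.sum_le_sum fun y _ => ?_
      rw [norm_div, norm_pow, Complex.norm_natCast, mul_pow, div_mul_eq_mul_div, mul_comm (r ^ d)]
      have h3 : ‖∑ i, (α y i : ℂ) * c i‖ ≤ ∑ i, |(α y i : ℝ)| * ‖c i‖ := by
        refine (norm_sum_le _ _).trans (le_of_eq ?_)
        simp
      gcongr
    · have h4 : ∀ s : Fin k → Bool,
          ‖schurNorm l fun i => (((if s i then 1 else -1) * (r * ‖c i‖) : ℝ) : ℂ)‖ =
          (Fintype.card ι : ℝ)⁻¹ * ∑ y, Real.exp (∑ i, (α y i : ℝ) *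
            ((if s i then 1 else -1) * (r * ‖c i‖))) := by
        intro s
        rw [hα]
        have h5 : (Fintype.card ι : ℂ)⁻¹ * ∑ y, Complex.exp (∑ i, (α y i : ℂ) *
            (((if s i then 1 else -1) * (r * ‖c i‖) : ℝ) : ℂ)) =
            (((Fintype.card ι : ℝ)⁻¹ * ∑ y, Real.exp (∑ i, (α y i : ℝ) *
            ((if s i then 1 else -1) * (r * ‖c i‖))) : ℝ) : ℂ) := by
          push_cast
          rfl
        rw [h5, Complex.norm_real, Real.norm_of_nonneg]
        exact mul_nonneg (by positivity) (Finset.sum_nonneg fun y _ => (Real.exp_pos _).le)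
      simp_rw [h4]
      rw [← Finset.mul_sum, Finset.sum_comm]
      refine mul_le_mul_of_nonneg_left (Finset.sum_le_sum fun y _ => ?_) (by positivity)
      refine le_trans (le_of_eq ?_) (exp_sum_abs_le (α y) fun i => r * ‖c i‖)
      rw [Finset.mul_sum]
      congr 1
      exact Finset.sum_congr rfl fun i _ => by ring

/-- Fubini for the double series over signatures and degrees, dominated by w_l M_l(d). -/
theorem hasSum_mixture {ι : Type*} {w : ι → ℝ} (hw : ∀ l, 0 ≤ w l) {b : ι → ℕ → ℂ} {h : ι → ℂ → ℂ}
    {r : ℝ} (hr : 0 < r) (hx : ∀ l x, HasSum (fun d => b l d * x ^ d) (h l x))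
    {M : ι → ℕ → ℝ} {B : ι → ℝ} (hMB : ∀ l, HasSum (M l) (B l))
    (hM : ∀ l d, ‖b l d‖ * r ^ d ≤ M l d) (hB : Summable fun l => w l * B l) :
    (∀ d, Summable fun l => (w l : ℂ) * b l d) ∧ ∀ x : ℂ, ‖x‖ ≤ r →
      HasSum (fun d => (∑' l, (w l : ℂ) * b l d) * x ^ d) (∑' l, (w l : ℂ) * h l x) := by
  have hM0 : ∀ l d, 0 ≤ M l d := fun l d =>
    (mul_nonneg (norm_nonneg _) (pow_nonneg hr.le d)).trans (hM l d)
  have hdom : Summable fun p : ι × ℕ => w p.1 * M p.1 p.2 := by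
    rw [summable_prod_of_nonneg fun p => mul_nonneg (hw _) (hM0 p.1 p.2)]
    refine ⟨fun l => (hMB l).summable.mul_left (w l), hB.congr fun l => ?_⟩
    rw [← (hMB l).tsum_eq]
    exact tsum_mul_left.symm
  have hF : ∀ x : ℂ, ‖x‖ ≤ r → Summable fun p : ℕ × ι => (w p.2 : ℂ) * b p.2 p.1 * x ^ p.1 := by
    intro x hxr
    refine Summable.of_norm_bounded hdom.prod_symm fun p => ?_
    rw [norm_mul, norm_mul, norm_pow, Complex.norm_real, Real.norm_of_nonneg (hw _), mul_assoc]
    refine mul_le_mul_of_nonneg_left (le_trans ?_ (hM p.2 p.1)) (hw _)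
    gcongr
  refine ⟨fun d => ?_, fun x hxr => ?_⟩
  · have h1 := (hF (r : ℂ) (by simp [abs_of_pos hr])).prod_factor d
    have h2 : ((r : ℂ)) ^ d ≠ 0 := pow_ne_zero _ (by exact_mod_cast hr.ne')
    exact (summable_mul_right_iff h2).1 h1
  · have hF2 := hF x hxr
    have h1 : HasSum (fun d => ∑' l, (w l : ℂ) * b l d * x ^ d)
        (∑' p : ℕ × ι, (w p.2 : ℂ) * b p.2 p.1 * x ^ p.1) :=
      hF2.hasSum.prod_fiberwise fun d => (hF2.prod_factor d).hasSum
    have h2 : ∑' p : ℕ × ι, (w p.2 : ℂ) * b p.2 p.1 * x ^ p.1 =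
        ∑' l, ∑' d, (w l : ℂ) * b l d * x ^ d := by
      rw [← (Equiv.prodComm ι ℕ).tsum_eq]
      exact hF2.prod_symm.tsum_prod
    have h3 : ∑' l, (w l : ℂ) * h l x = ∑' l, ∑' d, (w l : ℂ) * b l d * x ^ d := by
      refine tsum_congr fun l => ?_
      rw [← (hx l x).tsum_eq, ← tsum_mul_left]
      exact tsum_congr fun d => (mul_assoc _ _ _).symm
    rw [h3, ← h2]
    refine h1.congr_fun fun d => ?_
    exact tsum_mul_right.symm

/-- Convergence of the values on the polydisc yields convergence of the average of each Taylor
coefficient. -/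
theorem schurGen_taylor (ρ : PMF (Signature (k + n))) {ε : ℝ} (hε : 0 < ε)
    (hs : ∀ u ∈ Metric.ball (1 : Fin k → ℂ) ε, Summable (schurGenTerm ρ (padOnes (k + n) u)))
    (c : Fin k → ℂ) :
    AnalyticAt ℂ (fun x : ℂ => schurGen ρ (padOnes (k + n) fun i => Complex.exp ((x • c) i))) 0 ∧
    ∀ d, HasSum (fun l => ((ρ l).toReal : ℂ) *
        PowerSeries.coeff d (taylorSeries fun x => schurNorm l (x • c)))
      (PowerSeries.coeff d (taylorSeries fun x : ℂ =>
        schurGen ρ (padOnes (k + n) fun i => Complex.exp ((x • c) i)))) := by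
  obtain ⟨δ, hδ, hball⟩ : ∃ δ > 0, ∀ t : Fin k → ℂ, ‖t‖ < δ →
      (fun i => Complex.exp (t i)) ∈ Metric.ball (1 : Fin k → ℂ) ε := by
    have hc : Tendsto (fun t : Fin k → ℂ => fun i => Complex.exp (t i)) (𝓝 0) (𝓝 1) :=
      Continuous.tendsto' (by fun_prop) _ _ (by funext i; simp)
    obtain ⟨δ, hδ, h⟩ := Metric.eventually_nhds_iff.1 (hc.eventually (Metric.ball_mem_nhds 1 hε))
    exact ⟨δ, hδ, fun t ht => h (by simpa using ht)⟩
  obtain ⟨r, hr, hrc⟩ : ∃ r : ℝ, 0 < r ∧ r * ‖c‖ < δ := by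
    refine ⟨δ / (‖c‖ + 1), by positivity, ?_⟩
    rw [div_mul_eq_mul_div, div_lt_iff₀ (by positivity)]
    nlinarith [norm_nonneg c]
  have hsum : ∀ t : Fin k → ℂ, ‖t‖ < δ → Summable fun l => ((ρ l).toReal : ℂ) * schurNorm l t :=
    fun t ht => hs _ (hball t ht)
  choose hx M B hMB hM hB using fun l : Signature (k + n) =>
    And.imp_right (fun h => h r hr.le) (schurNorm_coeff_bound l c)
  -- The points (± r‖c_i‖) have norm below δ, so the generating series converges absolutely at their
  -- exponentials.
  have hsB : Summable fun l => (ρ l).toReal * B l := by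
    have h1 : Summable fun l => ∑ s : Fin k → Bool, (ρ l).toReal *
        ‖schurNorm l fun i => (((if s i then 1 else -1) * (r * ‖c i‖) : ℝ) : ℂ)‖ := by
      refine summable_sum fun s _ => ?_
      have h2 := (hsum (fun i => (((if s i then 1 else -1) * (r * ‖c i‖) : ℝ) : ℂ)) ?_).norm
      · refine h2.congr fun l => ?_
        rw [norm_mul, Complex.norm_real, Real.norm_of_nonneg ENNReal.toReal_nonneg]
      · refine lt_of_le_of_lt ((pi_norm_le_iff_of_nonneg (by positivity)).2 fun i => ?_) hrc
        rw [Complex.norm_real, norm_mul, Real.norm_of_nonneg (by positivity : 0 ≤ r * ‖c i‖)]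
        have h3 : ‖(if s i then (1 : ℝ) else -1)‖ = 1 := by split_ifs <;> simp
        rw [h3, one_mul]
        exact mul_le_mul_of_nonneg_left (norm_le_pi_norm c i) hr.le
    refine Summable.of_nonneg_of_le (fun l => mul_nonneg ENNReal.toReal_nonneg ?_) (fun l => ?_) h1
    · exact (hMB l).nonneg fun d =>
        (mul_nonneg (norm_nonneg _) (pow_nonneg hr.le d)).trans (hM l d)
    · rw [← Finset.mul_sum]
      exact mul_le_mul_of_nonneg_left (hB l) ENNReal.toReal_nonneg
  obtain ⟨hb, hser⟩ := hasSum_mixture (fun l => ENNReal.toReal_nonneg) hr hx hMB hM hsB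
  have hev : ∀ᶠ x in 𝓝 (0 : ℂ), ‖x‖ ≤ r := by
    filter_upwards [Metric.closedBall_mem_nhds (0 : ℂ) hr] with x hxr
    exact mem_closedBall_zero_iff.1 hxr
  obtain ⟨h1, h2⟩ := taylorSeries_eq_of_hasSum (hev.mono hser)
  refine ⟨h1, fun d => ?_⟩
  have h3 : PowerSeries.coeff d (taylorSeries fun x : ℂ =>
      schurGen ρ (padOnes (k + n) fun i => Complex.exp ((x • c) i))) = ∑' l, ((ρ l).toReal : ℂ) *
        PowerSeries.coeff d (taylorSeries fun x => schurNorm l (x • c)) :=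
    (congrArg (PowerSeries.coeff d) h2).trans (PowerSeries.coeff_mk d _)
  rw [h3]
  exact (hb d).hasSum

theorem schurExp_eq_schurNorm_mul (l : Signature (k + n)) (t : Fin k → ℂ) :
    schurExp l t = schurNorm l t * expQuotProd k n t := rfl

theorem analyticAt_schurNorm_smul (l : Signature (k + n)) (c : Fin k → ℂ) :
    AnalyticAt ℂ (fun x : ℂ => schurNorm l (x • c)) 0 := by
  obtain ⟨ι, hf, hn, α, hα⟩ := exists_schurNorm_eq_sum l
  simp_rw [hα, Pi.smul_apply, smul_eq_mul]
  fun_prop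

theorem hasSum_coeff_schurExp (ρ : PMF (Signature (k + n))) {ε : ℝ} (hε : 0 < ε)
    (hs : ∀ u ∈ Metric.ball (1 : Fin k → ℂ) ε, Summable (schurGenTerm ρ (padOnes (k + n) u)))
    (c : Fin k → ℂ) (d : ℕ) :
    HasSum (fun l => ((ρ l).toReal : ℂ) *
        PowerSeries.coeff d (taylorSeries fun x => schurExp l (x • c)))
      (PowerSeries.coeff d (taylorSeries fun x : ℂ =>
        schurGen ρ (padOnes (k + n) fun i => Complex.exp ((x • c) i)) *
          expQuotProd k n (x • c))) := by
  obtain ⟨h1, h2⟩ := schurGen_taylor ρ hε hs c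
  have hQ := analyticAt_comp_smul (analyticAt_expQuotProd (n := n) (0 : Fin k → ℂ)) c
  rw [taylorSeries_mul h1 hQ, PowerSeries.coeff_mul]
  have h3 := hasSum_sum (s := Finset.HasAntidiagonal.antidiagonal d) fun p _ =>
    (h2 p.1).mul_right (PowerSeries.coeff p.2 (taylorSeries fun x => expQuotProd k n (x • c)))
  refine h3.congr_fun fun l => ?_
  simp_rw [schurExp_eq_schurNorm_mul]
  rw [taylorSeries_mul (analyticAt_schurNorm_smul l c) hQ, PowerSeries.coeff_mul, Finset.mul_sum]
  exact Finset.sum_congr rfl fun p _ => (mul_assoc _ _ _).symm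

/-- Interpolation at the nodes `2, …, k + 1`: the coefficients of a polynomial of degree less than
`k` are fixed linear combinations of its values. -/
theorem exists_interpolation_weights (k : ℕ) : ∃ w : Fin k → Fin k → ℂ, ∀ (h : Fin k → ℂ) (b : Fin k),
    h b = ∑ s, w b s * ∑ a : Fin k, ((s : ℂ) + 2) ^ (a : ℕ) * h a := by
  let V := Matrix.vandermonde fun s : Fin k => (s : ℂ) + 2
  have hV : IsUnit V.det := by
    rw [isUnit_iff_ne_zero, Matrix.det_vandermonde_ne_zero_iff]
    intro i j hij
    have : (i : ℂ) = (j : ℂ) := by simpa using hij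
    exact Fin.ext (by exact_mod_cast this)
  refine ⟨fun b s => V⁻¹ b s, fun h b => ?_⟩
  have h1 : h = V⁻¹.mulVec (V.mulVec h) := by
    rw [Matrix.mulVec_mulVec, Matrix.nonsing_inv_mul _ hV, Matrix.one_mulVec]
  exact congrFun h1 b

/-- The expected power sum of the shifted coordinates is a fixed linear functional of the polynomial
`∑ H_b z ^ b` determined by the Schur generating function. -/
theorem exists_hasSum_power_sum (hk : 1 ≤ k) (ρ : PMF (Signature (k + n))) {ε : ℝ} (hε : 0 < ε)
    (hs : ∀ u ∈ Metric.ball (1 : Fin k → ℂ) ε, Summable (schurGenTerm ρ (padOnes (k + n) u))) :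
    ∃ H : Fin k → ℂ,
      HasSum (fun l => ((ρ l).toReal : ℂ) * ∑ j, (l.shifted j : ℂ) ^ k)
        (∑ b : Fin k, ((k + n - b).ascFactorial k : ℂ) * H b) ∧
      ∀ (z : ℂ) (c : Fin k → ℂ), (∀ m, 1 ≤ m → m ≤ k → ∑ i, c i ^ m = 1 - z ^ m) →
        (1 - z) * ∑ b : Fin k, z ^ (b : ℕ) * H b =
          PowerSeries.coeff k (taylorSeries fun x : ℂ =>
            schurGen ρ (padOnes (k + n) fun i => Complex.exp ((x • c) i)) *
              expQuotProd k n (x • c)) := by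
  choose f hfs hfh hf hp using fun l : Signature (k + n) => exists_symmetric_form_schurExp hk l
  obtain ⟨w, hw⟩ := exists_interpolation_weights k
  let h : Signature (k + n) → Fin k → ℂ := fun l b =>
    (f l * vandermondePoly k).coeff (staircaseAdd k k b)
  have hz : ∀ (z : ℂ) (c : Fin k → ℂ), (∀ m, 1 ≤ m → m ≤ k → ∑ i, c i ^ m = 1 - z ^ m) →
      HasSum (fun l => ((ρ l).toReal : ℂ) * ((1 - z) * ∑ b : Fin k, z ^ (b : ℕ) * h l b))
        (PowerSeries.coeff k (taylorSeries fun x : ℂ =>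
            schurGen ρ (padOnes (k + n) fun i => Complex.exp ((x • c) i)) *
              expQuotProd k n (x • c))) := by
    intro z c hc
    refine (hasSum_coeff_schurExp ρ hε hs c k).congr_fun fun l => ?_
    rw [hf, ← one_sub_mul_sum_coeff_staircase hk (hfs l) (hfh l) hc]
  -- Each coefficient is recovered from the values at z = 2, ..., k+1. These avoid z = 1, so the
  -- factor 1 - z can be divided out.
  have hH : ∀ b, Summable fun l => ((ρ l).toReal : ℂ) * h l b := by
    intro b
    have h1 : Summable fun l => ∑ s : Fin k, w b s * (((ρ l).toReal : ℂ) *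
        ∑ a : Fin k, ((s : ℂ) + 2) ^ (a : ℕ) * h l a) := by
      refine summable_sum fun s _ => Summable.mul_left _ ?_
      obtain ⟨c, hc⟩ := exists_sum_pow_eq k fun m => 1 - ((s : ℂ) + 2) ^ m
      have h2 := (hz _ c hc).summable
      have h3 : (1 - ((s : ℂ) + 2)) ≠ 0 := by
        intro h
        have h4 : ((s : ℕ) : ℂ) + 1 = 0 := by linear_combination -h
        exact Nat.cast_add_one_ne_zero (s : ℕ) h4
      refine (summable_mul_left_iff h3).1 (h2.congr fun l => ?_)
      ring
    refine h1.congr fun l => ?_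
    rw [hw (h l) b, Finset.mul_sum]
    exact Finset.sum_congr rfl fun s _ => mul_left_comm _ _ _
  refine ⟨fun b => ∑' l, ((ρ l).toReal : ℂ) * h l b, ?_, fun z c hc => ?_⟩
  · have h1 := hasSum_sum (s := Finset.univ) fun (b : Fin k) _ =>
      (hH b).hasSum.mul_left ((k + n - b).ascFactorial k : ℂ)
    refine h1.congr_fun fun l => ?_
    rw [hp l, Finset.mul_sum]
    exact Finset.sum_congr rfl fun b _ => mul_left_comm _ _ _
  · have h1 := (hasSum_sum (s := Finset.univ) fun (b : Fin k) _ =>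
      (hH b).hasSum.mul_left (z ^ (b : ℕ))).mul_left (1 - z)
    refine (h1.congr_fun fun l => ?_).unique (hz z c hc)
    simp only [Finset.mul_sum]
    exact Finset.sum_congr rfl fun b _ => by ring

end Expectation

/-! ### Taylor expansion of the logarithm at the special points. -/

section LocalExpansion

variable {k n : ℕ}

/-- From (e^(-w) - 1)/(-w) = e^(-w) (e^w - 1)/w; near 0 the imaginary part is too small for a jump
of the branch. -/
theorem eventually_logExpQuot_neg : ∀ᶠ w in 𝓝 (0 : ℂ), logExpQuot (-w) = logExpQuot w - w := by
  have hneg : Tendsto (fun w : ℂ => -w) (𝓝 0) (𝓝 0) := Continuous.tendsto' (by fun_prop) _ _ (by simp)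
  have hc : Tendsto (fun w => (logExpQuot w - w).im) (𝓝 0) (𝓝 0) := by
    have h := (analyticAt_logExpQuot.continuousAt.tendsto.sub tendsto_id)
    rw [logExpQuot_zero, sub_zero] at h
    exact (Complex.continuous_im.tendsto' 0 0 rfl).comp h
  filter_upwards [eventually_exp_logExpQuot, hc.eventually (Ioo_mem_nhds (neg_lt_zero.2 Real.pi_pos)
    Real.pi_pos)] with w h1 h2
  have h3 : expQuot (-w) = Complex.exp (logExpQuot w - w) := by
    rw [Complex.exp_sub, h1]
    rcases eq_or_ne w 0 with rfl | hw
    · simp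
    · have h4 := mul_expQuot w
      have h5 := mul_expQuot (-w)
      rw [Complex.exp_neg] at h5
      have h6 := Complex.exp_ne_zero w
      refine mul_left_cancel₀ (neg_ne_zero.2 hw) ?_
      rw [h5]
      field_simp
      linear_combination h4
  have h7 : logExpQuot (-w) = Complex.log (expQuot (-w)) := rfl
  rw [h7, h3, Complex.log_exp h2.1 h2.2.le]

/-- In other words, log((e^w - 1)/w) - w/2 is even. -/
theorem coeff_logExpQuot_mul_neg_one_pow (m : ℕ) :
    PowerSeries.coeff m (taylorSeries logExpQuot) * (-1) ^ m =
      PowerSeries.coeff m (taylorSeries logExpQuot) - if m = 1 then 1 else 0 := by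
  rw [← coeff_taylorSeries_comp_mul analyticAt_logExpQuot]
  have h : (fun x : ℂ => logExpQuot (x * -1)) =ᶠ[𝓝 0] fun x => logExpQuot x - x := by
    filter_upwards [eventually_logExpQuot_neg] with w hw
    rw [mul_neg_one, hw]
  rw [taylorSeries_congr h, taylorSeries_sub analyticAt_logExpQuot (by fun_prop), taylorSeries_id,
    map_sub, PowerSeries.coeff_X]

theorem two_mul_sum_Ioi {f : Fin k → Fin k → ℂ} (hf : ∀ i j, f i j = f j i) :
    2 * ∑ i, ∑ j ∈ Finset.Ioi i, f i j = ∑ i, ∑ j, f i j - ∑ i, f i i := by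
  have h1 : ∀ i, ∑ j, f i j = ∑ j ∈ Finset.Ioi i, f i j + ∑ j ∈ Finset.Iio i, f i j + f i i := by
    intro i
    rw [← Finset.filter_lt_eq_Ioi, ← Finset.filter_gt_eq_Iio, Finset.sum_filter, Finset.sum_filter,
      ← Finset.sum_add_distrib]
    have h2 : ∑ j, (if j = i then f i i else 0) = f i i := by simp
    rw [← h2, ← Finset.sum_add_distrib]
    refine Finset.sum_congr rfl fun j _ => ?_
    rcases lt_trichotomy i j with h | h | h
    · simp [h, h.not_gt, h.ne']
    · simp [h]
    · simp [h, h.not_gt, h.ne]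
  have h3 : ∑ i, ∑ j ∈ Finset.Iio i, f i j = ∑ i, ∑ j ∈ Finset.Ioi i, f i j := by
    rw [Finset.sum_comm' (t' := Finset.univ) (s' := fun j => Finset.Ioi j) (by simp)]
    exact Finset.sum_congr rfl fun i _ => Finset.sum_congr rfl fun j _ => hf j i
  simp_rw [h1]
  rw [Finset.sum_add_distrib, Finset.sum_add_distrib, h3]
  ring

/-- The cross terms of the power sum expansion of `∑_{i, j} (c_i - c_j) ^ m`. -/
noncomputable def crossSum (p : ℕ → ℂ) (m : ℕ) : ℂ :=
  ∑ a ∈ Finset.range (m - 1), (-1) ^ (m - (a + 1)) * (m.choose (a + 1)) * (p (a + 1) * p (m - (a + 1)))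

/-- Binomial expansion; the two extreme terms contain a zeroth power sum, which equals k. -/
theorem sum_sum_sub_pow (c : Fin k → ℂ) {m : ℕ} (hm : 1 ≤ m) :
    ∑ i, ∑ j, (c i - c j) ^ m = (1 + (-1) ^ m) * k * ∑ i, c i ^ m +
      crossSum (fun a => ∑ i, c i ^ a) m := by
  obtain ⟨m, rfl⟩ := Nat.exists_eq_add_of_le' hm
  have h1 : ∑ i, ∑ j, (c i - c j) ^ (m + 1) = ∑ a ∈ Finset.range (m + 1 + 1),
      (-1) ^ (m + 1 - a) * ((m + 1).choose a) * ((∑ i, c i ^ a) * ∑ j, c j ^ (m + 1 - a)) := by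
    simp_rw [sub_eq_add_neg, add_pow, Finset.sum_mul_sum, Finset.mul_sum]
    rw [Finset.sum_comm' (t' := Finset.univ) (s' := fun _ => Finset.univ) (by simp),
      Finset.sum_comm' (s := Finset.range (m + 1 + 1)) (t' := Finset.univ)
        (s' := fun _ => Finset.range (m + 1 + 1)) (by simp)]
    rw [Finset.sum_comm]
    refine Finset.sum_congr rfl fun i _ => ?_
    rw [Finset.sum_comm' (s := Finset.univ) (t := fun _ => Finset.range (m + 1 + 1))
      (t' := Finset.range (m + 1 + 1)) (s' := fun _ => Finset.univ) (by simp)]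
    refine Finset.sum_congr rfl fun a _ => Finset.sum_congr rfl fun j _ => ?_
    rw [neg_pow (c j)]
    ring
  rw [h1, Finset.sum_range_succ, Finset.sum_range_succ', crossSum]
  simp
  ring

/-- The logarithm of the product of the Schur generating function and `expQuotProd`. -/
noncomputable def logSchurGen (n : ℕ) (L : (Fin k → ℂ) → ℂ) (t : Fin k → ℂ) : ℂ :=
  L (fun i => Complex.exp (t i)) + n * ∑ i, logExpQuot (t i) +
    ∑ i, ∑ j ∈ Finset.Ioi i, (t j + logExpQuot (t i - t j))

/-- The error term of the logarithm of the Schur generating function. -/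
noncomputable def logError (N : ℕ) (Ψ Φ : ℂ → ℂ) (L : (Fin k → ℂ) → ℂ) (t : Fin k → ℂ) : ℂ :=
  L (fun i => Complex.exp (t i)) -
    ∑ i, (N * Ψ (Complex.exp (t i)) + Φ (Complex.exp (t i)))

theorem analyticAt_expMap {t : Fin k → ℂ} :
    AnalyticAt ℂ (fun t : Fin k → ℂ => fun i => Complex.exp (t i)) t :=
  analyticAt_pi_iff.2 fun i => (analyticAt_apply i t).cexp

theorem expMap_zero : (fun i : Fin k => Complex.exp ((0 : Fin k → ℂ) i)) = 1 := by
  funext i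
  simp

theorem analyticAt_comp_expMap {L : (Fin k → ℂ) → ℂ} (hL : AnalyticAt ℂ L 1) :
    AnalyticAt ℂ (fun t : Fin k → ℂ => L fun i => Complex.exp (t i)) 0 :=
  AnalyticAt.fun_comp (g := L) (by rw [expMap_zero]; exact hL) analyticAt_expMap

theorem analyticAt_comp_exp {Ψ : ℂ → ℂ} (hΨ : AnalyticAt ℂ Ψ 1) :
    AnalyticAt ℂ (fun u => Ψ (Complex.exp u)) 0 :=
  AnalyticAt.fun_comp (g := Ψ) (by rw [Complex.exp_zero]; exact hΨ) (by fun_prop)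

theorem analyticAt_logSchurGen {L : (Fin k → ℂ) → ℂ} (hL : AnalyticAt ℂ L 1) :
    AnalyticAt ℂ (logSchurGen n L) 0 := by
  refine ((analyticAt_comp_expMap hL).add (analyticAt_const.mul
    (Finset.analyticAt_fun_sum _ fun i _ => ?_))).add
    (Finset.analyticAt_fun_sum _ fun i _ => Finset.analyticAt_fun_sum _ fun j _ => ?_)
  · exact AnalyticAt.fun_comp (g := logExpQuot) (by simpa using analyticAt_logExpQuot)
      (analyticAt_apply i 0)
  · exact (analyticAt_apply j 0).add (AnalyticAt.fun_comp (g := logExpQuot)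
      (by simpa using analyticAt_logExpQuot) ((analyticAt_apply i 0).sub (analyticAt_apply j 0)))

theorem analyticAt_logError {N : ℕ} {Ψ Φ : ℂ → ℂ} (hΨ : AnalyticAt ℂ Ψ 1) (hΦ : AnalyticAt ℂ Φ 1)
    {L : (Fin k → ℂ) → ℂ} (hL : AnalyticAt ℂ L 1) : AnalyticAt ℂ (logError N Ψ Φ L) 0 := by
  refine (analyticAt_comp_expMap hL).sub (Finset.analyticAt_fun_sum _ fun i _ => ?_)
  exact (analyticAt_const.mul (AnalyticAt.fun_comp (g := fun u => Ψ (Complex.exp u))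
    (by simpa using analyticAt_comp_exp hΨ) (analyticAt_apply i 0))).add
    (AnalyticAt.fun_comp (g := fun u => Φ (Complex.exp u))
    (by simpa using analyticAt_comp_exp hΦ) (analyticAt_apply i 0))

theorem logSchurGen_zero {L : (Fin k → ℂ) → ℂ} (h0 : L 1 = 0) : logSchurGen n L 0 = 0 := by
  rw [logSchurGen, expMap_zero, h0]
  simp [logExpQuot_zero]

theorem eventually_exp_logSchurGen {ρ : PMF (Signature (k + n))} {L : (Fin k → ℂ) → ℂ}
    (hL : ∀ᶠ u in 𝓝 (1 : Fin k → ℂ), Complex.exp (L u) = schurGen ρ (padOnes (k + n) u)) :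
    ∀ᶠ t in 𝓝 (0 : Fin k → ℂ), Complex.exp (logSchurGen n L t) =
      schurGen ρ (padOnes (k + n) fun i => Complex.exp (t i)) * expQuotProd k n t := by
  have h1 : Tendsto (fun t : Fin k → ℂ => fun i => Complex.exp (t i)) (𝓝 0) (𝓝 1) :=
    Continuous.tendsto' (by fun_prop) _ _ expMap_zero
  have h2 : ∀ i, ∀ᶠ t in 𝓝 (0 : Fin k → ℂ), Complex.exp (logExpQuot (t i)) = expQuot (t i) :=
    fun i => (Continuous.tendsto' (by fun_prop : Continuous fun t : Fin k → ℂ => t i) _ _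
      (by simp)).eventually eventually_exp_logExpQuot
  have h3 : ∀ i j, ∀ᶠ t in 𝓝 (0 : Fin k → ℂ),
      Complex.exp (logExpQuot (t i - t j)) = expQuot (t i - t j) :=
    fun i j => (Continuous.tendsto' (by fun_prop : Continuous fun t : Fin k → ℂ => t i - t j) _ _
      (by simp)).eventually eventually_exp_logExpQuot
  filter_upwards [h1.eventually hL, eventually_all.2 h2, eventually_all.2 fun i =>
    eventually_all.2 (h3 i)] with t ht1 ht2 ht3
  rw [logSchurGen, Complex.exp_add, Complex.exp_add, ht1, expQuotProd, Complex.exp_nat_mul,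
    Complex.exp_sum, Complex.exp_sum]
  simp_rw [Complex.exp_sum, Complex.exp_add, ht2, ht3, Finset.prod_pow]
  ring

theorem coeff_taylorSeries_schurGen {ρ : PMF (Signature (k + n))} {L : (Fin k → ℂ) → ℂ}
    (hLa : AnalyticAt ℂ L 1) (h0 : L 1 = 0)
    (hL : ∀ᶠ u in 𝓝 (1 : Fin k → ℂ), Complex.exp (L u) = schurGen ρ (padOnes (k + n) u))
    (c : Fin k → ℂ) (d : ℕ) :
    PowerSeries.coeff d (taylorSeries fun x : ℂ =>
      schurGen ρ (padOnes (k + n) fun i => Complex.exp ((x • c) i)) * expQuotProd k n (x • c)) =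
    ∑ j ∈ Finset.range (d + 1),
      PowerSeries.coeff d (taylorSeries (fun x : ℂ => logSchurGen n L (x • c)) ^ j) / j.factorial := by
  have hc : Tendsto (fun x : ℂ => x • c) (𝓝 0) (𝓝 0) :=
    Continuous.tendsto' (by fun_prop) _ _ (by simp)
  rw [← coeff_taylorSeries_exp_comp (analyticAt_comp_smul (analyticAt_logSchurGen hLa) c)
    (by rw [zero_smul, logSchurGen_zero h0])]
  rw [taylorSeries_congr]
  filter_upwards [hc.eventually (eventually_exp_logSchurGen hL)] with x hx
  exact hx.symm

theorem coeff_taylorSeries_sum_comp {g : ℂ → ℂ} (hg : AnalyticAt ℂ g 0) (c : Fin k → ℂ) (m : ℕ) :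
    PowerSeries.coeff m (taylorSeries fun x : ℂ => ∑ i, g (x * c i)) =
      PowerSeries.coeff m (taylorSeries g) * ∑ i, c i ^ m := by
  rw [taylorSeries_sum _ fun i _ => AnalyticAt.fun_comp (g := g) (by simpa using hg) (by fun_prop), map_sum,
    Finset.mul_sum]
  exact Finset.sum_congr rfl fun i _ => coeff_taylorSeries_comp_mul hg _ _

/-- Each pair term t_j + log((e^(t_i-t_j) - 1)/(t_i - t_j)) is symmetric in i and j, so the sum over
i < j is half of the full sum minus the diagonal. The diagonal, present only for m = 1, is the
origin of the term -u/2 in κ⁽¹⁾. -/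
theorem coeff_taylorSeries_pairs (c : Fin k → ℂ) {m : ℕ} (hm : 1 ≤ m) :
    PowerSeries.coeff m (taylorSeries fun x : ℂ =>
      ∑ i, ∑ j ∈ Finset.Ioi i, (x * c j + logExpQuot (x * (c i - c j)))) =
    (k * PowerSeries.coeff m (taylorSeries logExpQuot) - if m = 1 then 1 / 2 else 0) * ∑ i, c i ^ m +
      PowerSeries.coeff m (taylorSeries logExpQuot) / 2 * crossSum (fun a => ∑ i, c i ^ a) m := by
  have hG : ∀ a : ℂ, AnalyticAt ℂ (fun x : ℂ => logExpQuot (x * a)) 0 := fun a =>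
    AnalyticAt.fun_comp (g := logExpQuot) (by simpa using analyticAt_logExpQuot) (by fun_prop)
  have hX : ∀ a : ℂ, AnalyticAt ℂ (fun x : ℂ => x * a) 0 := fun a => by fun_prop
  set g := PowerSeries.coeff m (taylorSeries logExpQuot) with hg
  let φ : Fin k → Fin k → ℂ := fun i j => (if m = 1 then c j else 0) + g * (c i - c j) ^ m
  have h1 : PowerSeries.coeff m (taylorSeries fun x : ℂ =>
      ∑ i, ∑ j ∈ Finset.Ioi i, (x * c j + logExpQuot (x * (c i - c j)))) =
      ∑ i, ∑ j ∈ Finset.Ioi i, φ i j := by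
    rw [taylorSeries_sum _ fun i _ => Finset.analyticAt_fun_sum _ fun j _ =>
      (hX _).fun_add (hG _), map_sum]
    refine Finset.sum_congr rfl fun i _ => ?_
    rw [taylorSeries_sum _ fun j _ => (hX _).fun_add (hG _), map_sum]
    refine Finset.sum_congr rfl fun j _ => ?_
    rw [taylorSeries_add (hX _) (hG _), map_add, coeff_taylorSeries_comp_mul analyticAt_logExpQuot]
    congr 1
    rw [coeff_taylorSeries_comp_mul (f := fun x => x) (by fun_prop), taylorSeries_id,
      PowerSeries.coeff_X]
    split_ifs with h
    · rw [h, one_mul, pow_one]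
    · rw [zero_mul]
  have hsign := coeff_logExpQuot_mul_neg_one_pow m
  rw [← hg] at hsign
  have h2 : ∀ i j, φ i j = φ j i := by
    intro i j
    have h3 : (c j - c i) ^ m = (-1) ^ m * (c i - c j) ^ m := by
      rw [← neg_sub, neg_pow]
    simp only [φ]
    rw [h3, ← mul_assoc, hsign]
    split_ifs with h
    · subst h; ring
    · ring
  have h4 := two_mul_sum_Ioi h2
  have h5 : ∑ i, ∑ j, φ i j = (if m = 1 then k * ∑ i, c i ^ m else 0) +
      g * ∑ i, ∑ j, (c i - c j) ^ m := by
    simp only [φ, Finset.sum_add_distrib, Finset.mul_sum]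
    congr 1
    split_ifs with h
    · subst h; simp [Finset.mul_sum]
    · simp
  have h6 : ∑ i, φ i i = if m = 1 then ∑ i, c i ^ m else 0 := by
    simp only [φ, sub_self, zero_pow (by omega : m ≠ 0), mul_zero, add_zero]
    split_ifs with h
    · subst h; simp
    · simp
  rw [h5, h6, sum_sum_sub_pow c hm] at h4
  rw [h1]
  split_ifs at h4 hsign ⊢ with h
  · linear_combination h4 / 2 + k * (∑ i, c i ^ m) / 2 * hsign
  · linear_combination h4 / 2 + k * (∑ i, c i ^ m) / 2 * hsign

/-- The n factors (e^(t_i) - 1)/t_i and the k from the pair interaction add up to N = k + n copies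
of log((e^u - 1)/u). -/
theorem coeff_taylorSeries_logSchurGen {Ψ Φ : ℂ → ℂ} (hΨ : AnalyticAt ℂ Ψ 1) (hΦ : AnalyticAt ℂ Φ 1)
    {L : (Fin k → ℂ) → ℂ} (hL : AnalyticAt ℂ L 1) (c : Fin k → ℂ) {m : ℕ} (hm : 1 ≤ m) :
    PowerSeries.coeff m (taylorSeries fun x : ℂ => logSchurGen n L (x • c)) =
      (((k + n : ℕ) : ℂ) *
        PowerSeries.coeff m (taylorSeries fun u => Ψ (Complex.exp u) + logExpQuot u) +
        PowerSeries.coeff m (taylorSeries fun u => Φ (Complex.exp u) - 1 / 2 * u)) * ∑ i, c i ^ m +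
      PowerSeries.coeff m (taylorSeries logExpQuot) / 2 * crossSum (fun a => ∑ i, c i ^ a) m +
      PowerSeries.coeff m (taylorSeries fun x : ℂ => logError (k + n) Ψ Φ L (x • c)) := by
  have hE := analyticAt_comp_smul (analyticAt_logError (N := k + n) hΨ hΦ hL) c
  have hΨe := analyticAt_comp_exp hΨ
  have hΦe := analyticAt_comp_exp hΦ
  have hcomp : ∀ {g : ℂ → ℂ}, AnalyticAt ℂ g 0 → AnalyticAt ℂ (fun x : ℂ => ∑ i, g (x * c i)) 0 :=
    fun {g} hg => Finset.analyticAt_fun_sum _ fun i _ =>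
      AnalyticAt.fun_comp (g := g) (by simpa using hg) (by fun_prop)
  have hG : ∀ a : ℂ, AnalyticAt ℂ (fun x : ℂ => logExpQuot (x * a)) 0 := fun a =>
    AnalyticAt.fun_comp (g := logExpQuot) (by simpa using analyticAt_logExpQuot) (by fun_prop)
  have hpair : AnalyticAt ℂ (fun x : ℂ =>
      ∑ i, ∑ j ∈ Finset.Ioi i, (x * c j + logExpQuot (x * (c i - c j)))) 0 :=
    Finset.analyticAt_fun_sum _ fun i _ => Finset.analyticAt_fun_sum _ fun j _ =>
      AnalyticAt.fun_add (by fun_prop) (hG _)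
  let g : ℂ → ℂ := fun u => (((k + n : ℕ) : ℂ) * Ψ (Complex.exp u) + Φ (Complex.exp u)) +
    n * logExpQuot u
  have hga : AnalyticAt ℂ g 0 := ((analyticAt_const.mul hΨe).add hΦe).add
    (analyticAt_const.mul analyticAt_logExpQuot)
  have h1 : (fun x : ℂ => logSchurGen n L (x • c)) = fun x =>
      (logError (k + n) Ψ Φ L (x • c) + ∑ i, g (x * c i)) +
      ∑ i, ∑ j ∈ Finset.Ioi i, (x * c j + logExpQuot (x * (c i - c j))) := by
    funext x
    simp only [logSchurGen, logError, g, Finset.sum_add_distrib, Finset.mul_sum, Pi.smul_apply,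
      smul_eq_mul, mul_sub]
    ring
  have h2 : PowerSeries.coeff m (taylorSeries g) = ((k + n : ℕ) : ℂ) *
      PowerSeries.coeff m (taylorSeries fun u => Ψ (Complex.exp u)) +
      PowerSeries.coeff m (taylorSeries fun u => Φ (Complex.exp u)) +
      n * PowerSeries.coeff m (taylorSeries logExpQuot) := by
    rw [taylorSeries_add ((analyticAt_const.fun_mul hΨe).fun_add hΦe)
      (analyticAt_const.fun_mul analyticAt_logExpQuot),
      taylorSeries_add (analyticAt_const.fun_mul hΨe) hΦe, taylorSeries_const_mul,
      taylorSeries_const_mul, map_add, map_add, PowerSeries.coeff_C_mul, PowerSeries.coeff_C_mul]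
  rw [h1, taylorSeries_add (hE.fun_add (hcomp hga)) hpair, taylorSeries_add hE (hcomp hga), map_add,
    map_add, coeff_taylorSeries_sum_comp hga, coeff_taylorSeries_pairs c hm, h2,
    taylorSeries_add hΨe analyticAt_logExpQuot, taylorSeries_sub hΦe (by fun_prop),
    taylorSeries_const_mul, taylorSeries_id, map_add, map_sub, PowerSeries.coeff_C_mul,
    PowerSeries.coeff_X]
  push_cast
  split_ifs <;> ring

theorem schurGen_comp_perm (ρ : PMF (Signature (k + n))) (σ : Equiv.Perm (Fin k)) {u : Fin k → ℂ}
    (hu : ∀ i, u i ≠ 0) :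
    schurGen ρ (padOnes (k + n) (u ∘ σ)) = schurGen ρ (padOnes (k + n) u) := by
  have h : padOnes (k + n) (u ∘ σ) =
      padOnes (k + n) u ∘ (finSumFinEquiv.permCongr (Equiv.Perm.sumCongr σ 1)) := by
    funext i
    refine Fin.addCases (fun i => ?_) (fun i => ?_) i
    · simp [padOnes, Equiv.permCongr_apply]
    · simp [padOnes, Equiv.permCongr_apply]
  refine tsum_congr fun l => ?_
  rw [schurGenTerm, schurGenTerm, h, schurFun_comp_perm]
  intro i
  unfold padOnes
  split_ifs
  exacts [hu _, one_ne_zero]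

/-- The two logarithms have equal exponentials, and near the symmetric point 1 their imaginary parts
differ by less than π. -/
theorem eventually_log_comp_perm {ρ : PMF (Signature (k + n))} {L : (Fin k → ℂ) → ℂ}
    (hLa : ContinuousAt L 1)
    (hL : ∀ᶠ u in 𝓝 (1 : Fin k → ℂ), Complex.exp (L u) = schurGen ρ (padOnes (k + n) u))
    (σ : Equiv.Perm (Fin k)) : ∀ᶠ u in 𝓝 (1 : Fin k → ℂ), L (u ∘ σ) = L u := by
  have hσ : Tendsto (fun u : Fin k → ℂ => u ∘ σ) (𝓝 1) (𝓝 1) :=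
    Continuous.tendsto' (by fun_prop) _ _ rfl
  have hc : Tendsto (fun u => (L (u ∘ σ) - L u).im) (𝓝 1) (𝓝 0) := by
    have h := (hLa.tendsto.comp hσ).sub hLa.tendsto
    rw [sub_self] at h
    exact (Complex.continuous_im.tendsto' 0 0 rfl).comp h
  have h0 : ∀ᶠ u in 𝓝 (1 : Fin k → ℂ), ∀ i, u i ≠ 0 := eventually_all.2 fun i =>
    (continuous_apply i).continuousAt.eventually_ne one_ne_zero
  filter_upwards [hL, hσ.eventually hL, h0, hc.eventually (Ioo_mem_nhds
    (neg_lt_zero.2 Real.pi_pos) Real.pi_pos)] with u h1 h2 h3 h4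
  rw [schurGen_comp_perm ρ σ h3, ← h1] at h2
  have h5 := Complex.log_exp h4.1 h4.2.le
  rw [Complex.exp_sub, h2, div_self (Complex.exp_ne_zero _), Complex.log_one] at h5
  exact (sub_eq_zero.1 h5.symm)

/-- The coefficients of the error term at the points with power sums `1 - z ^ m` are given by
polynomials in `z`. -/
theorem exists_polynomial_logError {ρ : PMF (Signature (k + n))} {Ψ Φ : ℂ → ℂ}
    (hΨ : AnalyticAt ℂ Ψ 1) (hΦ : AnalyticAt ℂ Φ 1) {L : (Fin k → ℂ) → ℂ} (hLa : AnalyticAt ℂ L 1)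
    (hL : ∀ᶠ u in 𝓝 (1 : Fin k → ℂ), Complex.exp (L u) = schurGen ρ (padOnes (k + n) u)) {m : ℕ}
    (hm : 1 ≤ m) : ∃ P : Polynomial ℂ, P.degree < m ∧ ∀ (c : Fin k → ℂ) (z : ℂ),
      (∀ m, 1 ≤ m → m ≤ k → ∑ i, c i ^ m = 1 - z ^ m) →
        PowerSeries.coeff m (taylorSeries fun x : ℂ => logError (k + n) Ψ Φ L (x • c)) =
          (1 - z) * P.eval z := by
  obtain ⟨f, hfh, hf⟩ := exists_isHomogeneous_taylorSeries
    (analyticAt_logError (N := k + n) hΨ hΦ hLa) m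
  -- Symmetry of Schur functions passes to the logarithm near 1, hence to the form of degree m of
  -- the error.
  have hsymm : f.IsSymmetric := by
    intro σ
    refine MvPolynomial.funext fun c => ?_
    rw [MvPolynomial.eval_rename, ← hf, ← hf, taylorSeries_congr]
    have hc : Tendsto (fun x : ℂ => fun i : Fin k => Complex.exp ((x • c) i)) (𝓝 0) (𝓝 1) :=
      Continuous.tendsto' (by fun_prop) _ _ (by funext i; simp)
    filter_upwards [hc.eventually (eventually_log_comp_perm hLa.continuousAt hL σ)] with x hx
    rw [logError, logError, ← hx]
    congr 1
    exact Equiv.sum_comp σ fun i => ((k + n : ℕ) : ℂ) * Ψ (Complex.exp ((x • c) i)) +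
      Φ (Complex.exp ((x • c) i))
  obtain ⟨P, hP, hP'⟩ := exists_polynomial_eval_symmetric hm hsymm hfh
  exact ⟨P, hP, fun c z hc => by rw [hf, hP' c z hc]⟩

end LocalExpansion

/-! ### First-order expansions in 1/N and rising factorials. -/

section Jets

/-- The sequence `a` has the expansion `a₀ + a₁ / N + o(1 / N)`. -/
def HasJet (a : ℕ → ℂ) (a₀ a₁ : ℂ) : Prop :=
  Tendsto (fun N : ℕ => (N : ℂ) * (a N - a₀)) atTop (𝓝 a₁)

theorem tendsto_one_div_natCast : Tendsto (fun N : ℕ => 1 / (N : ℂ)) atTop (𝓝 0) := by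
  simpa using tendsto_inv_atTop_nhds_zero_nat (𝕜 := ℂ)

theorem HasJet.tendsto {a : ℕ → ℂ} {a₀ a₁ : ℂ} (h : HasJet a a₀ a₁) : Tendsto a atTop (𝓝 a₀) := by
  have h1 := (tendsto_one_div_natCast.mul h).add_const a₀
  rw [zero_mul, zero_add] at h1
  refine h1.congr' ?_
  filter_upwards [eventually_ne_atTop 0] with N hN
  have : (N : ℂ) ≠ 0 := by exact_mod_cast hN
  field_simp
  ring

theorem HasJet.congr' {a b : ℕ → ℂ} {a₀ a₁ : ℂ} (h : HasJet a a₀ a₁) (hab : ∀ᶠ N in atTop, a N = b N) :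
    HasJet b a₀ a₁ :=
  Tendsto.congr' (hab.mono fun N hN => by rw [hN]) h

theorem hasJet_const (c : ℂ) : HasJet (fun _ => c) c 0 := by
  simp [HasJet]

theorem HasJet.add {a b : ℕ → ℂ} {a₀ a₁ b₀ b₁ : ℂ} (ha : HasJet a a₀ a₁) (hb : HasJet b b₀ b₁) :
    HasJet (fun N => a N + b N) (a₀ + b₀) (a₁ + b₁) := by
  refine (Tendsto.add ha hb).congr fun N => ?_
  ring

theorem HasJet.mul {a b : ℕ → ℂ} {a₀ a₁ b₀ b₁ : ℂ} (ha : HasJet a a₀ a₁) (hb : HasJet b b₀ b₁) :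
    HasJet (fun N => a N * b N) (a₀ * b₀) (a₀ * b₁ + a₁ * b₀) := by
  refine ((Tendsto.const_mul a₀ hb).add (Tendsto.mul ha hb.tendsto)).congr fun N => ?_
  ring

theorem HasJet.const_mul {a : ℕ → ℂ} {a₀ a₁ : ℂ} (c : ℂ) (ha : HasJet a a₀ a₁) :
    HasJet (fun N => c * a N) (c * a₀) (c * a₁) := by
  simpa using (hasJet_const c).mul ha

theorem HasJet.sum {ι : Type*} (s : Finset ι) {a : ι → ℕ → ℂ} {a₀ a₁ : ι → ℂ}
    (h : ∀ i ∈ s, HasJet (a i) (a₀ i) (a₁ i)) :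
    HasJet (fun N => ∑ i ∈ s, a i N) (∑ i ∈ s, a₀ i) (∑ i ∈ s, a₁ i) := by
  refine (tendsto_finsetSum s h).congr fun N => ?_
  rw [← Finset.sum_sub_distrib, Finset.mul_sum]

theorem hasJet_add_one_div_mul (c : ℂ) {y : ℕ → ℂ} {y₀ : ℂ} (hy : Tendsto y atTop (𝓝 y₀)) :
    HasJet (fun N => c + 1 / (N : ℂ) * y N) c y₀ := by
  refine hy.congr' ?_
  filter_upwards [eventually_ne_atTop 0] with N hN
  have : (N : ℂ) ≠ 0 := by exact_mod_cast hN
  field_simp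
  ring

/-- Coefficientwise expansion of a sequence of power series with polynomial coefficients. -/
def HasSeriesJet (w : ℕ → PowerSeries (Polynomial ℂ)) (w₀ w₁ : PowerSeries (Polynomial ℂ)) : Prop :=
  ∀ m a, HasJet (fun N => (PowerSeries.coeff m (w N)).coeff a) ((PowerSeries.coeff m w₀).coeff a)
    ((PowerSeries.coeff m w₁).coeff a)

theorem HasSeriesJet.mul {v w : ℕ → PowerSeries (Polynomial ℂ)}
    {v₀ v₁ w₀ w₁ : PowerSeries (Polynomial ℂ)} (hv : HasSeriesJet v v₀ v₁)
    (hw : HasSeriesJet w w₀ w₁) :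
    HasSeriesJet (fun N => v N * w N) (v₀ * w₀) (v₀ * w₁ + v₁ * w₀) := by
  intro m a
  simp only [PowerSeries.coeff_mul, Polynomial.finsetSum_coeff, Polynomial.coeff_mul, map_add,
    Polynomial.coeff_add, ← Finset.sum_add_distrib]
  exact HasJet.sum _ fun p _ => HasJet.sum _ fun q _ => (hv _ _).mul (hw _ _)

theorem HasSeriesJet.pow {w : ℕ → PowerSeries (Polynomial ℂ)} {w₀ w₁ : PowerSeries (Polynomial ℂ)}
    (hw : HasSeriesJet w w₀ w₁) (j : ℕ) :
    HasSeriesJet (fun N => w N ^ (j + 1)) (w₀ ^ (j + 1)) ((j + 1 : ℕ) * w₀ ^ j * w₁) := by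
  induction j with
  | zero => simpa using hw
  | succ j ih =>
    have h := ih.mul hw
    simp_rw [pow_succ _ (j + 1)]
    convert h using 1
    push_cast
    ring

/-- A degree bound independent of N, so that coefficientwise expansions can be summed. -/
theorem natDegree_coeff_pow_le {w : PowerSeries (Polynomial ℂ)}
    (hw : ∀ m, (PowerSeries.coeff m w).natDegree ≤ m) (j : ℕ) :
    ∀ m, (PowerSeries.coeff m (w ^ j)).natDegree ≤ m := by
  induction j with
  | zero =>
    intro m
    rw [pow_zero, PowerSeries.coeff_one]
    split_ifs <;> simp
  | succ j ih =>
    intro m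
    rw [pow_succ, PowerSeries.coeff_mul]
    refine Polynomial.natDegree_sum_le_of_forall_le _ _ fun p hp => ?_
    rw [Finset.HasAntidiagonal.mem_antidiagonal] at hp
    rw [← hp]
    exact Polynomial.natDegree_mul_le.trans (add_le_add (ih _) (hw _))

/-- The linear functional on polynomials sending `X ^ a` to `q a`. -/
noncomputable def coeffSum (q : ℕ → ℂ) (R : Polynomial ℂ) : ℂ :=
  R.sum fun a r => r * q a

theorem coeffSum_add (q : ℕ → ℂ) (R S : Polynomial ℂ) :
    coeffSum q (R + S) = coeffSum q R + coeffSum q S :=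
  Polynomial.sum_add_index R S _ (by simp) fun _ _ _ => add_mul _ _ _

theorem coeffSum_monomial (q : ℕ → ℂ) (a : ℕ) (r : ℂ) :
    coeffSum q (Polynomial.monomial a r) = r * q a :=
  Polynomial.sum_monomial_index r _ (zero_mul _)

theorem coeffSum_eq_sum_range (q : ℕ → ℂ) {R : Polynomial ℂ} {D : ℕ} (hR : R.natDegree < D) :
    coeffSum q R = ∑ a ∈ Finset.range D, R.coeff a * q a :=
  Polynomial.sum_over_range' R (by simp) D hR

theorem coeffSum_C_mul (q : ℕ → ℂ) (c : ℂ) (R : Polynomial ℂ) :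
    coeffSum q (Polynomial.C c * R) = c * coeffSum q R := by
  induction R using Polynomial.induction_on' with
  | add R S hR hS => rw [mul_add, coeffSum_add, hR, hS, coeffSum_add, mul_add]
  | monomial a r => rw [Polynomial.C_mul_monomial, coeffSum_monomial, coeffSum_monomial, mul_assoc]

theorem coeffSum_sum {ι : Type*} (q : ℕ → ℂ) (s : Finset ι) (R : ι → Polynomial ℂ) :
    coeffSum q (∑ i ∈ s, R i) = ∑ i ∈ s, coeffSum q (R i) := by
  classical
  induction s using Finset.induction_on with
  | empty => simp [coeffSum]
  | insert i s hi ih => rw [Finset.sum_insert hi, Finset.sum_insert hi, coeffSum_add, ih]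

/-- Summation by parts: multiplication by 1 - X is dual to a finite difference. -/
theorem coeffSum_one_sub_X_mul (q : ℕ → ℂ) (R : Polynomial ℂ) :
    coeffSum q ((1 - Polynomial.X) * R) = coeffSum (fun a => q a - q (a + 1)) R := by
  induction R using Polynomial.induction_on' with
  | add R S hR hS => rw [mul_add, coeffSum_add, hR, hS, coeffSum_add]
  | monomial a r =>
    rw [sub_mul, one_mul, Polynomial.X_mul_monomial, sub_eq_add_neg, ← map_neg, coeffSum_add,
      coeffSum_monomial, coeffSum_monomial, coeffSum_monomial]
    ring

/-- The product `(N - a)(N - a + 1) ⋯ (N - a + d - 1)`. -/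
noncomputable def shiftedRising (N d a : ℕ) : ℂ :=
  ∏ i ∈ Finset.range d, ((N : ℂ) - a + i)

theorem shiftedRising_sub (N d a : ℕ) :
    shiftedRising N (d + 1) a - shiftedRising N (d + 1) (a + 1) = (d + 1) * shiftedRising N d a := by
  rw [shiftedRising, Finset.prod_range_succ, shiftedRising, Finset.prod_range_succ', shiftedRising]
  have h : ∏ i ∈ Finset.range d, ((N : ℂ) - (a + 1 : ℕ) + (i + 1 : ℕ)) =
      ∏ i ∈ Finset.range d, ((N : ℂ) - a + i) :=
    Finset.prod_congr rfl fun i _ => by push_cast; ring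
  rw [h]
  push_cast
  ring

/-- Differences lower the degree of a rising factorial, so each factor 1 - X costs one power of N.
This balances the powers of N that accompany 1 - z in the exponential series. -/
theorem coeffSum_shiftedRising_pow_mul (N d i : ℕ) (R : Polynomial ℂ) :
    coeffSum (shiftedRising N (d + i)) ((1 - Polynomial.X) ^ i * R) =
      (d + i).factorial / d.factorial * coeffSum (shiftedRising N d) R := by
  induction i with
  | zero =>
    have : (d.factorial : ℂ) ≠ 0 := by exact_mod_cast Nat.factorial_ne_zero d
    simp [this]
  | succ i ih =>
    have h : (fun a => shiftedRising N (d + (i + 1)) a - shiftedRising N (d + (i + 1)) (a + 1)) =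
        fun a => ((d + i : ℕ) + 1) * shiftedRising N (d + i) a := by
      funext a
      exact shiftedRising_sub N (d + i) a
    have h2 : ∀ (c : ℂ) (q : ℕ → ℂ) (S : Polynomial ℂ),
        coeffSum (fun a => c * q a) S = c * coeffSum q S := by
      intro c q S
      rw [coeffSum, coeffSum, Polynomial.sum, Polynomial.sum, Finset.mul_sum]
      exact Finset.sum_congr rfl fun a _ => mul_left_comm _ _ _
    rw [pow_succ', mul_assoc, coeffSum_one_sub_X_mul, h, h2, ih, ← add_assoc, Nat.factorial_succ]
    push_cast
    ring

/-- The quotient is ∏ (1 + (i - a)/N) over i < d, and the sum of the i - a is d(d-1)/2 - d a. -/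
theorem hasJet_shiftedRising (d a : ℕ) :
    HasJet (fun N => shiftedRising N d a / (N : ℂ) ^ d) 1 (d * (d - 1) / 2 - d * a) := by
  have h : ∀ d, HasJet (fun N => ∏ i ∈ Finset.range d, (1 + 1 / (N : ℂ) * ((i : ℂ) - a))) 1
      (d * (d - 1) / 2 - d * a) := by
    intro d
    induction d with
    | zero => simpa using hasJet_const 1
    | succ d ih =>
      simp_rw [Finset.prod_range_succ]
      have h1 := ih.mul (hasJet_add_one_div_mul 1 (tendsto_const_nhds (x := (d : ℂ) - a)))
      convert h1 using 1
      · ring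
      · push_cast
        ring
  refine (h d).congr' ?_
  filter_upwards [eventually_ne_atTop 0] with N hN
  have : (N : ℂ) ≠ 0 := by exact_mod_cast hN
  rw [shiftedRising, ← Finset.card_range d, ← Finset.prod_const, Finset.card_range,
    ← Finset.prod_div_distrib]
  refine Finset.prod_congr rfl fun i _ => ?_
  field_simp
  ring

/-- The sums of the coefficients R_a and of a R_a are R(1) and R'(1). -/
theorem hasJet_coeffSum_shiftedRising (d : ℕ) {D : ℕ} {R : ℕ → Polynomial ℂ} {R₀ R₁ : Polynomial ℂ}
    (hR : ∀ᶠ N in atTop, (R N).natDegree < D) (hR₀ : R₀.natDegree < D) (hR₁ : R₁.natDegree < D)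
    (h : ∀ a, HasJet (fun N => (R N).coeff a) (R₀.coeff a) (R₁.coeff a)) :
    HasJet (fun N => coeffSum (shiftedRising N d) (R N) / (N : ℂ) ^ d) (R₀.eval 1)
      (R₁.eval 1 + d * (d - 1) / 2 * R₀.eval 1 - d * (Polynomial.derivative R₀).eval 1) := by
  have h1 := HasJet.sum (Finset.range D) fun a _ => (h a).mul (hasJet_shiftedRising d a)
  have h2 := h1.congr' (b := fun N => coeffSum (shiftedRising N d) (R N) / (N : ℂ) ^ d) (by
    filter_upwards [hR] with N hN
    rw [coeffSum_eq_sum_range _ hN, Finset.sum_div]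
    exact Finset.sum_congr rfl fun a _ => (mul_div_assoc _ _ _).symm)
  have e0 : R₀.eval 1 = ∑ a ∈ Finset.range D, R₀.coeff a := by
    rw [Polynomial.eval_eq_sum_range' hR₀]
    simp
  have e1 : R₁.eval 1 = ∑ a ∈ Finset.range D, R₁.coeff a := by
    rw [Polynomial.eval_eq_sum_range' hR₁]
    simp
  have e2 : (Polynomial.derivative R₀).eval 1 = ∑ a ∈ Finset.range D, R₀.coeff a * a := by
    rw [Polynomial.derivative_eval, Polynomial.sum_over_range' _ (by simp) D hR₀]
    simp
  convert h2 using 1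
  · simp [e0]
  · rw [e0, e1, e2, Finset.mul_sum, Finset.mul_sum, ← Finset.sum_add_distrib,
      ← Finset.sum_sub_distrib]
    exact Finset.sum_congr rfl fun a _ => by ring

end Jets

/-! ### The 1/N expansion of the moment functional. -/

section LimitSeries

/-- The polynomial `1 + X + ⋯ + X ^ (m - 1)`. -/
noncomputable def geomPoly (m : ℕ) : Polynomial ℂ :=
  ∑ i ∈ Finset.range m, Polynomial.X ^ i

theorem one_sub_mul_eval_geomPoly (m : ℕ) (z : ℂ) : (1 - z) * (geomPoly m).eval z = 1 - z ^ m := by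
  rw [geomPoly, Polynomial.eval_finsetSum]
  simpa using mul_neg_geom_sum z m

theorem eval_one_geomPoly (m : ℕ) : (geomPoly m).eval 1 = m := by
  simp [geomPoly, Polynomial.eval_finsetSum]

theorem two_mul_eval_one_derivative_geomPoly (m : ℕ) :
    2 * (Polynomial.derivative (geomPoly m)).eval 1 = m * (m - 1) := by
  induction m with
  | zero => simp [geomPoly]
  | succ m ih =>
    rw [geomPoly, Finset.sum_range_succ, Polynomial.derivative_add, Polynomial.eval_add, mul_add]
    rw [geomPoly] at ih
    rw [ih, Polynomial.derivative_X_pow]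
    simp
    ring

theorem natDegree_geomPoly_le (m : ℕ) : (geomPoly m).natDegree ≤ m - 1 := by
  refine Polynomial.natDegree_sum_le_of_forall_le _ _ fun i hi => ?_
  rw [Polynomial.natDegree_X_pow]
  have := Finset.mem_range.1 hi
  omega

/-- The polynomial in `z` of the cross terms with power sums `1 - z ^ a`, divided by
`(1 - z) ^ 2`. -/
noncomputable def crossPoly (m : ℕ) : Polynomial ℂ :=
  ∑ a ∈ Finset.range (m - 1), Polynomial.C ((-1) ^ (m - (a + 1)) * (m.choose (a + 1) : ℂ)) *
    (geomPoly (a + 1) * geomPoly (m - (a + 1)))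

theorem crossSum_eq_eval_crossPoly (m : ℕ) (z : ℂ) :
    crossSum (fun a => 1 - z ^ a) m = (1 - z) ^ 2 * (crossPoly m).eval z := by
  simp only [crossSum, crossPoly, Polynomial.eval_finsetSum, Polynomial.eval_mul, Polynomial.eval_C,
    Finset.mul_sum, ← one_sub_mul_eval_geomPoly]
  exact Finset.sum_congr rfl fun a _ => by ring

theorem natDegree_crossPoly_le (m : ℕ) : (crossPoly m).natDegree ≤ m - 1 := by
  refine Polynomial.natDegree_sum_le_of_forall_le _ _ fun a ha => ?_
  have := Finset.mem_range.1 ha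
  refine (Polynomial.natDegree_C_mul_le _ _).trans (Polynomial.natDegree_mul_le.trans ?_)
  have h1 := natDegree_geomPoly_le (a + 1)
  have h2 := natDegree_geomPoly_le (m - (a + 1))
  omega

/-- The leading part of the rescaled logarithm of the Schur generating function. -/
noncomputable def leadingSeries (κ : ℕ → ℂ) : PowerSeries (Polynomial ℂ) :=
  PowerSeries.mk fun m => Polynomial.C (κ m) * geomPoly m

/-- The correction of order `1 / N`, with error term `e`. -/
noncomputable def correctionSeries (ν g : ℕ → ℂ) (e : ℕ → Polynomial ℂ) :
    PowerSeries (Polynomial ℂ) :=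
  PowerSeries.mk fun m => Polynomial.C (ν m) * geomPoly m +
    Polynomial.C (g m / 2) * ((1 - Polynomial.X) * crossPoly m) + e m

theorem natDegree_correctionSeries_le (ν g : ℕ → ℂ) {e : ℕ → Polynomial ℂ}
    (he : ∀ m, (e m).natDegree ≤ m) (m : ℕ) :
    (PowerSeries.coeff m (correctionSeries ν g e)).natDegree ≤ m := by
  rw [correctionSeries, PowerSeries.coeff_mk]
  refine Polynomial.natDegree_add_le_of_degree_le (Polynomial.natDegree_add_le_of_degree_le ?_ ?_)
    (he m)
  · exact (Polynomial.natDegree_C_mul_le _ _).trans ((natDegree_geomPoly_le m).trans (by omega))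
  · rcases Nat.eq_zero_or_pos m with rfl | hm
    · simp [crossPoly]
    · refine (Polynomial.natDegree_C_mul_le _ _).trans (Polynomial.natDegree_mul_le.trans ?_)
      have h1 := natDegree_crossPoly_le m
      have h2 : (1 - Polynomial.X : Polynomial ℂ).natDegree ≤ 1 :=
        (Polynomial.natDegree_sub_le _ _).trans (by simp)
      omega

theorem natDegree_leadingSeries_le (κ : ℕ → ℂ) (m : ℕ) :
    (PowerSeries.coeff m (leadingSeries κ)).natDegree ≤ m := by
  rw [leadingSeries, PowerSeries.coeff_mk]
  exact (Polynomial.natDegree_C_mul_le _ _).trans ((natDegree_geomPoly_le m).trans (by omega))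

theorem hasSeriesJet_leading_add_correction (κ ν g : ℕ → ℂ) {e : ℕ → ℕ → Polynomial ℂ}
    (he : ∀ m a, Tendsto (fun N => (e N m).coeff a) atTop (𝓝 0)) :
    HasSeriesJet (fun N => leadingSeries κ +
        PowerSeries.C (Polynomial.C (1 / (N : ℂ))) * correctionSeries ν g (e N))
      (leadingSeries κ) (correctionSeries ν g 0) := by
  intro m a
  simp only [map_add, PowerSeries.coeff_C_mul, Polynomial.coeff_add, Polynomial.coeff_C_mul]
  refine hasJet_add_one_div_mul _ ?_
  simp only [correctionSeries, PowerSeries.coeff_mk, Polynomial.coeff_add, Pi.zero_apply,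
    Polynomial.coeff_zero]
  exact tendsto_const_nhds.add (he m a)

/-- The polynomial 1 + X + ... + X^(m-1) is palindromic, so its logarithmic derivative at 1 is
(m-1)/2. These add up under products, and j factors of total index m give (m-j)/2. -/
theorem two_mul_eval_one_derivative_leadingSeries_pow (κ : ℕ → ℂ) (j : ℕ) : ∀ m,
    2 * (Polynomial.derivative (PowerSeries.coeff m (leadingSeries κ ^ j))).eval 1 =
      (m - j) * (PowerSeries.coeff m (leadingSeries κ ^ j)).eval 1 := by
  induction j with
  | zero =>
    intro m
    rw [pow_zero, PowerSeries.coeff_one]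
    split_ifs with h <;> simp [h]
  | succ j ih =>
    intro m
    rw [pow_succ, PowerSeries.coeff_mul, Polynomial.derivative_sum, Polynomial.eval_finsetSum,
      Polynomial.eval_finsetSum, Finset.mul_sum, Finset.mul_sum]
    refine Finset.sum_congr rfl fun p hp => ?_
    rw [Finset.HasAntidiagonal.mem_antidiagonal] at hp
    rw [Polynomial.derivative_mul, Polynomial.eval_add, Polynomial.eval_mul, Polynomial.eval_mul,
      Polynomial.eval_mul, ← hp]
    have h1 := ih p.1
    have h2 : 2 * (Polynomial.derivative (PowerSeries.coeff p.2 (leadingSeries κ))).eval 1 =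
        (p.2 - 1) * (PowerSeries.coeff p.2 (leadingSeries κ)).eval 1 := by
      rw [leadingSeries, PowerSeries.coeff_mk, Polynomial.derivative_C_mul, Polynomial.eval_mul,
        Polynomial.eval_mul, Polynomial.eval_C, eval_one_geomPoly]
      linear_combination κ p.2 * two_mul_eval_one_derivative_geomPoly p.2
    push_cast
    linear_combination (PowerSeries.coeff p.2 (leadingSeries κ)).eval 1 * h1 +
      (PowerSeries.coeff p.1 (leadingSeries κ ^ j)).eval 1 * h2

theorem eval_coeff_eq_coeff_map (z : ℂ) (m : ℕ) (F : PowerSeries (Polynomial ℂ)) :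
    (PowerSeries.coeff m F).eval z =
      PowerSeries.coeff m (PowerSeries.map (Polynomial.evalRingHom z) F) := by
  rw [PowerSeries.coeff_map, Polynomial.coe_evalRingHom]

theorem map_eval_one_leadingSeries (κ : ℕ → ℂ) :
    PowerSeries.map (Polynomial.evalRingHom 1) (leadingSeries κ) =
      PowerSeries.mk fun m => m * κ m := by
  ext m
  rw [PowerSeries.coeff_map, leadingSeries, PowerSeries.coeff_mk, PowerSeries.coeff_mk,
    Polynomial.coe_evalRingHom, Polynomial.eval_mul, Polynomial.eval_C, eval_one_geomPoly, mul_comm]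

/-- The pair interaction still carries a factor 1 - X and disappears at 1. -/
theorem map_eval_one_correctionSeries (ν g : ℕ → ℂ) :
    PowerSeries.map (Polynomial.evalRingHom 1) (correctionSeries ν g 0) =
      PowerSeries.mk fun m => m * ν m := by
  ext m
  rw [PowerSeries.coeff_map, correctionSeries, PowerSeries.coeff_mk, PowerSeries.coeff_mk,
    Polynomial.coe_evalRingHom]
  simp [eval_one_geomPoly, mul_comm]

/-- The expansion of the rescaled moment functional. -/
theorem hasJet_moment_functional (k : ℕ) (κ ν g : ℕ → ℂ) {e : ℕ → ℕ → Polynomial ℂ}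
    (he : ∀ m a, Tendsto (fun N => (e N m).coeff a) atTop (𝓝 0))
    (hd : ∀ N m, (e N m).natDegree ≤ m) :
    HasJet (fun N => ∑ i ∈ Finset.range k, (k.factorial : ℂ) / ((i + 1).factorial * (k - i).factorial) *
      (coeffSum (shiftedRising N (k - i)) (PowerSeries.coeff k ((leadingSeries κ +
        PowerSeries.C (Polynomial.C (1 / (N : ℂ))) * correctionSeries ν g (e N)) ^ (i + 1))) /
          (N : ℂ) ^ (k - i)))
      (∑ i ∈ Finset.range k, (k.factorial : ℂ) / ((i + 1).factorial * (k - i).factorial) *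
        PowerSeries.coeff k ((PowerSeries.mk fun m => m * κ m) ^ (i + 1)))
      (∑ i ∈ Finset.range k, (k.factorial : ℂ) / ((i + 1).factorial * (k - i).factorial) *
        ((i + 1) * PowerSeries.coeff k ((PowerSeries.mk fun m => m * κ m) ^ i *
          PowerSeries.mk fun m => m * ν m))) := by
  refine HasJet.sum _ fun i hi => HasJet.const_mul _ ?_
  have hi := Finset.mem_range.1 hi
  have hjet := (hasSeriesJet_leading_add_correction κ ν g he).pow i k
  have hlt : ∀ {R : Polynomial ℂ}, R.natDegree ≤ k → R.natDegree < k + 1 := fun h => Nat.lt_succ_of_le h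
  have h0 := natDegree_coeff_pow_le (natDegree_leadingSeries_le κ) (i + 1) k
  have h1 : (PowerSeries.coeff k (((i + 1 : ℕ) : PowerSeries (Polynomial ℂ)) * leadingSeries κ ^ i *
      correctionSeries ν g 0)).natDegree ≤ k := by
    rw [mul_assoc, ← nsmul_eq_mul, map_nsmul, PowerSeries.coeff_mul]
    refine (Polynomial.natDegree_smul_le _ _).trans
      (Polynomial.natDegree_sum_le_of_forall_le _ _ fun p hp => ?_)
    rw [Finset.HasAntidiagonal.mem_antidiagonal] at hp
    rw [← hp]
    exact Polynomial.natDegree_mul_le.trans (add_le_add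
      (natDegree_coeff_pow_le (natDegree_leadingSeries_le κ) i _)
      (natDegree_correctionSeries_le ν g (by simp) _))
  have h2 : ∀ N : ℕ, (PowerSeries.coeff k ((leadingSeries κ +
      PowerSeries.C (Polynomial.C (1 / (N : ℂ))) * correctionSeries ν g (e N)) ^ (i + 1))).natDegree
        ≤ k := by
    intro N
    refine natDegree_coeff_pow_le (fun m => ?_) (i + 1) k
    rw [map_add, PowerSeries.coeff_C_mul]
    exact Polynomial.natDegree_add_le_of_degree_le (natDegree_leadingSeries_le κ m)
      ((Polynomial.natDegree_C_mul_le _ _).trans (natDegree_correctionSeries_le ν g (hd N) m))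
  have h3 := hasJet_coeffSum_shiftedRising (k - i) (Eventually.of_forall fun N => hlt (h2 N))
    (hlt h0) (hlt h1) hjet
  have h4 := two_mul_eval_one_derivative_leadingSeries_pow κ (i + 1) k
  convert h3 using 1
  · rw [eval_coeff_eq_coeff_map, ← map_eval_one_leadingSeries]
    congr 1
    exact (map_pow (PowerSeries.map (Polynomial.evalRingHom 1)) _ _).symm
  · rw [Nat.cast_sub hi.le]
    have h5 : (PowerSeries.coeff k (((i + 1 : ℕ) : PowerSeries (Polynomial ℂ)) *
        leadingSeries κ ^ i * correctionSeries ν g 0)).eval 1 =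
        (i + 1) * PowerSeries.coeff k ((PowerSeries.mk fun m => m * κ m) ^ i *
          PowerSeries.mk fun m => m * ν m) := by
      have h6 : PowerSeries.map (Polynomial.evalRingHom 1)
          (((i + 1 : ℕ) : PowerSeries (Polynomial ℂ)) * leadingSeries κ ^ i *
            correctionSeries ν g 0) = ((i + 1 : ℕ) : PowerSeries ℂ) *
          ((PowerSeries.mk fun m => m * κ m) ^ i * PowerSeries.mk fun m => m * ν m) := by
        simp only [map_mul, map_pow, map_natCast, map_eval_one_leadingSeries,
          map_eval_one_correctionSeries, mul_assoc]
      rw [eval_coeff_eq_coeff_map, h6, ← nsmul_eq_mul, map_nsmul, nsmul_eq_mul]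
      push_cast
      rfl
    rw [h5]
    push_cast at h4
    -- With d = k - i, `h4` says that 2 R₀'(1) = (d-1) R₀(1), so the terms d(d-1)/2 R₀(1) and -d
    -- R₀'(1) cancel.
    linear_combination ((k : ℂ) - i) / 2 * h4

end LimitSeries

/-! ### The expected power sum and its error terms. -/

section Assembly

/-- Needed because only the first k power sums of the special points are prescribed. -/
theorem coeff_pow_congr {F G : PowerSeries ℂ} {k : ℕ}
    (h : ∀ m ≤ k, PowerSeries.coeff m F = PowerSeries.coeff m G) (j : ℕ) :
    ∀ m ≤ k, PowerSeries.coeff m (F ^ j) = PowerSeries.coeff m (G ^ j) := by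
  induction j with
  | zero => intro m _; simp
  | succ j ih =>
    intro m hm
    rw [pow_succ, pow_succ, PowerSeries.coeff_mul, PowerSeries.coeff_mul]
    refine Finset.sum_congr rfl fun p hp => ?_
    rw [Finset.HasAntidiagonal.mem_antidiagonal] at hp
    rw [ih _ (by omega), h _ (by omega)]

theorem ascFactorial_eq_shiftedRising {k N : ℕ} (hkN : k ≤ N) (b : Fin k) :
    ((N - b).ascFactorial k : ℂ) = shiftedRising N k b := by
  rw [Nat.ascFactorial_eq_prod_range, shiftedRising]
  push_cast
  refine Finset.prod_congr rfl fun i _ => ?_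
  rw [Nat.cast_sub (b.2.le.trans hkN)]

/-- The identity holds for all z, so it may be divided by 1 - z as an identity of polynomials; the
remaining (1-z)^i is absorbed by the rising factorial. The term j = 0 drops out since k ≥ 1. -/
theorem sum_ascFactorial_eq_coeffSum {k N : ℕ} (hkN : k ≤ N) (H : Fin k → ℂ)
    (w : PowerSeries (Polynomial ℂ))
    (hH : ∀ z : ℂ, (1 - z) * ∑ b : Fin k, z ^ (b : ℕ) * H b =
      ∑ j ∈ Finset.range (k + 1), ((1 - z) * N) ^ j * (PowerSeries.coeff k (w ^ j)).eval z /
        j.factorial) (hk : 1 ≤ k) :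
    ∑ b : Fin k, ((N - b).ascFactorial k : ℂ) * H b =
      ∑ i ∈ Finset.range k, (N : ℂ) ^ (i + 1) * ((k.factorial : ℂ) /
        ((i + 1).factorial * (k - i).factorial) *
        coeffSum (shiftedRising N (k - i)) (PowerSeries.coeff k (w ^ (i + 1)))) := by
  have hX : (1 - Polynomial.X : Polynomial ℂ) ≠ 0 := by
    intro h
    have := congrArg (Polynomial.eval 0) h
    simp at this
  have hpoly : ∑ b : Fin k, Polynomial.monomial (b : ℕ) (H b) = ∑ i ∈ Finset.range k,
      Polynomial.C ((N : ℂ) ^ (i + 1) / (i + 1).factorial) *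
        ((1 - Polynomial.X) ^ i * PowerSeries.coeff k (w ^ (i + 1))) := by
    refine mul_left_cancel₀ hX (Polynomial.funext fun z => ?_)
    have h1 := hH z
    rw [Finset.sum_range_succ'] at h1
    have h2 : PowerSeries.coeff k (w ^ 0) = 0 := by
      rw [pow_zero, PowerSeries.coeff_one, if_neg (by omega)]
    rw [h2, Polynomial.eval_zero, mul_zero, zero_div, add_zero] at h1
    simp only [Polynomial.eval_mul, Polynomial.eval_sub, Polynomial.eval_one, Polynomial.eval_X,
      Polynomial.eval_finsetSum, Polynomial.eval_monomial, Polynomial.eval_C, Polynomial.eval_pow]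
    rw [Finset.sum_congr rfl fun (b : Fin k) _ => mul_comm (H b) _, h1, Finset.mul_sum]
    refine Finset.sum_congr rfl fun i _ => ?_
    rw [mul_pow (1 - z)]
    ring
  have h3 : ∑ b : Fin k, ((N - b).ascFactorial k : ℂ) * H b =
      coeffSum (shiftedRising N k) (∑ b : Fin k, Polynomial.monomial (b : ℕ) (H b)) := by
    rw [coeffSum_sum]
    refine Finset.sum_congr rfl fun b _ => ?_
    rw [coeffSum_monomial, ascFactorial_eq_shiftedRising hkN, mul_comm]
  rw [h3, hpoly, coeffSum_sum]
  refine Finset.sum_congr rfl fun i hi => ?_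
  have h4 := coeffSum_shiftedRising_pow_mul N (k - i) i (PowerSeries.coeff k (w ^ (i + 1)))
  rw [Nat.sub_add_cancel (Finset.mem_range.1 hi).le] at h4
  rw [coeffSum_C_mul, h4]
  ring

/-- The rescaled logarithm of the Schur generating function, as a series in the scaling variable with
coefficients polynomial in `z`. -/
noncomputable def logSeries (Ψ Φ : ℂ → ℂ) (N : ℕ) (e : ℕ → Polynomial ℂ) :
    PowerSeries (Polynomial ℂ) :=
  leadingSeries (fun m => PowerSeries.coeff m
      (taylorSeries fun u => Ψ (Complex.exp u) + logExpQuot u)) +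
    PowerSeries.C (Polynomial.C (1 / (N : ℂ))) * correctionSeries
      (fun m => PowerSeries.coeff m (taylorSeries fun u => Φ (Complex.exp u) - 1 / 2 * u))
      (fun m => PowerSeries.coeff m (taylorSeries logExpQuot)) e

theorem eval_coeff_logSeries (Ψ Φ : ℂ → ℂ) {N : ℕ} (hN : N ≠ 0) (e : ℕ → Polynomial ℂ) (m : ℕ)
    (z : ℂ) : (1 - z) * N * (PowerSeries.coeff m (logSeries Ψ Φ N e)).eval z =
      ((N : ℂ) * PowerSeries.coeff m (taylorSeries fun u => Ψ (Complex.exp u) + logExpQuot u) +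
        PowerSeries.coeff m (taylorSeries fun u => Φ (Complex.exp u) - 1 / 2 * u)) * (1 - z ^ m) +
      PowerSeries.coeff m (taylorSeries logExpQuot) / 2 * crossSum (fun a => 1 - z ^ a) m +
      (1 - z) * (e m).eval z := by
  have hN0 : (N : ℂ) ≠ 0 := by exact_mod_cast hN
  rw [crossSum_eq_eval_crossPoly, ← one_sub_mul_eval_geomPoly]
  simp only [logSeries, leadingSeries, correctionSeries, map_add, PowerSeries.coeff_C_mul,
    PowerSeries.coeff_mk, Polynomial.eval_add, Polynomial.eval_mul, Polynomial.eval_C,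
    Polynomial.eval_sub, Polynomial.eval_one, Polynomial.eval_X]
  generalize PowerSeries.coeff m (taylorSeries fun u => Ψ (Complex.exp u) + logExpQuot u) = x
  generalize PowerSeries.coeff m (taylorSeries fun u => Φ (Complex.exp u) - 1 / 2 * u) = y
  field_simp
  ring

theorem crossSum_congr {p q : ℕ → ℂ} {m : ℕ} (h : ∀ a, 1 ≤ a → a ≤ m → p a = q a) :
    crossSum p m = crossSum q m := by
  refine Finset.sum_congr rfl fun a ha => ?_
  have := Finset.mem_range.1 ha
  rw [h (a + 1) (by omega) (by omega), h (m - (a + 1)) (by omega) (by omega)]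

variable {k n : ℕ}

theorem hasSum_power_sum (hk : 1 ≤ k) {Ψ Φ : ℂ → ℂ} (hΨ : AnalyticAt ℂ Ψ 1) (hΦ : AnalyticAt ℂ Φ 1)
    {ρ : PMF (Signature (k + n))} {ε : ℝ} (hε : 0 < ε)
    (hs : ∀ u ∈ Metric.ball (1 : Fin k → ℂ) ε, Summable (schurGenTerm ρ (padOnes (k + n) u)))
    {L : (Fin k → ℂ) → ℂ} (hLa : AnalyticAt ℂ L 1) (h0 : L 1 = 0)
    (hL : ∀ᶠ u in 𝓝 (1 : Fin k → ℂ), Complex.exp (L u) = schurGen ρ (padOnes (k + n) u))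
    {e : ℕ → Polynomial ℂ} (he0 : e 0 = 0)
    (he : ∀ m, 1 ≤ m → m ≤ k → ∀ (c : Fin k → ℂ) (z : ℂ),
      (∀ m, 1 ≤ m → m ≤ k → ∑ i, c i ^ m = 1 - z ^ m) →
        PowerSeries.coeff m (taylorSeries fun x : ℂ => logError (k + n) Ψ Φ L (x • c)) =
          (1 - z) * (e m).eval z) :
    HasSum (fun l => ((ρ l).toReal : ℂ) * ∑ j, (l.shifted j : ℂ) ^ k)
      (∑ i ∈ Finset.range k, ((k + n : ℕ) : ℂ) ^ (i + 1) * ((k.factorial : ℂ) /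
        ((i + 1).factorial * (k - i).factorial) * coeffSum (shiftedRising (k + n) (k - i))
          (PowerSeries.coeff k (logSeries Ψ Φ (k + n) e ^ (i + 1))))) := by
  obtain ⟨H, hH, hz⟩ := exists_hasSum_power_sum hk ρ hε hs
  rw [← sum_ascFactorial_eq_coeffSum (Nat.le_add_right k n) H _ (fun z => ?_) hk]
  · exact hH
  -- At such a point the whole logarithm is, through degree k, (1-z) N times `logSeries` evaluated
  -- at z.
  · obtain ⟨c, hc⟩ := exists_sum_pow_eq k fun m => 1 - z ^ m
    rw [hz z c hc, coeff_taylorSeries_schurGen hLa h0 hL c k]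
    refine Finset.sum_congr rfl fun j _ => ?_
    congr 1
    let F : PowerSeries ℂ := PowerSeries.C ((1 - z) * ((k + n : ℕ) : ℂ)) *
      PowerSeries.map (Polynomial.evalRingHom z) (logSeries Ψ Φ (k + n) e)
    have h1 : ∀ m ≤ k, PowerSeries.coeff m (taylorSeries fun x : ℂ => logSchurGen n L (x • c)) =
        PowerSeries.coeff m F := by
      intro m hm
      rw [PowerSeries.coeff_C_mul, ← eval_coeff_eq_coeff_map, eval_coeff_logSeries _ _ (by omega)]
      rcases Nat.eq_zero_or_pos m with rfl | hm1
      · rw [PowerSeries.coeff_zero_eq_constantCoeff, constantCoeff_taylorSeries, zero_smul,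
          logSchurGen_zero h0, he0]
        simp [crossSum]
      · rw [coeff_taylorSeries_logSchurGen hΨ hΦ hLa c hm1, hc m hm1 hm, he m hm1 hm c z hc,
          crossSum_congr fun a ha1 ha => hc a ha1 (ha.trans hm)]
    rw [coeff_pow_congr h1 j k le_rfl, mul_pow, ← map_pow, ← map_pow, PowerSeries.coeff_C_mul,
      ← eval_coeff_eq_coeff_map]

/-- In exponential coordinates the hypothesis says that the error tends to 0 uniformly near 0, and
Cauchy's estimate passes to the coefficients. -/
theorem tendsto_coeff_logError {Ψ Φ : ℂ → ℂ} (hΨ : AnalyticAt ℂ Ψ 1) (hΦ : AnalyticAt ℂ Φ 1)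
    {ε : ℝ} (hε : 0 < ε) {L : ℕ → (Fin k → ℂ) → ℂ}
    (hL : ∀ᶠ N in atTop, AnalyticOnNhd ℂ (L N) (Metric.ball 1 ε))
    (hu : TendstoUniformlyOn
      (fun (N : ℕ) (u : Fin k → ℂ) => (N : ℂ) * (1 / (N : ℂ) * L N u - ∑ i : Fin k, Ψ (u i)))
      (fun u : Fin k → ℂ => ∑ i : Fin k, Φ (u i)) atTop (Metric.ball 1 ε)) (c : Fin k → ℂ) (m : ℕ) :
    Tendsto (fun N => PowerSeries.coeff m
      (taylorSeries fun x : ℂ => logError N Ψ Φ (L N) (x • c))) atTop (𝓝 0) := by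
  have hcont : Tendsto (fun x : ℂ => fun i : Fin k => Complex.exp ((x • c) i)) (𝓝 0) (𝓝 1) :=
    Continuous.tendsto' (by fun_prop) _ _ (by funext i; simp)
  have hconti : ∀ i, Tendsto (fun x : ℂ => Complex.exp ((x • c) i)) (𝓝 0) (𝓝 1) := fun i =>
    Continuous.tendsto' (by fun_prop) _ _ (by simp)
  obtain ⟨R, hR, hball⟩ := Metric.eventually_nhds_iff_ball.1
    ((hcont.eventually (Metric.ball_mem_nhds 1 hε)).and (eventually_all.2 fun i =>
      ((hconti i).eventually (hΨ.eventually_analyticAt.and hΦ.eventually_analyticAt))))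
  refine tendsto_coeff_taylorSeries_zero hR ?_ ?_ m
  · filter_upwards [hL] with N hN x hx
    obtain ⟨h1, h2⟩ := hball x hx
    have hexp : DifferentiableAt ℂ (fun x : ℂ => fun i : Fin k => Complex.exp ((x • c) i)) x := by
      simp only [Pi.smul_apply, smul_eq_mul]
      fun_prop
    have hexpi : ∀ i, DifferentiableAt ℂ (fun x : ℂ => Complex.exp ((x • c) i)) x := by
      simp only [Pi.smul_apply, smul_eq_mul]
      fun_prop
    refine DifferentiableAt.differentiableWithinAt ?_
    refine DifferentiableAt.fun_sub (DifferentiableAt.fun_comp' (g := L N) x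
      (hN _ h1).differentiableAt hexp) (DifferentiableAt.fun_sum fun i _ => ?_)
    exact DifferentiableAt.fun_add (DifferentiableAt.const_mul (DifferentiableAt.fun_comp' (g := Ψ) x
      (h2 i).1.differentiableAt (hexpi i)) _) (DifferentiableAt.fun_comp' (g := Φ) x
      (h2 i).2.differentiableAt (hexpi i))
  · rw [Metric.tendstoUniformlyOn_iff] at hu ⊢
    intro η hη
    filter_upwards [hu η hη, eventually_ne_atTop 0] with N hN hN0 x hx
    have h1 := hN _ (hball x hx).1
    have h2 : (N : ℂ) ≠ 0 := by exact_mod_cast hN0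
    rw [dist_comm, dist_eq_norm] at h1 ⊢
    convert h1 using 2
    rw [logError, sub_zero, Finset.sum_add_distrib, ← Finset.mul_sum, mul_sub, ← mul_assoc,
      mul_one_div_cancel h2, one_mul, sub_sub]

/-- The error polynomials exist for all large `N` and their coefficients tend to `0`. -/
theorem exists_error_polynomials {Ψ Φ : ℂ → ℂ} (hΨ : AnalyticAt ℂ Ψ 1) (hΦ : AnalyticAt ℂ Φ 1)
    (ρ : (N : ℕ) → PMF (Signature N)) {ε : ℝ} (hε : 0 < ε) {L : ℕ → (Fin k → ℂ) → ℂ}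
    (hL : ∀ᶠ N in atTop, AnalyticOnNhd ℂ (L N) (Metric.ball 1 ε) ∧
      ∀ u ∈ Metric.ball (1 : Fin k → ℂ) ε, Complex.exp (L N u) = schurGen (ρ N) (padOnes N u))
    (hu : TendstoUniformlyOn
      (fun (N : ℕ) (u : Fin k → ℂ) => (N : ℂ) * (1 / (N : ℂ) * L N u - ∑ i : Fin k, Ψ (u i)))
      (fun u : Fin k → ℂ => ∑ i : Fin k, Φ (u i)) atTop (Metric.ball 1 ε)) :
    ∃ e : ℕ → ℕ → Polynomial ℂ, (∀ N, e N 0 = 0) ∧ (∀ N m, (e N m).natDegree ≤ m) ∧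
      (∀ m a, Tendsto (fun N => (e N m).coeff a) atTop (𝓝 0)) ∧
      ∀ᶠ N in atTop, ∀ m, 1 ≤ m → m ≤ k → ∀ (c : Fin k → ℂ) (z : ℂ),
      (∀ m, 1 ≤ m → m ≤ k → ∑ i, c i ^ m = 1 - z ^ m) →
        PowerSeries.coeff m (taylorSeries fun x : ℂ => logError N Ψ Φ (L N) (x • c)) =
          (1 - z) * (e N m).eval z := by
  -- Outside the relevant range of N and m the zero polynomial is taken, so that the degree bounds
  -- hold for all N and m.
  have hex : ∀ N m : ℕ, ∃ P : Polynomial ℂ, P.natDegree ≤ m ∧ (P = 0 ∨ 1 ≤ m ∧ m ≤ k ∧ P.degree < m) ∧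
      (k ≤ N → (AnalyticOnNhd ℂ (L N) (Metric.ball 1 ε) ∧
      ∀ u ∈ Metric.ball (1 : Fin k → ℂ) ε, Complex.exp (L N u) = schurGen (ρ N) (padOnes N u)) →
      1 ≤ m → m ≤ k → ∀ (c : Fin k → ℂ) (z : ℂ),
      (∀ m, 1 ≤ m → m ≤ k → ∑ i, c i ^ m = 1 - z ^ m) →
        PowerSeries.coeff m (taylorSeries fun x : ℂ => logError N Ψ Φ (L N) (x • c)) =
          (1 - z) * P.eval z) := by
    intro N m
    by_cases hN : k ≤ N ∧ (AnalyticOnNhd ℂ (L N) (Metric.ball 1 ε) ∧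
      ∀ u ∈ Metric.ball (1 : Fin k → ℂ) ε, Complex.exp (L N u) = schurGen (ρ N) (padOnes N u)) ∧
      1 ≤ m ∧ m ≤ k
    · obtain ⟨hkN, hLN, hm1, hm⟩ := hN
      obtain ⟨n, rfl⟩ := Nat.exists_eq_add_of_le hkN
      obtain ⟨P, hP, hP'⟩ := exists_polynomial_logError (ρ := ρ (k + n)) hΨ hΦ
        (hLN.1 1 (Metric.mem_ball_self hε))
        (by filter_upwards [Metric.ball_mem_nhds 1 hε] with u hu using hLN.2 u hu) hm1
      exact ⟨P, Polynomial.natDegree_le_of_degree_le hP.le, Or.inr ⟨hm1, hm, hP⟩, fun _ _ _ _ => hP'⟩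
    · exact ⟨0, by simp, Or.inl rfl, fun h1 h2 h3 h4 => absurd ⟨h1, h2, h3, h4⟩ hN⟩
  choose e hdeg hdeg' he using hex
  have hlarge : ∀ᶠ N in atTop, ∀ m, 1 ≤ m → m ≤ k → ∀ (c : Fin k → ℂ) (z : ℂ),
      (∀ m, 1 ≤ m → m ≤ k → ∑ i, c i ^ m = 1 - z ^ m) →
        PowerSeries.coeff m (taylorSeries fun x : ℂ => logError N Ψ Φ (L N) (x • c)) =
          (1 - z) * (e N m).eval z := by
    filter_upwards [hL, eventually_ge_atTop k] with N hN hkN m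
    exact he N m hkN hN
  refine ⟨e, fun N => ?_, hdeg, fun m a => ?_, hlarge⟩
  · rcases hdeg' N 0 with h | h
    · exact h
    · omega
  · by_cases hm : 1 ≤ m ∧ m ≤ k
    swap
    · have h0 : ∀ N, e N m = 0 := fun N => (hdeg' N m).resolve_right fun h => hm ⟨h.1, h.2.1⟩
      simp [h0]
    have hdlt : ∀ N, (e N m).degree < k := fun N => by
      rcases hdeg' N m with h | h
      · rw [h, Polynomial.degree_zero]
        exact WithBot.bot_lt_coe k
      · exact h.2.2.trans_le (by exact_mod_cast h.2.1)
    by_cases ha : a < k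
    swap
    · have h0 : ∀ N, (e N m).coeff a = 0 := fun N => Polynomial.coeff_eq_zero_of_degree_lt
        ((hdlt N).trans_le (by exact_mod_cast not_lt.1 ha))
      simp [h0]
    -- The coefficients are fixed combinations of the values at z = 2, ..., k+1, and each value is a
    -- Taylor coefficient of the error at a fixed point, divided by 1 - z.
    obtain ⟨w, hw⟩ := exists_interpolation_weights k
    choose c hc using fun s : Fin k => exists_sum_pow_eq k fun m => 1 - ((s : ℂ) + 2) ^ m
    have hne : ∀ s : Fin k, 1 - ((s : ℂ) + 2) ≠ 0 := fun s h =>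
      Nat.cast_add_one_ne_zero (R := ℂ) (s : ℕ) (by linear_combination -h)
    have hlim : Tendsto (fun N => ∑ s : Fin k, w ⟨a, ha⟩ s * (PowerSeries.coeff m
        (taylorSeries fun x : ℂ => logError N Ψ Φ (L N) (x • c s)) / (1 - ((s : ℂ) + 2)))) atTop
        (𝓝 (∑ s : Fin k, w ⟨a, ha⟩ s * (0 / (1 - ((s : ℂ) + 2))))) :=
      tendsto_finsetSum _ fun s _ => ((tendsto_coeff_logError hΨ hΦ hε (hL.mono fun N h => h.1) hu
        (c s) m).div_const _).const_mul _
    simp only [zero_div, mul_zero, Finset.sum_const_zero] at hlim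
    refine hlim.congr' ?_
    filter_upwards [hlarge] with N hN
    have h1 := hw (fun b : Fin k => (e N m).coeff b) ⟨a, ha⟩
    rw [h1]
    refine Finset.sum_congr rfl fun s _ => ?_
    rw [hN m hm.1 hm.2 (c s) _ (hc s), mul_div_cancel_left₀ _ (hne s)]
    congr 1
    have hnat : (e N m).natDegree < k := by
      rcases eq_or_ne (e N m) 0 with h0 | h0
      · rw [h0, Polynomial.natDegree_zero]
        omega
      · exact (Polynomial.natDegree_lt_iff_degree_lt h0).2 (hdlt N)
    rw [Polynomial.eval_eq_sum_range' hnat, ← Fin.sum_univ_eq_sum_range (fun b => (e N m).coeff b * ((s : ℂ) + 2) ^ b)]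
    exact Finset.sum_congr rfl fun b _ => mul_comm _ _

end Assembly

/-! ### Binomial resummation and the proof of the theorem. -/

section Limits

theorem mk_mul_eq_X_mul_derivative (F : PowerSeries ℂ) :
    (PowerSeries.mk fun m => m * PowerSeries.coeff m F) =
      PowerSeries.X * PowerSeries.derivative ℂ F := by
  ext m
  rw [PowerSeries.coeff_mk, coeff_X_mul_derivative]

theorem mk_kappaOne (Φ : ℂ → ℂ) :
    (PowerSeries.mk fun n => if n = 0 then 0 else kappaOne Φ n) = PowerSeries.mk fun m =>
      m * PowerSeries.coeff m (taylorSeries fun u => Φ (Complex.exp u) - 1 / 2 * u) := by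
  ext n
  rw [PowerSeries.coeff_mk, PowerSeries.coeff_mk, coeff_taylorSeries]
  split_ifs with h
  · simp [h]
  · obtain ⟨n, rfl⟩ := Nat.exists_eq_succ_of_ne_zero h
    rw [kappaOne, Nat.factorial_succ, Nat.succ_sub_one]
    have hm : (n : ℂ) + 1 ≠ 0 := Nat.cast_add_one_ne_zero n
    have hf : (n.factorial : ℂ) ≠ 0 := by exact_mod_cast Nat.factorial_ne_zero n
    push_cast
    generalize iteratedDeriv n.succ (fun u => Φ (Complex.exp u) - 1 / 2 * u) 0 = x
    field_simp

theorem coeff_eq_zero_of_X_pow_dvd {F : PowerSeries ℂ} {k : ℕ}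
    (h : PowerSeries.X ^ (k + 1) ∣ F) : PowerSeries.coeff k F = 0 :=
  PowerSeries.X_pow_dvd_iff.1 h k (Nat.lt_succ_self k)

/-- Here (k+1) k! / ((i+1)! (k-i)!) is the binomial coefficient of k+1 over i+1; the powers 0 and
k+1 of C have no coefficient in degree k. -/
theorem sum_choose_coeff_pow {C : PowerSeries ℂ} (hC : PowerSeries.X ∣ C) {k : ℕ} (hk : 1 ≤ k) :
    (k + 1) * ∑ i ∈ Finset.range k, (k.factorial : ℂ) / ((i + 1).factorial * (k - i).factorial) *
      PowerSeries.coeff k (C ^ (i + 1)) = PowerSeries.coeff k ((1 + C) ^ (k + 1)) := by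
  rw [add_comm 1 C, add_pow, map_sum, Finset.sum_range_succ, Finset.sum_range_succ']
  have h1 : PowerSeries.coeff k (C ^ (k + 1)) = 0 :=
    coeff_eq_zero_of_X_pow_dvd (pow_dvd_pow_of_dvd hC _)
  have h2 : PowerSeries.coeff k (1 : PowerSeries ℂ) = 0 := by
    rw [PowerSeries.coeff_one, if_neg (by omega)]
  simp only [one_pow, mul_one, Nat.choose_self, Nat.cast_one, h1, add_zero, pow_zero,
    Nat.choose_zero_right, h2, Finset.mul_sum]
  refine Finset.sum_congr rfl fun i hi => ?_
  have hi := Finset.mem_range.1 hi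
  rw [mul_comm (C ^ (i + 1)), ← nsmul_eq_mul _ (C ^ (i + 1)), map_nsmul, nsmul_eq_mul,
    Nat.cast_choose ℂ (by omega : i + 1 ≤ k + 1), Nat.factorial_succ k,
    show k + 1 - (i + 1) = k - i by omega]
  push_cast
  ring

/-- Likewise (i+1) k! / ((i+1)! (k-i)!) is k over i, and C^k D starts in degree k+1. -/
theorem sum_choose_coeff_pow_mul {C D : PowerSeries ℂ} (hC : PowerSeries.X ∣ C)
    (hD : PowerSeries.X ∣ D) (k : ℕ) :
    ∑ i ∈ Finset.range k, (k.factorial : ℂ) / ((i + 1).factorial * (k - i).factorial) *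
      ((i + 1) * PowerSeries.coeff k (C ^ i * D)) = PowerSeries.coeff k ((1 + C) ^ k * D) := by
  rw [add_comm 1 C, add_pow, Finset.sum_mul, map_sum, Finset.sum_range_succ]
  have h1 : PowerSeries.coeff k (C ^ k * 1 ^ (k - k) * (k.choose k : PowerSeries ℂ) * D) = 0 := by
    refine coeff_eq_zero_of_X_pow_dvd ?_
    rw [Nat.choose_self, Nat.cast_one, mul_one, one_pow, mul_one, pow_succ]
    exact mul_dvd_mul (pow_dvd_pow_of_dvd hC _) hD
  rw [h1, add_zero]
  refine Finset.sum_congr rfl fun i hi => ?_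
  have hi := Finset.mem_range.1 hi
  rw [one_pow, mul_one, mul_comm (C ^ i) (k.choose i : PowerSeries ℂ), mul_assoc,
    ← nsmul_eq_mul _ (C ^ i * D), map_nsmul, nsmul_eq_mul,
    Nat.cast_choose ℂ hi.le, Nat.factorial_succ i]
  have hm : (i : ℂ) + 1 ≠ 0 := Nat.cast_add_one_ne_zero i
  push_cast
  field_simp

theorem sum_toReal_eq_one {α : Type*} (p : PMF α) : HasSum (fun a => (p a).toReal) 1 := by
  have h := ENNReal.hasSum_toReal (f := fun a => p a) (by rw [p.tsum_coe]; exact ENNReal.one_ne_top)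
  have h2 : ∑' a, (p a).toReal = 1 := by
    rw [← ENNReal.tsum_toReal_eq fun a => p.apply_ne_top a, p.tsum_coe, ENNReal.toReal_one]
  rwa [h2] at h

theorem hasSum_momentTerm {N : ℕ} {ρ : PMF (Signature N)} {k : ℕ} {s : ℂ}
    (h : HasSum (fun l => ((ρ l).toReal : ℂ) * ∑ j, (l.shifted j : ℂ) ^ k) s) :
    Summable (momentTerm ρ k) ∧ (expectedMoment ρ k : ℂ) = 1 / (N : ℂ) ^ (k + 1) * s := by
  have h1 : HasSum (fun l => (momentTerm ρ k l : ℂ)) (1 / (N : ℂ) ^ k * s) := by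
    refine (h.mul_left (1 / (N : ℂ) ^ k)).congr_fun fun l => ?_
    rw [momentTerm]
    push_cast
    simp only [div_pow, ← Finset.sum_div]
    ring
  have h2 : Summable (momentTerm ρ k) := Complex.summable_ofReal.1 h1.summable
  refine ⟨h2, ?_⟩
  rw [expectedMoment]
  push_cast
  rw [h1.tsum_eq, pow_succ]
  ring

end Limits

theorem mainTheorem8 (ρ : (N : ℕ) → PMF (Signature N)) (Ψ Φ : ℂ → ℂ)
    (hΨ : AnalyticAt ℂ Ψ 1) (hΦ : AnalyticAt ℂ Φ 1)
    (hρ : SchurGenAsymptotics ρ Ψ Φ) (k : ℕ) :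
    (∀ᶠ N : ℕ in atTop, Summable (momentTerm (ρ N) k)) ∧
    Tendsto
      (fun N : ℕ => (N : ℂ) * ((expectedMoment (ρ N) k : ℂ) - limitMoment Ψ k)) atTop
      (𝓝 (∑ π ∈ nonCrossing k, ∑ V ∈ π.parts,
        kappaOne Φ V.card * ∏ W ∈ π.parts.erase V, kappaZero Ψ W.card)) := by
  -- The values 1 and 0 at index 0 are normalizations; blocks are nonempty, so they never enter the
  -- sum.
  have hNC := sum_nonCrossing_derivative (fun n => if n = 0 then 1 else kappaZero Ψ n)
    (fun n => if n = 0 then 0 else kappaOne Φ n) (if_pos rfl) (if_pos rfl) k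
  have hcard : ∀ {π : Finpartition (Finset.univ : Finset (Fin k))} {V}, V ∈ π.parts → V.card ≠ 0 :=
    fun hV => (Finset.card_pos.2 (Finpartition.nonempty_of_mem_parts _ hV)).ne'
  have hsum : ∑ π ∈ nonCrossing k, ∑ V ∈ π.parts,
      kappaOne Φ V.card * ∏ W ∈ π.parts.erase V, kappaZero Ψ W.card =
      PowerSeries.coeff k ((PowerSeries.mk fun n => if n = 0 then 1 else kappaZero Ψ n) ^ k *
        PowerSeries.mk fun n => if n = 0 then 0 else kappaOne Φ n) := by
    rw [← hNC]
    refine Finset.sum_congr rfl fun π _ => Finset.sum_congr rfl fun V hV => ?_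
    rw [if_neg (hcard hV)]
    congr 1
    refine Finset.prod_congr rfl fun W hW => ?_
    rw [if_neg (hcard (Finset.mem_of_mem_erase hW))]
  have hm := limitMoment_eq hΨ k
  rw [hsum]
  set κ : ℕ → ℂ := fun m => PowerSeries.coeff m
    (taylorSeries fun u => Ψ (Complex.exp u) + logExpQuot u) with hκ
  set ν : ℕ → ℂ := fun m => PowerSeries.coeff m
    (taylorSeries fun u => Φ (Complex.exp u) - 1 / 2 * u) with hν
  have hC : (PowerSeries.mk fun n => if n = 0 then 1 else kappaZero Ψ n) =
      1 + PowerSeries.mk fun m => m * κ m := by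
    rw [mk_kappaZero, mk_mul_eq_X_mul_derivative]
  have hXC : PowerSeries.X ∣ PowerSeries.mk fun m => m * κ m := by
    rw [mk_mul_eq_X_mul_derivative]
    exact dvd_mul_right _ _
  have hXD : PowerSeries.X ∣ PowerSeries.mk fun m => m * ν m := by
    rw [mk_mul_eq_X_mul_derivative]
    exact dvd_mul_right _ _
  rw [hC] at hm
  rw [hC, mk_kappaOne, ← sum_choose_coeff_pow_mul hXC hXD]
  -- For k = 0 the moment is exactly 1 for N ≠ 0, and the sum over partitions is empty; the
  -- determinant argument needs k ≥ 1.
  rcases Nat.eq_zero_or_pos k with rfl | hk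
  · have hH : ∀ N, HasSum (fun l => ((ρ N l).toReal : ℂ) * ∑ j, (l.shifted j : ℂ) ^ 0) N := by
      intro N
      have h1 : HasSum (fun l => ((ρ N l).toReal : ℂ)) ((1 : ℝ) : ℂ) :=
        Complex.hasSum_ofReal.2 (sum_toReal_eq_one (ρ N))
      simpa using h1.mul_right (N : ℂ)
    refine ⟨Eventually.of_forall fun N => (hasSum_momentTerm (hH N)).1, ?_⟩
    have hm1 : limitMoment Ψ 0 = 1 := by simpa using hm
    rw [Finset.range_zero, Finset.sum_empty]
    refine tendsto_const_nhds.congr' ?_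
    filter_upwards [eventually_ne_atTop 0] with N hN
    have hN0 : (N : ℂ) ≠ 0 := by exact_mod_cast hN
    rw [(hasSum_momentTerm (hH N)).2, hm1]
    simp [hN0]
  · obtain ⟨ε, hε, L, hev, hu⟩ := hρ k
    obtain ⟨e, he0, hdeg, hlim, he⟩ := exists_error_polynomials hΨ hΦ ρ hε
      (hev.mono fun N h => ⟨h.2.1, h.2.2.2⟩) hu
    have hH : ∀ᶠ N : ℕ in atTop, HasSum (fun l => ((ρ N l).toReal : ℂ) * ∑ j, (l.shifted j : ℂ) ^ k)
        (∑ i ∈ Finset.range k, (N : ℂ) ^ (i + 1) * ((k.factorial : ℂ) /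
        ((i + 1).factorial * (k - i).factorial) * coeffSum (shiftedRising N (k - i))
          (PowerSeries.coeff k (logSeries Ψ Φ N (e N) ^ (i + 1))))) := by
      filter_upwards [hev, he, eventually_ge_atTop k] with N hN heN hkN
      obtain ⟨n, rfl⟩ := Nat.exists_eq_add_of_le hkN
      exact hasSum_power_sum hk hΨ hΦ hε hN.1 (hN.2.1 1 (Metric.mem_ball_self hε)) hN.2.2.1
        (by filter_upwards [Metric.ball_mem_nhds 1 hε] with u hu using hN.2.2.2 u hu) (he0 _) heN
    refine ⟨hH.mono fun N h => (hasSum_momentTerm h).1, ?_⟩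
    have hjet := hasJet_moment_functional k κ ν
      (fun m => PowerSeries.coeff m (taylorSeries logExpQuot)) hlim hdeg
    have hm2 : limitMoment Ψ k = ∑ i ∈ Finset.range k, (k.factorial : ℂ) /
        ((i + 1).factorial * (k - i).factorial) *
          PowerSeries.coeff k ((PowerSeries.mk fun m => m * κ m) ^ (i + 1)) :=
      mul_left_cancel₀ (Nat.cast_add_one_ne_zero (R := ℂ) k)
        (hm.trans (sum_choose_coeff_pow hXC hk).symm)
    rw [hm2]
    refine hjet.congr' ?_
    filter_upwards [hH, eventually_ne_atTop 0] with N hN hN0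
    have hN0 : (N : ℂ) ≠ 0 := by exact_mod_cast hN0
    rw [(hasSum_momentTerm hN).2, Finset.mul_sum]
    refine Finset.sum_congr rfl fun i hi => ?_
    have hi := Finset.mem_range.1 hi
    -- The normalization N^(k+1) is shared between the power from the exponential series and the
    -- rising factorial of degree k - i.
    have hpow : (N : ℂ) ^ (k + 1) = N ^ (i + 1) * N ^ (k - i) := by
      rw [← pow_add]
      congr 1
      omega
    have hlog : logSeries Ψ Φ N (e N) = leadingSeries κ + PowerSeries.C (Polynomial.C (1 / (N : ℂ))) *
      correctionSeries ν (fun m => PowerSeries.coeff m (taylorSeries logExpQuot)) (e N) := rfl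
    rw [hpow, hlog]
    generalize coeffSum _ _ = x
    field_simp
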